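/- \textbf{Setting.} Let $K$ be a non-archimedean local field of characteristic $\neq 2$, $\overline K$ an algebraic closure, and $\nu:\overline K\to\mathbb Q\cup\{\infty\}$ the extension of the valuation of $K$ with $\nu(K^\times)=\mathbb Z$. An \emph{octad} is an ordered $8$-tuple $O=(O_A,\dots,O_H)$ of points of $\mathbb P^3(\overline K)$. It is a \emph{Cayley octad} if its points are pairwise distinct and are exactly the common zeros of a net spanned by three linearly independent quadrics. It is \emph{normalised} if five of its points are $(1:0:0:0),(0:1:0:0),(0:0:1:0),(0:0:0:1),(1:1:1:1)$, in some order. \textbf{Valuation data.} Let $\mathcal P$ be the set of $4$-element subsets of $\{A,\dots,H\}$. Choose representatives $x_A,\dots,x_H\in\overline K^4$ of the points of $O$, each with minimal coordinate valuation $0$, and put $p_{ijkl}=\det(x_i|x_j|x_k|x_l)$. The valuation data of $O$ is $(v,t)\in\mathbb Q^{\mathcal P}\times\mathbb Q$, where $v_{ijkl}=\nu(p_{ijkl})$ and $t$ is the twisted cubic index $$t=\min\big(\nu(M_1-M_2)-\min(\nu(M_1),\nu(M_2))\big),$$ the minimum being over all orderings $(a_0,\dots,a_7)$ of the labels (this gives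 $840$ binomials up to sign), with $p_{ijkl}$ standing for $p_{a_ia_ja_ka_l}$ in $$M_1=p_{0123}\,p_{0145}\,p_{0246}\,p_{0356},\qquad M_2=p_{0124}\,p_{0135}\,p_{0236}\,p_{0456}.$$ All these quantities are required to be finite. \textbf{Blocks.} For a set $T$ of labels let $v_{pt}^T,v_{ln}^T,v_{pln}^T$ be the valuation data whose twisted cubic index is $0$ and whose entry at $S\in\mathcal P$ is $\max(0,|S\cap T|-1)$, $\max(0,|S\cap T|-2)$, $\max(0,|S\cap T|-3)$ respectively. Let $v_{tc}$ have all entries $0$ and twisted cubic index $1$. Sums, positive rational multiples and maxima $\vee$ are taken componentwise. Let $E_3$ be the $6$-dimensional $\mathbb F_2$-space of subsets of $\{A,\dots,H\}$ of even cardinality modulo complementation, with symmetric difference as addition and the symplectic form $\langle I,J\rangle=|I\cap J|\bmod 2$, and let $\mathrm{Sp}(6,2)$ be the group of its isometries. The \emph{blocks}, up to a permutation of the labels, are the following $19$ valuation data. Each is listed with its \emph{picture}: a subspace of $E_3$, a pair of orthogonal subspaces (in the $\phi$ case, unordered) or a subset of $E_3$. $\alpha$-blocks. \begin{itemize} \item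 Picture $\langle AB\rangle$: $\alpha_{1a}=v_{pt}^{AB}$, $\alpha_{1b}=v_{pln}^{CDEFGH}$. \item Picture $\langle ABCD\rangle$: $\alpha_{2a}=v_{pln}^{ABCD}+v_{pln}^{EFGH}$, $\alpha_{2b}=v_{pln}^{ABCD}+v_{pt}^{ABCD}$. \end{itemize} $\chi$-blocks. \begin{itemize} \item Picture $\langle AB,ACDE\rangle$: $\chi_{1a}=(v_{ln}^{CDE}+v_{ln}^{FGH})\vee v_{pln}^{CDEFGH}$, $\chi_{1b}=v_{pt}^{AB}\vee(v_{pln}^{ABCDE}+v_{pln}^{ABFGH})$, $\chi_{1c}=(v_{ln}^{ABCDE}+v_{ln}^{CDE})\vee v_{pt}^{CDE}$. \item Picture $\langle AB,AC\rangle$: $\chi_{2a}=v_{ln}^{DEFGH}+v_{pln}^{DEFGH}$, $\chi_{2b}=v_{ln}^{ABC}+v_{pt}^{ABC}$, $\chi_{2c}=v_{ln}^{ABC}+v_{pln}^{DEFGH}$. \end{itemize} $\phi$-blocks. \begin{itemize} \item Picture $\{\langle AB,CD,ACEF\rangle,\langle EF,GH,ABEG\rangle\}$: $\phi_{1a}=v_{ln}^{ABEF}+v_{ln}^{ABGH}+v_{pln}^{ABCD}+v_{pln}^{EFGH}$,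 $\phi_{1b}=(v_{pt}^{AB}+v_{pt}^{CD})\vee(v_{pln}^{ABCDEF}+v_{pln}^{ABCDGH})$. \item Picture $\{\langle AB,BC,DE\rangle,\langle FG,FH,DE\rangle\}$: $\phi_{2a}=(v_{ln}^{ABC}+v_{ln}^{FGH})\vee(v_{pln}^{ABCDE}+v_{pln}^{DEFGH})$, $\phi_{2b}=v_{pt}^{DE}+v_{ln}^{ABCD}+v_{ln}^{ABCE}$, $\phi_{2c}=v_{ln}^{ABCD}+v_{ln}^{ABCE}+v_{pln}^{ABCFGH}$. \item Picture $\{\langle AB,AC,AD\rangle,\langle EF,EG,EH\rangle\}$: $\phi_{3a}=v_{ln}^{ABCD}+v_{pln}^{ABCD}+v_{pln}^{EFGH}$, $\phi_{3b}=v_{pt}^{ABCD}+v_{ln}^{ABCD}+v_{pln}^{ABCD}$. \end{itemize} Hyperelliptic blocks. \begin{itemize} \item $\mathrm{TCu}=v_{tc}$; picture: $0$ and the $28$ classes of pairs of labels. \item $\mathrm{Line}^{ABCD}=v_{ln}^{ABCD}$; picture: $0$ and the classes of all $S\cup T$ with $S\subseteq ABCD$, $T\subseteq EFGH$ and $|S|-|T|=\pm2$.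 \end{itemize} \textbf{Cremona transformations and $\mathrm{Sp}(6,2)$.} Let $S|S^c$ be a partition of the labels into two quadruples. The Cremona transformation at $S$ acts on classes of octads modulo $\mathrm{PGL}_4(\overline K)$: move the points of $S$ to the coordinate points and invert the coordinates of the other four points (which must be nonzero). It is attached to the transvection $a\mapsto a+\langle a,S\rangle S$ of $E_3$. A permutation $\rho$ of the labels acts by relabelling the octad, and on $E_3$ by $T\mapsto\rho(T)$. Every $\tau\in\mathrm{Sp}(6,2)$ is a relabelling, possibly followed by one such transvection; an octad $O'$ is said to \emph{represent} $\tau\cdot[O]$ if, up to $\mathrm{PGL}_4(\overline K)$, it is obtained from $O$ by the relabelling and, if needed, the Cremona transformation of some such expression of $\tau$. \textbf{Statement.} Let $O$ be a Cayley octad whose valuation data is $m\cdot B$ with $B$ a single block and $m>0$ rational. Let $\tau\in\mathrm{Sp}(6,2)$. Then $\tau\cdot[O]$ is represented by some normalised octad, and every normalised octad $O'$ representing $\tau\cdot[O]$ is a Cayley octad with valuation data $m\cdot B'$ for a block $B'$ in the same class ($\alpha$, $\chi$, $\phi$ or hyperelliptic) as $B$, such that the picture of $B'$ is the image under $\tau$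 of the picture of $B$. In particular, every Cremona transformation takes an octad with a single $\alpha$-, $\chi$-, $\phi$- or hyperelliptic block to an octad with a single block of the same class, whose picture is the image under the corresponding transvection; and the map $d_K$ from Cayley octads to octad pictures commutes with $\mathrm{Sp}(6,2)$ on octads with one-block pictures. -/

import Mathlib

open scoped LinearAlgebra.Projectivization

noncomputable section

namespace CayleyOctad

/-! ### Octads -/

/-- The eight labels `A, …, H` are `0, …, 7`. An octad is an ordered 8-tuple of points of `ℙ³`. -/
abbrev Octad (L : Type*) [Field L] : Type _ := Fin 8 → ℙ L (Fin 4 → L)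

section Octads

variable {L : Type*} [Field L]

/-- `x` consists of affine representatives of the points of `O`. -/
def IsLift (x : Fin 8 → Fin 4 → L) (O : Octad L) : Prop :=
  ∀ i, ∃ h : x i ≠ 0, Projectivization.mk L (x i) h = O i

/-- The eight points are pairwise distinct, and they are exactly the base points of a net of
quadrics, spanned by three quadrics. -/
def IsCayleyOctad (O : Octad L) : Prop :=
  Function.Injective O ∧
  ∃ Q : Fin 3 → QuadraticForm L (Fin 4 → L), LinearIndependent L Q ∧
    ∀ (v : Fin 4 → L) (hv : v ≠ 0),
      (∀ k, Q k v = 0) ↔ ∃ i, O i = Projectivization.mk L v hv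

/-- Two octads lie in the same orbit of the projective linear group of `ℙ³`. -/
def PGLEquiv (O O' : Octad L) : Prop :=
  ∃ M : LinearMap.GeneralLinearGroup L (Fin 4 → L), ∀ i, O' i = M • O i

/-- Five of the eight points are `(1:0:0:0), …, (0:0:0:1), (1:1:1:1)`. -/
def IsNormalised (O : Octad L) : Prop :=
  ∃ (s : Fin 5 ↪ Fin 8) (x : Fin 8 → Fin 4 → L), IsLift x O ∧
    (∀ k : Fin 4, x (s k.castSucc) = Pi.single k 1) ∧ x (s (Fin.last 4)) = fun _ => 1

/-- Relabelling of an octad: the point of `O` with label `i` gets the label `ρ i`. -/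
def permOctad (ρ : Equiv.Perm (Fin 8)) (O : Octad L) : Octad L := fun i => O (ρ.symm i)

/-- The standard Cremona transformation based at the points with labels `s 0, …, s 3`: these are
the coordinate points, and the coordinates of the other four points are inverted. -/
def IsStandardCremona (s : Fin 4 ↪ Fin 8) (O O' : Octad L) : Prop :=
  ∃ x y : Fin 8 → Fin 4 → L, IsLift x O ∧ IsLift y O' ∧
    (∀ k, x (s k) = Pi.single k 1 ∧ y (s k) = Pi.single k 1) ∧
    ∀ i, i ∉ Set.range s → ∀ j, x i j ≠ 0 ∧ y i j = (x i j)⁻¹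

/-- `O'` represents the image, under the Cremona transformation of the partition `S | Sᶜ`, of the
projective equivalence class of `O`. -/
def CremonaRel (S : Finset (Fin 8)) (O O' : Octad L) : Prop :=
  ∃ s : Fin 4 ↪ Fin 8, Finset.univ.map s = S ∧
    ∃ O₁ O₂ : Octad L, PGLEquiv O O₁ ∧ IsStandardCremona s O₁ O₂ ∧ PGLEquiv O₂ O'

end Octads

/-! ### The symplectic space `E₃` -/

/-- Subsets of the eight labels, as vectors over `𝔽₂`, of even cardinality. -/
def evenSubsets : Submodule (ZMod 2) (Fin 8 → ZMod 2) :=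
  LinearMap.ker (∑ i, LinearMap.proj i : (Fin 8 → ZMod 2) →ₗ[ZMod 2] ZMod 2)

lemma mem_evenSubsets (x : Fin 8 → ZMod 2) : x ∈ evenSubsets ↔ ∑ i, x i = 0 := by
  simp [evenSubsets]

/-- The full set of labels. -/
def fullSet : evenSubsets := ⟨fun _ => 1, by rw [mem_evenSubsets]; decide⟩

/-- Even subsets modulo complementation, with symmetric difference as addition. -/
abbrev E3 : Type := evenSubsets ⧸ Submodule.span (ZMod 2) {fullSet}

/-- The class in `E₃` of a subset of even cardinality. -/
def cls (T : Finset (Fin 8)) (hT : Even T.card) : E3 :=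
  Submodule.Quotient.mk ⟨fun i => if i ∈ T then 1 else 0, by
    rw [mem_evenSubsets, Finset.sum_boole, Finset.filter_univ_mem]
    exact hT.natCast_zmod_two⟩

/-- The form `|I ∩ J| mod 2` on subsets. -/
def dotForm : (Fin 8 → ZMod 2) →ₗ[ZMod 2] (Fin 8 → ZMod 2) →ₗ[ZMod 2] ZMod 2 :=
  LinearMap.mk₂ (ZMod 2) (fun x y => ∑ i, x i * y i)
    (by intro x y z; simp [add_mul, Finset.sum_add_distrib])
    (by intro c x y; simp [mul_assoc, Finset.mul_sum])
    (by intro x y z; simp [mul_add, Finset.sum_add_distrib])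
    (by intro c x y; simp [mul_left_comm, Finset.mul_sum])

/-- The symplectic pairing `⟨I, J⟩ = |I ∩ J| mod 2` on `E₃`. -/
def pairing : E3 →ₗ[ZMod 2] E3 →ₗ[ZMod 2] ZMod 2 :=
  Submodule.liftQ _
    (LinearMap.flip (Submodule.liftQ _
      (LinearMap.flip (dotForm.domRestrict₁₂ evenSubsets evenSubsets)) (by
        rw [Submodule.span_singleton_le_iff_mem, LinearMap.mem_ker]
        ext x
        have hx := (mem_evenSubsets x.1).1 x.2
        change ∑ i, x.1 i * (1 : ZMod 2) = 0
        simpa using hx))) (by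
    rw [Submodule.span_singleton_le_iff_mem, LinearMap.mem_ker]
    ext y
    have hy := (mem_evenSubsets y.1).1 y.2
    change ∑ i, (1 : ZMod 2) * y.1 i = 0
    simpa using hy)

/-- `Sp(6,2)` consists of the linear automorphisms of `E₃` that preserve the pairing. -/
def IsSymplectic (τ : E3 ≃ₗ[ZMod 2] E3) : Prop :=
  ∀ a b, pairing (τ a) (τ b) = pairing a b

/-- The action of a permutation of the labels on `E₃`, sending the class of `T` to that
of `ρ(T)`. -/
def permE3 (ρ : Equiv.Perm (Fin 8)) : E3 →ₗ[ZMod 2] E3 :=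
  Submodule.mapQ _ _
    ((LinearMap.funLeft (ZMod 2) (ZMod 2) ρ.symm).restrict (p := evenSubsets) (q := evenSubsets)
      (by
        intro x hx
        rw [mem_evenSubsets] at hx ⊢
        simpa [LinearMap.funLeft_apply] using (Equiv.sum_comp ρ.symm x).trans hx))
    (by
      rw [Submodule.span_singleton_le_iff_mem, Submodule.mem_comap]
      have : (LinearMap.funLeft (ZMod 2) (ZMod 2) ρ.symm).restrict (p := evenSubsets)
          (q := evenSubsets) (by
            intro x hx
            rw [mem_evenSubsets] at hx ⊢
            simpa [LinearMap.funLeft_apply] using (Equiv.sum_comp ρ.symm x).trans hx) fullSet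
          = fullSet := by
        ext i; rfl
      rw [this]
      exact Submodule.mem_span_singleton_self _)

/-- The symplectic transvection `a ↦ a + ⟨a, u⟩ u`. For `u` the class of `ijkl`, with complement
`pqrs`, it fixes `ij`, `pq`, `il`, `ps` and exchanges `kr` and `ijlr`; this is the element of
`Sp(6,2)` attached to the Cremona transformation `ijkl | pqrs`. -/
def transvection (u : E3) : E3 →ₗ[ZMod 2] E3 :=
  LinearMap.id + (pairing.flip u).smulRight u

/-- `O'` represents the image under `τ ∈ Sp(6,2)` of the projective equivalence class of `O`:
`τ` is written as a permutation of the labels followed by one of the 36 Cremona transformations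
(the identity, or the one attached to a partition `S | Sᶜ` into two quadruples). -/
def SpImage {L : Type*} [Field L] (τ : E3 ≃ₗ[ZMod 2] E3) (O O' : Octad L) : Prop :=
  ∃ ρ : Equiv.Perm (Fin 8),
    (τ.toLinearMap = permE3 ρ ∧ PGLEquiv (permOctad ρ O) O') ∨
    ∃ (S : Finset (Fin 8)) (hS : S.card = 4),
      τ.toLinearMap = transvection (cls S (hS ▸ by decide)) ∘ₗ permE3 ρ ∧
        CremonaRel S (permOctad ρ O) O'

/-! ### Valuation data -/

/-- The set `P` of quadruples of labels. -/
abbrev Quadruple : Type := {S : Finset (Fin 8) // S.card = 4}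

/-- A valuation datum: a vector indexed by the quadruples together with a twisted cubic index. Sums,
rational multiples and maxima (`⊔`) are taken componentwise. -/
abbrev ValData : Type := (Quadruple → ℚ) × ℚ

/-- `ν` extends the valuation of `K` to `L` and is normalised with respect to `K`: the nonzero
elements of `K` have integral valuations, and the value `1` is attained. -/
def IsNormalisedExtension (K : Type*) {L : Type*} [Field K] [ValuativeRel K] [Field L]
    [Algebra K L] (ν : AddValuation L (WithTop ℚ)) : Prop :=
  (∀ a : K, 0 ≤ ν (algebraMap K L a) ↔ ValuativeRel.valuation K a ≤ 1) ∧
  (∀ a : K, a ≠ 0 → ∃ n : ℤ, ν (algebraMap K L a) = ((n : ℚ) : WithTop ℚ)) ∧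
  ∃ ϖ : K, ν (algebraMap K L ϖ) = ((1 : ℚ) : WithTop ℚ)

section Valuations

variable {L : Type*} [Field L]

/-- The Plücker coordinate `det (x_i | x_j | x_k | x_l)`. -/
def plucker (x : Fin 8 → Fin 4 → L) (i j k l : Fin 8) : L :=
  Matrix.det (Matrix.of ![x i, x j, x k, x l])

/-- First monomial of the condition that the points `π 1, …, π 6`, projected from `π 0`, lie on a
conic. -/
def cubicMonomial₁ (x : Fin 8 → Fin 4 → L) (π : Equiv.Perm (Fin 8)) : L :=
  plucker x (π 0) (π 1) (π 2) (π 3) * plucker x (π 0) (π 1) (π 4) (π 5) *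
    plucker x (π 0) (π 2) (π 4) (π 6) * plucker x (π 0) (π 3) (π 5) (π 6)

/-- Second monomial of the same condition. The condition is the vanishing of the difference of the
two monomials; up to sign, this gives 840 binomials as `π` varies, and they vanish when the eight
points lie on a twisted cubic. -/
def cubicMonomial₂ (x : Fin 8 → Fin 4 → L) (π : Equiv.Perm (Fin 8)) : L :=
  plucker x (π 0) (π 1) (π 2) (π 4) * plucker x (π 0) (π 1) (π 3) (π 5) *
    plucker x (π 0) (π 2) (π 3) (π 6) * plucker x (π 0) (π 4) (π 5) (π 6)

/-- `t` is the twisted cubic index: the minimum over the 840 binomials of the gap between the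
valuation of the binomial and its value in the absence of cancellation, the smaller of the
valuations of the two monomials. -/
def IsTwistedCubicIndex (ν : AddValuation L (WithTop ℚ)) (x : Fin 8 → Fin 4 → L) (t : ℚ) : Prop :=
  (∀ π, (t : WithTop ℚ) + min (ν (cubicMonomial₁ x π)) (ν (cubicMonomial₂ x π)) ≤
      ν (cubicMonomial₁ x π - cubicMonomial₂ x π)) ∧
  ∃ π, (t : WithTop ℚ) + min (ν (cubicMonomial₁ x π)) (ν (cubicMonomial₂ x π)) =
      ν (cubicMonomial₁ x π - cubicMonomial₂ x π)

/-- `v` is the valuation data of `O`, computed from representatives whose coordinates have minimal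
valuation `0`. -/
def HasValuationData (ν : AddValuation L (WithTop ℚ)) (O : Octad L) (v : ValData) : Prop :=
  ∃ x : Fin 8 → Fin 4 → L, IsLift x O ∧
    (∀ i, (∀ j, 0 ≤ ν (x i j)) ∧ ∃ j, ν (x i j) = 0) ∧
    (∀ S : Quadruple, ν (plucker x (S.1.orderEmbOfFin S.2 0) (S.1.orderEmbOfFin S.2 1)
      (S.1.orderEmbOfFin S.2 2) (S.1.orderEmbOfFin S.2 3)) = (v.1 S : WithTop ℚ)) ∧
    IsTwistedCubicIndex ν x v.2

end Valuations

/-- Point coincidence vector. -/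
def vpt (T : Finset (Fin 8)) : ValData := (fun S => max 0 (((S.1 ∩ T).card : ℚ) - 1), 0)

/-- Line coincidence vector. -/
def vln (T : Finset (Fin 8)) : ValData := (fun S => max 0 (((S.1 ∩ T).card : ℚ) - 2), 0)

/-- Plane coincidence vector. -/
def vpln (T : Finset (Fin 8)) : ValData := (fun S => max 0 (((S.1 ∩ T).card : ℚ) - 3), 0)

/-- Twisted cubic coincidence vector. -/
def vtc : ValData := (fun _ => 0, 1)

/-! ### Building blocks -/

/-- The 19 building blocks, up to labelling. -/
inductive BlockType : Type
  | alpha1a | alpha1b | alpha2a | alpha2b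
  | chi1a | chi1b | chi1c | chi2a | chi2b | chi2c
  | phi1a | phi1b | phi2a | phi2b | phi2c | phi3a | phi3b
  | tcu | line

/-- The four classes of blocks. -/
inductive BlockClass : Type
  | alpha | chi | phi | hyperelliptic

namespace BlockType

/-- The class of a block. -/
def blockClass : BlockType → BlockClass
  | alpha1a | alpha1b | alpha2a | alpha2b => .alpha
  | chi1a | chi1b | chi1c | chi2a | chi2b | chi2c => .chi
  | phi1a | phi1b | phi2a | phi2b | phi2c | phi3a | phi3b => .phi
  | tcu | line => .hyperelliptic

/-- Valuation data of the blocks in their standard labelling (`A = 0, …, H = 7`):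
`α₁^{AB}`, `α₂^{ABCD}`, `χ₁^{AB|CDE|FGH}`, `χ₂^{ABC}`, `φ₁^{AB|CD‖EF|GH}`, `φ₂^{ABC|FGH}`,
`φ₃^{ABCD}`, `TCu`, `Line^{ABCD}`. -/
def valData : BlockType → ValData
  | alpha1a => vpt {0, 1}
  | alpha1b => vpln {2, 3, 4, 5, 6, 7}
  | alpha2a => vpln {0, 1, 2, 3} + vpln {4, 5, 6, 7}
  | alpha2b => vpln {0, 1, 2, 3} + vpt {0, 1, 2, 3}
  | chi1a => (vln {2, 3, 4} + vln {5, 6, 7}) ⊔ vpln {2, 3, 4, 5, 6, 7}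
  | chi1b => vpt {0, 1} ⊔ (vpln {0, 1, 2, 3, 4} + vpln {0, 1, 5, 6, 7})
  | chi1c => (vln {0, 1, 2, 3, 4} + vln {2, 3, 4}) ⊔ vpt {2, 3, 4}
  | chi2a => vln {3, 4, 5, 6, 7} + vpln {3, 4, 5, 6, 7}
  | chi2b => vln {0, 1, 2} + vpt {0, 1, 2}
  | chi2c => vln {0, 1, 2} + vpln {3, 4, 5, 6, 7}
  | phi1a => vln {0, 1, 4, 5} + vln {0, 1, 6, 7} + vpln {0, 1, 2, 3} + vpln {4, 5, 6, 7}
  | phi1b => (vpt {0, 1} + vpt {2, 3}) ⊔ (vpln {0, 1, 2, 3, 4, 5} + vpln {0, 1, 2, 3, 6, 7})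
  | phi2a => (vln {0, 1, 2} + vln {5, 6, 7}) ⊔ (vpln {0, 1, 2, 3, 4} + vpln {3, 4, 5, 6, 7})
  | phi2b => vpt {3, 4} + vln {0, 1, 2, 3} + vln {0, 1, 2, 4}
  | phi2c => vln {0, 1, 2, 3} + vln {0, 1, 2, 4} + vpln {0, 1, 2, 5, 6, 7}
  | phi3a => vln {0, 1, 2, 3} + vpln {0, 1, 2, 3} + vpln {4, 5, 6, 7}
  | phi3b => vpt {0, 1, 2, 3} + vln {0, 1, 2, 3} + vpln {0, 1, 2, 3}
  | tcu => vtc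
  | line => vln {0, 1, 2, 3}

/-- The span in `E₃` of three even subsets. -/
def spanOf (T₁ T₂ T₃ : Finset (Fin 8)) (h₁ : Even T₁.card := by decide)
    (h₂ : Even T₂.card := by decide) (h₃ : Even T₃.card := by decide) : Set E3 :=
  Submodule.span (ZMod 2) {cls T₁ h₁, cls T₂ h₂, cls T₃ h₃}

/-- The subset of `E₃` attached to the twisted cubic block: `0` and the classes of pairs. -/
def tcuSubset : Set E3 :=
  {a | a = 0 ∨ ∃ (T : Finset (Fin 8)) (h : Even T.card), T.card = 2 ∧ a = cls T h}

/-- The subset of `E₃` attached to the line block `ABCD`: `0` and the classes of `S ∪ T` with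
`S ⊆ ABCD`, `T ⊆ EFGH` and `|S| - |T| = ± 2`. -/
def lineSubset : Set E3 :=
  {a | a = 0 ∨ ∃ (S T : Finset (Fin 8)) (h : Even (S ∪ T).card), S ⊆ {0, 1, 2, 3} ∧
    T ⊆ {4, 5, 6, 7} ∧ (S.card = T.card + 2 ∨ T.card = S.card + 2) ∧ a = cls (S ∪ T) h}

/-- The picture of a block in its standard labelling, recorded by the subspace or subset of `E₃`
attached to it. For a `φ`-block the two mutually orthogonal subspaces attached to it are both
recorded. -/
def picture : BlockType → Set (Set E3)
  | alpha1a | alpha1b => {spanOf {0, 1} ∅ ∅}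
  | alpha2a | alpha2b => {spanOf {0, 1, 2, 3} ∅ ∅}
  | chi1a | chi1b | chi1c => {spanOf {0, 1} {0, 2, 3, 4} ∅}
  | chi2a | chi2b | chi2c => {spanOf {0, 1} {0, 2} ∅}
  | phi1a | phi1b => {spanOf {0, 1} {2, 3} {0, 2, 4, 5}, spanOf {4, 5} {6, 7} {0, 1, 4, 6}}
  | phi2a | phi2b | phi2c => {spanOf {0, 1} {1, 2} {3, 4}, spanOf {5, 6} {5, 7} {3, 4}}
  | phi3a | phi3b => {spanOf {0, 1} {0, 2} {0, 3}, spanOf {4, 5} {4, 6} {4, 7}}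
  | tcu => {tcuSubset}
  | line => {lineSubset}

end BlockType

/-- A building block: one of the 19 types with a labelling. -/
structure Block where
  /-- The type of the block. -/
  type : BlockType
  /-- The labelling: `labelling A, …, labelling H` replace `A, …, H`. -/
  labelling : Equiv.Perm (Fin 8)

namespace Block

/-- The class of a block. -/
def blockClass (B : Block) : BlockClass := B.type.blockClass

/-- The valuation data of a block. -/
def valData (B : Block) : ValData :=
  (fun S => B.type.valData.1 ⟨S.1.map B.labelling.symm.toEmbedding, by
    rw [Finset.card_map]; exact S.2⟩, B.type.valData.2)

/-- The picture of a block. -/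
def picture (B : Block) : Set (Set E3) :=
  (fun X => permE3 B.labelling '' X) '' B.type.picture

end Block

end CayleyOctad

end

/-! Self-dual lifts. Quadrics in four variables form a space of dimension ten, and three independent
ones vanish on the octad, so the eight points impose at most seven conditions. Hence there is a
linear relation between the squares of their coordinate vectors. In general position all its
coefficients are nonzero, and over an algebraically closed field their square roots can be absorbed
into the vectors. The resulting lift satisfies `SelfDual`, that is, the sum of the `x i ⊗ x i`
vanishes. For such a lift complementary 4×4 minors agree up to sign (`SelfDual.minor_sq`), and all
840 binomials agree up to sign (`SelfDual.cubicForm_sq`). The valuations of the octad are then a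
complement-symmetric function on quadruples and one further number, `cubicNu`. The twisted cubic
index compares this number with the monomials.

Cremona transformations. In a frame formed by four of the points, the transformation inverts the
coordinates of the other four. It sends the net to the net with reversed mixed coefficients
(`IsInversion.isNetBase`), and the square relation of the image is explicit. Each minor of the image
is, up to monomials in the coordinates, a minor or a conic condition of the source. No cancellation
has to be controlled: the valuations of the image satisfy linear equations, `CremonaEquations`,
which determine them up to an additive constant (`CremonaEquations.unique`).

Finite verification. Blocks with the same picture differ only by a rescaling of the points, and
passing to a self-dual lift removes this difference. The 19 blocks thus become 9 shapes with
complement-symmetric weights (`HasShape`). For every shape and each of the 35 splittings of the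
labels it remains to check that the Cremona equations are solved by a relabelled shape of the same
class whose picture is the transvected one. This is `Shape.tableCheck_eq_true`.

Return to blocks. A normalised octad with primitive coordinates has a prescribed scaling. Wherever
the five frame labels lie, some block of the shape has its values compatible with this scaling, and
then it is the valuation data (`HasShape.exists_hasValuationData`).

Group theory. The form `|T| / 2 mod 2` polarises to the pairing. A symplectic map changes it by the
pairing with a vector `u` on which it vanishes, and the transvection in `u` undoes this change. A
symplectic map preserving the form is a relabelling (`IsSymplectic.exists_decomposition`). -/

open scoped LinearAlgebra.Projectivization

noncomputable section

namespace CayleyOctad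

/-! ### Minors, conic conditions and relations between squares. -/

section Minors
variable {L : Type*} [Field L]

/-- The determinant of the four vectors with labels `f 0, …, f 3`. -/
def minor (x : Fin 8 → Fin 4 → L) (f : Fin 4 → Fin 8) : L :=
  Matrix.det (Matrix.of fun a => x (f a))

lemma plucker_eq_minor (x : Fin 8 → Fin 4 → L) (i j k l : Fin 8) :
    plucker x i j k l = minor x ![i, j, k, l] := by
  unfold plucker minor
  congr 1
  ext a b
  fin_cases a <;> rfl

/-- The difference of the two monomials of the conic condition. -/
def cubicForm (x : Fin 8 → Fin 4 → L) (π : Equiv.Perm (Fin 8)) : L :=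
  cubicMonomial₁ x π - cubicMonomial₂ x π

/-- The tuple `y` is obtained from `x` by an invertible matrix and a rescaling of the vectors. -/
def ProjEquiv (x y : Fin 8 → Fin 4 → L) : Prop :=
  ∃ (M : Matrix (Fin 4) (Fin 4) L) (c : Fin 8 → L), M.det ≠ 0 ∧ (∀ i, c i ≠ 0) ∧
    ∀ i, y i = c i • M.mulVec (x i)

lemma minor_smul_mulVec (M : Matrix (Fin 4) (Fin 4) L) (c : Fin 8 → L)
    (x : Fin 8 → Fin 4 → L) (f : Fin 4 → Fin 8) :
    minor (fun i => c i • M.mulVec (x i)) f = (∏ a, c (f a)) * (M.det * minor x f) := by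
  unfold minor
  have : (Matrix.of fun a => c (f a) • M.mulVec (x (f a))) =
      Matrix.diagonal (fun a => c (f a)) * (Matrix.of (fun a => x (f a)) * M.transpose) := by
    ext a b
    rw [Matrix.diagonal_mul]
    simp [Matrix.mul_apply, Matrix.mulVec, dotProduct, mul_comm]
  rw [this, Matrix.det_mul, Matrix.det_mul, Matrix.det_diagonal, Matrix.det_transpose]
  ring

lemma plucker_smul_mulVec (M : Matrix (Fin 4) (Fin 4) L) (c : Fin 8 → L)
    (x : Fin 8 → Fin 4 → L) (i j k l : Fin 8) :
    plucker (fun i => c i • M.mulVec (x i)) i j k l =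
      c i * c j * c k * c l * M.det * plucker x i j k l := by
  rw [plucker_eq_minor, minor_smul_mulVec, plucker_eq_minor, Fin.prod_univ_four]
  simp
  ring

/-- The factor by which the conic condition changes under rescaling. -/
def cubicFactor (d : L) (c : Fin 8 → L) (π : Equiv.Perm (Fin 8)) : L :=
  (c (π 0) ^ 2 * c (π 1) * c (π 2) * c (π 3) * c (π 4) * c (π 5) * c (π 6) * d ^ 2) ^ 2

lemma cubicMonomial₁_smul_mulVec (M : Matrix (Fin 4) (Fin 4) L) (c : Fin 8 → L)
    (x : Fin 8 → Fin 4 → L) (π : Equiv.Perm (Fin 8)) :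
    cubicMonomial₁ (fun i => c i • M.mulVec (x i)) π =
      cubicFactor M.det c π * cubicMonomial₁ x π := by
  simp only [cubicMonomial₁, plucker_smul_mulVec, cubicFactor]
  ring

lemma cubicMonomial₂_smul_mulVec (M : Matrix (Fin 4) (Fin 4) L) (c : Fin 8 → L)
    (x : Fin 8 → Fin 4 → L) (π : Equiv.Perm (Fin 8)) :
    cubicMonomial₂ (fun i => c i • M.mulVec (x i)) π =
      cubicFactor M.det c π * cubicMonomial₂ x π := by
  simp only [cubicMonomial₂, plucker_smul_mulVec, cubicFactor]
  ring

lemma cubicForm_smul_mulVec (M : Matrix (Fin 4) (Fin 4) L) (c : Fin 8 → L)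
    (x : Fin 8 → Fin 4 → L) (π : Equiv.Perm (Fin 8)) :
    cubicForm (fun i => c i • M.mulVec (x i)) π = cubicFactor M.det c π * cubicForm x π := by
  simp only [cubicForm, cubicMonomial₁_smul_mulVec, cubicMonomial₂_smul_mulVec]
  ring

lemma minor_comp (x : Fin 8 → Fin 4 → L) (ρ : Fin 8 → Fin 8) (f : Fin 4 → Fin 8) :
    minor (x ∘ ρ) f = minor x (ρ ∘ f) := rfl

lemma cubicForm_comp (x : Fin 8 → Fin 4 → L) (ρ π : Equiv.Perm (Fin 8)) :
    cubicForm (x ∘ ρ) π = cubicForm x (ρ * π) := rfl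

/-- General position: no four of the vectors are dependent. -/
def GeneralPosition (x : Fin 8 → Fin 4 → L) : Prop :=
  ∀ f : Fin 4 → Fin 8, Function.Injective f → minor x f ≠ 0

lemma GeneralPosition.comp {x : Fin 8 → Fin 4 → L} (hx : GeneralPosition x)
    (ρ : Equiv.Perm (Fin 8)) : GeneralPosition (x ∘ ρ) :=
  fun f hf => hx (ρ ∘ f) (ρ.injective.comp hf)

lemma GeneralPosition.smul_mulVec {x : Fin 8 → Fin 4 → L} (hx : GeneralPosition x)
    {M : Matrix (Fin 4) (Fin 4) L} {c : Fin 8 → L} (hM : M.det ≠ 0) (hc : ∀ i, c i ≠ 0) :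
    GeneralPosition (fun i => c i • M.mulVec (x i)) := by
  intro f hf
  rw [minor_smul_mulVec]
  exact mul_ne_zero (Finset.prod_ne_zero_iff.2 fun a _ => hc _) (mul_ne_zero hM (hx f hf))

lemma minor_sq_comp_perm (x : Fin 8 → Fin 4 → L) (f : Fin 4 → Fin 8) (σ : Equiv.Perm (Fin 4)) :
    minor x (f ∘ σ) ^ 2 = minor x f ^ 2 := by
  have h := Matrix.det_permute σ (Matrix.of fun a => x (f a))
  have h' : minor x (f ∘ σ) = (Equiv.Perm.sign σ : ℤ) * minor x f := by
    rw [minor, minor, ← h]; rfl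
  rw [h', mul_pow]
  rcases Int.units_eq_one_or (Equiv.Perm.sign σ) with h | h <;> simp [h]

/-- The square of a minor depends only on the set of labels. -/
lemma minor_sq_congr (x : Fin 8 → Fin 4 → L) {f g : Fin 4 → Fin 8} (hf : Function.Injective f)
    (hg : Function.Injective g) (h : Set.range f = Set.range g) :
    minor x f ^ 2 = minor x g ^ 2 := by
  let σ : Equiv.Perm (Fin 4) :=
    (Equiv.ofInjective g hg).trans ((Equiv.setCongr h.symm).trans (Equiv.ofInjective f hf).symm)
  have : g = f ∘ σ := by
    ext a
    have := Equiv.apply_ofInjective_symm hf ((Equiv.setCongr h.symm) (Equiv.ofInjective g hg a))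
    simp only [Function.comp, σ, Equiv.trans_apply]
    rw [this]
    rfl
  rw [this, minor_sq_comp_perm]

/-- A linear relation between the squares of the vectors. -/
def SquareRelation (lam : Fin 8 → L) (x : Fin 8 → Fin 4 → L) : Prop :=
  ∀ a b, ∑ i, lam i * (x i a * x i b) = 0

/-- The sum of the squares of the vectors vanishes. -/
def SelfDual (x : Fin 8 → Fin 4 → L) : Prop := ∀ a b, ∑ i, x i a * x i b = 0

lemma SelfDual.comp {x : Fin 8 → Fin 4 → L} (hx : SelfDual x) (ρ : Equiv.Perm (Fin 8)) :
    SelfDual (x ∘ ρ) := fun a b =>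
  (Equiv.sum_comp ρ fun i => x i a * x i b).trans (hx a b)

lemma SelfDual.mulVec {x : Fin 8 → Fin 4 → L} (hx : SelfDual x) (M : Matrix (Fin 4) (Fin 4) L) :
    SelfDual fun i => M.mulVec (x i) := by
  intro a b
  simp only [Matrix.mulVec, dotProduct, Finset.sum_mul_sum]
  rw [Finset.sum_comm]
  refine Finset.sum_eq_zero fun c _ => ?_
  rw [Finset.sum_comm]
  refine Finset.sum_eq_zero fun d _ => ?_
  calc ∑ i, M a c * x i c * (M b d * x i d) = M a c * M b d * ∑ i, x i c * x i d := by
        rw [Finset.mul_sum]; exact Finset.sum_congr rfl fun i _ => by ring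
    _ = 0 := by rw [hx, mul_zero]

/-- Split the sum of squares into two halves of four vectors: the Gram matrices `XᵀX` of the two
halves are negatives of each other. Taking determinants in even size gives the equality of squares.
-/
lemma SelfDual.minor_sq {x : Fin 8 → Fin 4 → L} (hx : SelfDual x) (π : Equiv.Perm (Fin 8)) :
    minor x ![π 0, π 1, π 2, π 3] ^ 2 = minor x ![π 4, π 5, π 6, π 7] ^ 2 := by
  have h : ((Matrix.of fun a => x (![π 0, π 1, π 2, π 3] a)).transpose *
      (Matrix.of fun a => x (![π 0, π 1, π 2, π 3] a))) =
      -((Matrix.of fun a => x (![π 4, π 5, π 6, π 7] a)).transpose *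
      (Matrix.of fun a => x (![π 4, π 5, π 6, π 7] a))) := by
    ext a b
    have := hx.comp π a b
    simp only [Fin.sum_univ_eight, Function.comp] at this
    simp only [Matrix.mul_apply, Matrix.transpose_apply, Matrix.of_apply, Matrix.neg_apply,
      Fin.sum_univ_four]
    simp
    linear_combination this
  have h2 := congrArg Matrix.det h
  rw [Matrix.det_neg, Matrix.det_mul, Matrix.det_mul, Matrix.det_transpose,
    Matrix.det_transpose] at h2
  unfold minor
  simp at h2
  linear_combination h2

lemma SelfDual.minor_sq_compl {x : Fin 8 → Fin 4 → L} (hx : SelfDual x) {f g : Fin 4 → Fin 8}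
    (hf : Function.Injective f) (hg : Function.Injective g)
    (h : ∀ a b, f a ≠ g b) : minor x f ^ 2 = minor x g ^ 2 := by
  have hinj : Function.Injective (Fin.append f g : Fin (4 + 4) → Fin 8) :=
    Fin.append_injective_iff.2 ⟨hf, hg, h⟩
  let π : Equiv.Perm (Fin 8) := Equiv.ofBijective _ (Finite.injective_iff_bijective.1 hinj)
  have h1 : ![π 0, π 1, π 2, π 3] = f := by
    ext a; fin_cases a <;> rfl
  have h2 : ![π 4, π 5, π 6, π 7] = g := by
    ext a; fin_cases a <;> rfl
  simpa only [h1, h2] using hx.minor_sq π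

/-- The plane through three points as a linear form in the fourth. A product of two such forms is a
quadric on which a square relation can be evaluated. -/
lemma plucker_eq_sum (x : Fin 8 → Fin 4 → L) (j k l : Fin 8) :
    ∃ α : Fin 4 → L, ∀ i, plucker x i j k l = ∑ a, α a * x i a := by
  refine ⟨fun a => (-1) ^ (a : ℕ) * Matrix.det (Matrix.submatrix
    (Matrix.of ![x j, x j, x k, x l]) Fin.succ a.succAbove), fun i => ?_⟩
  rw [plucker, Matrix.det_succ_row_zero]
  refine Finset.sum_congr rfl fun a _ => ?_
  have : (Matrix.of ![x i, x j, x k, x l]).submatrix Fin.succ a.succAbove =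
      (Matrix.of ![x j, x j, x k, x l]).submatrix Fin.succ a.succAbove := by
    ext b c; fin_cases b <;> rfl
  rw [this]
  simp
  ring

lemma plucker_eq_zero {x : Fin 8 → Fin 4 → L} {j k l : Fin 8} :
    plucker x j j k l = 0 ∧ plucker x k j k l = 0 ∧ plucker x l j k l = 0 := by
  refine ⟨?_, ?_, ?_⟩
  · exact Matrix.det_zero_of_row_eq (i := 0) (j := 1) (by decide) rfl
  · exact Matrix.det_zero_of_row_eq (i := 0) (j := 2) (by decide) rfl
  · exact Matrix.det_zero_of_row_eq (i := 0) (j := 3) (by decide) rfl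

/-- Evaluation of a relation between squares on a pair of planes. -/
lemma SquareRelation.exchange {lam : Fin 8 → L} {x : Fin 8 → Fin 4 → L}
    (h : SquareRelation lam x) (π : Equiv.Perm (Fin 8)) :
    lam (π 0) * (plucker x (π 0) (π 1) (π 2) (π 3) * plucker x (π 0) (π 4) (π 5) (π 6)) +
    lam (π 7) * (plucker x (π 7) (π 1) (π 2) (π 3) * plucker x (π 7) (π 4) (π 5) (π 6)) = 0 := by
  obtain ⟨α, hα⟩ := plucker_eq_sum x (π 1) (π 2) (π 3)
  obtain ⟨β, hβ⟩ := plucker_eq_sum x (π 4) (π 5) (π 6)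
  have key : ∑ i, lam i * (plucker x i (π 1) (π 2) (π 3) * plucker x i (π 4) (π 5) (π 6)) = 0 := by
    simp only [hα, hβ, Finset.sum_mul_sum]
    simp only [Finset.mul_sum]
    rw [Finset.sum_comm]
    refine Finset.sum_eq_zero fun a _ => ?_
    rw [Finset.sum_comm]
    refine Finset.sum_eq_zero fun b _ => ?_
    calc ∑ i, lam i * (α a * x i a * (β b * x i b))
        = α a * β b * ∑ i, lam i * (x i a * x i b) := by
          rw [Finset.mul_sum]; exact Finset.sum_congr rfl fun i _ => by ring
      _ = 0 := by rw [h, mul_zero]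
  -- The six points `π 1, …, π 6` lie on one of the two planes, so only the terms of `π 0` and `π 7`
  -- survive.
  rw [← Equiv.sum_comp π, Fin.sum_univ_eight] at key
  obtain ⟨h1, h2, h3⟩ := plucker_eq_zero (x := x) (j := π 1) (k := π 2) (l := π 3)
  obtain ⟨h4, h5, h6⟩ := plucker_eq_zero (x := x) (j := π 4) (k := π 5) (l := π 6)
  simp only [h1, h2, h3, h4, h5, h6, zero_mul, mul_zero, add_zero] at key
  exact key

lemma exists_perm_zero_seven {i k : Fin 8} (h : i ≠ k) :
    ∃ π : Equiv.Perm (Fin 8), π 0 = i ∧ π 7 = k := by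
  refine ⟨Equiv.swap (Equiv.swap 0 i 7) k * Equiv.swap 0 i, ?_, ?_⟩
  · rw [Equiv.Perm.mul_apply, Equiv.swap_apply_left]
    refine Equiv.swap_apply_of_ne_of_ne ?_ h
    intro h'
    have : Equiv.swap 0 i 0 = Equiv.swap 0 i 7 := by rw [Equiv.swap_apply_left]; exact h'
    exact absurd ((Equiv.swap 0 i).injective this) (by decide)
  · rw [Equiv.Perm.mul_apply, Equiv.swap_apply_left]

/-- The exchange identity links any two coefficients by products of minors that are nonzero in
general position. If one coefficient vanished, all would. -/
lemma SquareRelation.ne_zero {lam : Fin 8 → L} {x : Fin 8 → Fin 4 → L}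
    (h : SquareRelation lam x) (hx : GeneralPosition x) (h0 : lam ≠ 0) (k : Fin 8) : lam k ≠ 0 := by
  obtain ⟨i, hi⟩ := Function.ne_iff.1 h0
  intro hk
  have hik : i ≠ k := by rintro rfl; exact hi hk
  obtain ⟨π, rfl, rfl⟩ := exists_perm_zero_seven hik
  have := h.exchange π
  rw [hk, zero_mul, add_zero, plucker_eq_minor, plucker_eq_minor] at this
  refine mul_ne_zero hi (mul_ne_zero (hx _ ?_) (hx _ ?_)) this
  · have : (![π 0, π 1, π 2, π 3] : Fin 4 → Fin 8) = π ∘ ![0, 1, 2, 3] := by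
      ext a; fin_cases a <;> rfl
    rw [this]; exact π.injective.comp (by decide)
  · have : (![π 0, π 4, π 5, π 6] : Fin 4 → Fin 8) = π ∘ ![0, 4, 5, 6] := by
      ext a; fin_cases a <;> rfl
    rw [this]; exact π.injective.comp (by decide)

/-- A factor `lam i` in front of a square is absorbed by rescaling the vector with a square root of
`lam i`. -/
lemma SquareRelation.exists_selfDual [IsAlgClosed L] {lam : Fin 8 → L} {x : Fin 8 → Fin 4 → L}
    (h : SquareRelation lam x) :
    ∃ c : Fin 8 → L, (∀ i, c i ^ 2 = lam i) ∧ SelfDual fun i => c i • x i := by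
  choose c hc using fun i => IsAlgClosed.exists_pow_nat_eq (lam i) (n := 2) (by norm_num)
  refine ⟨c, hc, fun a b => ?_⟩
  rw [← h a b]
  refine Finset.sum_congr rfl fun i _ => ?_
  rw [← hc]
  simp
  ring

end Minors

/-! ### Self-dual tuples in a standard frame and the symmetry of the conic condition. -/

section Frames
variable {L : Type*} [Field L]

/-- The vectors with labels `0, …, 3` form the standard basis. -/
def StandardFrame (x : Fin 8 → Fin 4 → L) : Prop :=
  x 0 = ![1, 0, 0, 0] ∧ x 1 = ![0, 1, 0, 0] ∧ x 2 = ![0, 0, 1, 0] ∧ x 3 = ![0, 0, 0, 1]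

lemma exists_standardFrame (x : Fin 8 → Fin 4 → L) (hx : plucker x 0 1 2 3 ≠ 0) :
    ∃ M : Matrix (Fin 4) (Fin 4) L, M.det * plucker x 0 1 2 3 = 1 ∧
      StandardFrame fun i => M.mulVec (x i) := by
  set A : Matrix (Fin 4) (Fin 4) L := Matrix.of ![x 0, x 1, x 2, x 3] with hA
  have hdet : IsUnit A.transpose.det := by
    rw [Matrix.det_transpose]; exact isUnit_iff_ne_zero.2 hx
  have hinv : A.transpose⁻¹ * A.transpose = 1 := Matrix.nonsing_inv_mul _ hdet
  refine ⟨A.transpose⁻¹, ?_, ?_⟩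
  · have := congrArg Matrix.det hinv
    rwa [Matrix.det_mul, Matrix.det_one, Matrix.det_transpose] at this
  · have key : ∀ k a, (A.transpose⁻¹).mulVec (fun b => A k b) a = (1 : Matrix _ _ L) a k := by
      intro k a
      rw [← hinv, Matrix.mul_apply]
      rfl
    refine ⟨?_, ?_, ?_, ?_⟩
    · ext a; refine (key 0 a).trans ?_; fin_cases a <;> simp [Matrix.one_apply]
    · ext a; refine (key 1 a).trans ?_; fin_cases a <;> simp [Matrix.one_apply]
    · ext a; refine (key 2 a).trans ?_; fin_cases a <;> simp [Matrix.one_apply]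
    · ext a; refine (key 3 a).trans ?_; fin_cases a <;> simp [Matrix.one_apply]

/-- If `U` has the last four vectors as columns, self-duality with a standard frame reads `1 + U Uᵀ
= 0`. -/
lemma SelfDual.frame_rows {x : Fin 8 → Fin 4 → L} (hx : SelfDual x) (hf : StandardFrame x)
    (a b : Fin 4) : x 4 a * x 4 b + x 5 a * x 5 b + x 6 a * x 6 b + x 7 a * x 7 b =
      if a = b then -1 else 0 := by
  obtain ⟨h0, h1, h2, h3⟩ := hf
  have := hx a b
  rw [Fin.sum_univ_eight, h0, h1, h2, h3] at this
  fin_cases a <;> fin_cases b <;> simp at this ⊢ <;> linear_combination this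

/-- A right inverse of a square matrix is a left inverse, so `U Uᵀ = -1` gives `Uᵀ U = -1`. -/
lemma SelfDual.frame_columns {x : Fin 8 → Fin 4 → L} (hx : SelfDual x) (hf : StandardFrame x)
    (i j : Fin 4) : x (Fin.natAdd 4 i) 0 * x (Fin.natAdd 4 j) 0 +
      x (Fin.natAdd 4 i) 1 * x (Fin.natAdd 4 j) 1 + x (Fin.natAdd 4 i) 2 * x (Fin.natAdd 4 j) 2 +
      x (Fin.natAdd 4 i) 3 * x (Fin.natAdd 4 j) 3 = if i = j then -1 else 0 := by
  let U : Matrix (Fin 4) (Fin 4) L := Matrix.of fun a j => x (Fin.natAdd 4 j) a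
  have h1 : U * -U.transpose = 1 := by
    ext a b
    have := hx.frame_rows hf a b
    rw [Matrix.mul_neg, Matrix.neg_apply, Matrix.mul_apply, Fin.sum_univ_four, Matrix.one_apply]
    have e : x 4 a * x 4 b + x 5 a * x 5 b + x 6 a * x 6 b + x 7 a * x 7 b =
      U a 0 * U.transpose 0 b + U a 1 * U.transpose 1 b + U a 2 * U.transpose 2 b +
        U a 3 * U.transpose 3 b := rfl
    rw [← e, this]
    split_ifs <;> simp
  have h2 : (-U.transpose * U) i j = (1 : Matrix (Fin 4) (Fin 4) L) i j := by
    rw [mul_eq_one_comm.1 h1]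
  rw [Matrix.neg_mul, Matrix.neg_apply, Matrix.mul_apply, Fin.sum_univ_four,
    Matrix.one_apply] at h2
  have e : U.transpose i 0 * U 0 j + U.transpose i 1 * U 1 j + U.transpose i 2 * U 2 j +
      U.transpose i 3 * U 3 j = x (Fin.natAdd 4 i) 0 * x (Fin.natAdd 4 j) 0 +
      x (Fin.natAdd 4 i) 1 * x (Fin.natAdd 4 j) 1 + x (Fin.natAdd 4 i) 2 * x (Fin.natAdd 4 j) 2 +
      x (Fin.natAdd 4 i) 3 * x (Fin.natAdd 4 j) 3 := rfl
  rw [← e]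
  split_ifs at h2 ⊢ <;> linear_combination -h2

lemma det_four (a b c d : Fin 4 → L) : Matrix.det (Matrix.of ![a, b, c, d]) =
    (a 0 * b 1 - a 1 * b 0) * (c 2 * d 3 - c 3 * d 2) -
    (a 0 * b 2 - a 2 * b 0) * (c 1 * d 3 - c 3 * d 1) +
    (a 0 * b 3 - a 3 * b 0) * (c 1 * d 2 - c 2 * d 1) +
    (a 1 * b 2 - a 2 * b 1) * (c 0 * d 3 - c 3 * d 0) -
    (a 1 * b 3 - a 3 * b 1) * (c 0 * d 2 - c 2 * d 0) +
    (a 2 * b 3 - a 3 * b 2) * (c 0 * d 1 - c 1 * d 0) := by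
  simp [Matrix.det_succ_row_zero, Fin.sum_univ_succ, Fin.succAbove]
  ring

/-- The conic condition on six points projected from a seventh. -/
def conicForm (x : Fin 8 → Fin 4 → L) (a b c d e f g : Fin 8) : L :=
  plucker x a b c d * plucker x a b e f * plucker x a c e g * plucker x a d f g -
  plucker x a b c e * plucker x a b d f * plucker x a c d g * plucker x a e f g

/-- The condition that six points lie on a conic is alternating in the six points. For these five
adjacent transpositions this is a polynomial identity in the coordinates, without any hypothesis of
self-duality. -/
lemma StandardFrame.conicForm_swap {x : Fin 8 → Fin 4 → L} (hf : StandardFrame x) :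
    conicForm x 0 2 1 3 4 5 6 = -conicForm x 0 1 2 3 4 5 6 ∧
    conicForm x 0 1 3 2 4 5 6 = -conicForm x 0 1 2 3 4 5 6 ∧
    conicForm x 0 1 2 4 3 5 6 = -conicForm x 0 1 2 3 4 5 6 ∧
    conicForm x 0 1 2 3 5 4 6 = -conicForm x 0 1 2 3 4 5 6 ∧
    conicForm x 0 1 2 3 4 6 5 = -conicForm x 0 1 2 3 4 5 6 := by
  obtain ⟨h0, h1, h2, h3⟩ := hf
  simp only [conicForm, plucker, h0, h1, h2, h3, det_four]
  simp
  refine ⟨?_, ?_, ?_, ?_, ?_⟩ <;> ring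

lemma StandardFrame.conicForm_eq {x : Fin 8 → Fin 4 → L} (hf : StandardFrame x) :
    conicForm x 0 1 2 3 4 5 6 =
      (x 4 2 * x 4 3) * ((x 5 1 * x 5 3) * (x 6 1 * x 6 2) - (x 5 1 * x 5 2) * (x 6 1 * x 6 3)) -
      (x 4 1 * x 4 3) * ((x 5 2 * x 5 3) * (x 6 1 * x 6 2) - (x 5 1 * x 5 2) * (x 6 2 * x 6 3)) +
      (x 4 1 * x 4 2) * ((x 5 2 * x 5 3) * (x 6 1 * x 6 3) - (x 5 1 * x 5 3) * (x 6 2 * x 6 3)) ∧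
    conicForm x 0 1 2 3 4 5 7 =
      (x 4 2 * x 4 3) * ((x 5 1 * x 5 3) * (x 7 1 * x 7 2) - (x 5 1 * x 5 2) * (x 7 1 * x 7 3)) -
      (x 4 1 * x 4 3) * ((x 5 2 * x 5 3) * (x 7 1 * x 7 2) - (x 5 1 * x 5 2) * (x 7 2 * x 7 3)) +
      (x 4 1 * x 4 2) * ((x 5 2 * x 5 3) * (x 7 1 * x 7 3) - (x 5 1 * x 5 3) * (x 7 2 * x 7 3)) ∧
    conicForm x 1 0 2 3 4 5 6 =
      (x 4 2 * x 4 3) * ((x 5 0 * x 5 3) * (x 6 0 * x 6 2) - (x 5 0 * x 5 2) * (x 6 0 * x 6 3)) -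
      (x 4 0 * x 4 3) * ((x 5 2 * x 5 3) * (x 6 0 * x 6 2) - (x 5 0 * x 5 2) * (x 6 2 * x 6 3)) +
      (x 4 0 * x 4 2) * ((x 5 2 * x 5 3) * (x 6 0 * x 6 3) - (x 5 0 * x 5 3) * (x 6 2 * x 6 3)) := by
  obtain ⟨h0, h1, h2, h3⟩ := hf
  simp only [conicForm, plucker, h0, h1, h2, h3, det_four]
  simp
  refine ⟨?_, ?_, ?_⟩ <;> ring

/-- The two remaining adjacent transpositions change the centre of projection, or replace a
projected point by the omitted one. Here self-duality is needed: orthogonality of columns gives the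
first exchange, orthogonality of rows the second. -/
lemma SelfDual.conicForm_swap {x : Fin 8 → Fin 4 → L} (hx : SelfDual x) (hf : StandardFrame x) :
    conicForm x 1 0 2 3 4 5 6 = -conicForm x 0 1 2 3 4 5 6 ∧
    conicForm x 0 1 2 3 4 5 7 = -conicForm x 0 1 2 3 4 5 6 := by
  obtain ⟨e1, e2, e3⟩ := hf.conicForm_eq
  rw [e1, e2, e3]
  constructor
  · have h45 : x 4 0 * x 5 0 + x 4 1 * x 5 1 + x 4 2 * x 5 2 + x 4 3 * x 5 3 = 0 :=
      hx.frame_columns hf 0 1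
    have h46 : x 4 0 * x 6 0 + x 4 1 * x 6 1 + x 4 2 * x 6 2 + x 4 3 * x 6 3 = 0 :=
      hx.frame_columns hf 0 2
    have h56 : x 5 0 * x 6 0 + x 5 1 * x 6 1 + x 5 2 * x 6 2 + x 5 3 * x 6 3 = 0 :=
      hx.frame_columns hf 1 2
    linear_combination (x 4 2 * x 4 3 * (x 5 3 * x 6 2 - x 5 2 * x 6 3)) * h56 +
      (x 5 2 * x 5 3 * (x 4 2 * x 6 3 - x 4 3 * x 6 2)) * h46 +
      (x 6 2 * x 6 3 * (x 4 3 * x 5 2 - x 4 2 * x 5 3)) * h45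
  · have h23 : x 4 2 * x 4 3 + x 5 2 * x 5 3 + x 6 2 * x 6 3 + x 7 2 * x 7 3 = 0 :=
      hx.frame_rows hf 2 3
    have h13 : x 4 1 * x 4 3 + x 5 1 * x 5 3 + x 6 1 * x 6 3 + x 7 1 * x 7 3 = 0 :=
      hx.frame_rows hf 1 3
    have h12 : x 4 1 * x 4 2 + x 5 1 * x 5 2 + x 6 1 * x 6 2 + x 7 1 * x 7 2 = 0 :=
      hx.frame_rows hf 1 2
    linear_combination (x 4 1 * x 4 3 * (x 5 1 * x 5 2) - x 4 1 * x 4 2 * (x 5 1 * x 5 3)) * h23 +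
      (x 4 1 * x 4 2 * (x 5 2 * x 5 3) - x 4 2 * x 4 3 * (x 5 1 * x 5 2)) * h13 +
      (x 4 2 * x 4 3 * (x 5 1 * x 5 3) - x 4 1 * x 4 3 * (x 5 2 * x 5 3)) * h12

lemma SelfDual.cubicForm_swap_of_frame {x : Fin 8 → Fin 4 → L} (hx : SelfDual x)
    (hf : StandardFrame x) (i : Fin 7) :
    cubicForm x (Equiv.swap i.castSucc i.succ) = -cubicForm x 1 := by
  obtain ⟨h1, h2, h3, h4, h5⟩ := hf.conicForm_swap
  obtain ⟨h0, h6⟩ := hx.conicForm_swap hf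
  fin_cases i
  exacts [h0, h1, h2, h3, h4, h5, h6]

lemma SelfDual.cubicForm_sq_swap {x : Fin 8 → Fin 4 → L} (hx : SelfDual x)
    (h0 : plucker x 0 1 2 3 ≠ 0) (i : Fin 7) :
    cubicForm x (Equiv.swap i.castSucc i.succ) ^ 2 = cubicForm x 1 ^ 2 := by
  obtain ⟨M, hM, hf⟩ := exists_standardFrame x h0
  have hM0 : M.det ≠ 0 := left_ne_zero_of_mul_eq_one hM
  have key := (hx.mulVec M).cubicForm_swap_of_frame hf i
  have e : ∀ π, cubicForm (fun i => M.mulVec (x i)) π = (M.det ^ 2) ^ 2 * cubicForm x π := by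
    intro π
    have := cubicForm_smul_mulVec M (fun _ => 1) x π
    simpa [cubicFactor] using this
  rw [e, e, ← mul_neg] at key
  rw [mul_left_cancel₀ (pow_ne_zero _ (pow_ne_zero _ hM0)) key, neg_sq]

/-- For a self-dual tuple, the conic condition does not depend, up to sign, on the choice of the
points. -/
lemma SelfDual.cubicForm_sq {x : Fin 8 → Fin 4 → L} (hx : SelfDual x) (hg : GeneralPosition x)
    (π : Equiv.Perm (Fin 8)) : cubicForm x π ^ 2 = cubicForm x 1 ^ 2 := by
  -- Adjacent transpositions generate the symmetric group. For each of them the tuple, already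
  -- relabelled by `π`, is moved to a new frame.
  have hπ : π ∈ Submonoid.closure
      (Set.range fun i : Fin 7 => Equiv.swap i.castSucc i.succ) := by
    rw [Equiv.Perm.mclosure_swap_castSucc_succ]; trivial
  induction hπ using Submonoid.closure_induction_right with
  | one => rfl
  | mul_right π _ s hs ih =>
    obtain ⟨i, rfl⟩ := hs
    rw [← ih, ← cubicForm_comp, (hx.comp π).cubicForm_sq_swap _ i, cubicForm_comp, mul_one]
    rw [plucker_eq_minor]
    exact hg.comp π _ (by decide)

end Frames

/-! ### Nets of quadrics, lifts of octads and base loci. -/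

section Nets
variable {L : Type*} [Field L]

/-- The ten coefficients of a quadratic form in four variables. -/
def quadCoeffs : QuadraticForm L (Fin 4 → L) →ₗ[L] (Fin 4 → L) × (Fin 6 → L) where
  toFun Q := (fun a => Q (Pi.single a 1),
    ![QuadraticMap.polar Q (Pi.single 0 1) (Pi.single 1 1),
      QuadraticMap.polar Q (Pi.single 0 1) (Pi.single 2 1),
      QuadraticMap.polar Q (Pi.single 0 1) (Pi.single 3 1),
      QuadraticMap.polar Q (Pi.single 1 1) (Pi.single 2 1),
      QuadraticMap.polar Q (Pi.single 1 1) (Pi.single 3 1),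
      QuadraticMap.polar Q (Pi.single 2 1) (Pi.single 3 1)])
  map_add' Q Q' := by
    refine Prod.ext (funext fun a => rfl) (funext fun k => ?_)
    fin_cases k <;> exact QuadraticMap.polar_add _ _ _ _
  map_smul' c Q := by
    refine Prod.ext (funext fun a => rfl) (funext fun k => ?_)
    fin_cases k <;> exact QuadraticMap.polar_smul _ _ _ _

lemma quadraticForm_apply (Q : QuadraticForm L (Fin 4 → L)) (v : Fin 4 → L) :
    Q v = (quadCoeffs Q).1 0 * (v 0 * v 0) + (quadCoeffs Q).1 1 * (v 1 * v 1) +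
      (quadCoeffs Q).1 2 * (v 2 * v 2) + (quadCoeffs Q).1 3 * (v 3 * v 3) +
      (quadCoeffs Q).2 0 * (v 0 * v 1) + (quadCoeffs Q).2 1 * (v 0 * v 2) +
      (quadCoeffs Q).2 2 * (v 0 * v 3) + (quadCoeffs Q).2 3 * (v 1 * v 2) +
      (quadCoeffs Q).2 4 * (v 1 * v 3) + (quadCoeffs Q).2 5 * (v 2 * v 3) := by
  have hv : v = v 0 • Pi.single 0 1 + v 1 • Pi.single 1 1 + v 2 • Pi.single 2 1 +
      v 3 • Pi.single 3 1 := by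
    ext a; fin_cases a <;> simp
  have key : ∀ (e f g h : Fin 4 → L) (a b c d : L), Q (a • e + b • f + c • g + d • h) =
      Q e * (a * a) + Q f * (b * b) + Q g * (c * c) + Q h * (d * d) +
      QuadraticMap.polar Q e f * (a * b) + QuadraticMap.polar Q e g * (a * c) +
      QuadraticMap.polar Q e h * (a * d) + QuadraticMap.polar Q f g * (b * c) +
      QuadraticMap.polar Q f h * (b * d) + QuadraticMap.polar Q g h * (c * d) := by
    intro e f g h a b c d
    rw [QuadraticMap.map_add Q, QuadraticMap.map_add Q, QuadraticMap.map_add Q]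
    simp only [QuadraticMap.polar_add_left, QuadraticMap.polar_smul_left,
      QuadraticMap.polar_smul_right, QuadraticMap.map_smul, smul_eq_mul]
    ring
  conv_lhs => rw [hv]
  rw [key]
  rfl

lemma quadCoeffs_injective : Function.Injective (quadCoeffs (L := L)) := by
  intro Q Q' h
  ext v
  rw [quadraticForm_apply, quadraticForm_apply Q', h]

/-- The upper bound is all that the count of conditions needs. -/
lemma finrank_quadraticForm_le : Module.finrank L (QuadraticForm L (Fin 4 → L)) ≤ 10 :=
  (LinearMap.finrank_le_finrank_of_injective quadCoeffs_injective).trans (by simp)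

instance : FiniteDimensional L (QuadraticForm L (Fin 4 → L)) :=
  Module.Finite.of_injective quadCoeffs quadCoeffs_injective

/-- Eight vectors on a net of quadrics satisfy a linear relation between their squares. -/
lemma exists_squareRelation {x : Fin 8 → Fin 4 → L} {Q : Fin 3 → QuadraticForm L (Fin 4 → L)}
    (hQ : LinearIndependent L Q) (hx : ∀ k i, Q k (x i) = 0) :
    ∃ lam : Fin 8 → L, lam ≠ 0 ∧ SquareRelation lam x := by
  let ev : QuadraticForm L (Fin 4 → L) →ₗ[L] (Fin 8 → L) :=
    { toFun := fun q i => q (x i)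
      map_add' := fun _ _ => rfl
      map_smul' := fun _ _ => rfl }
  -- Evaluation at the eight points kills the net, so its rank is at most `10 - 3 = 7` and it is not
  -- surjective. A functional that annihilates its image is the relation.
  have hker : 3 ≤ Module.finrank L (LinearMap.ker ev) := by
    have h1 : Submodule.span L (Set.range Q) ≤ LinearMap.ker ev := by
      rw [Submodule.span_le]
      rintro _ ⟨k, rfl⟩
      exact LinearMap.mem_ker.2 (funext fun i => hx k i)
    have h2 := Submodule.finrank_mono h1
    rwa [finrank_span_eq_card hQ, Fintype.card_fin] at h2
  have hsum := LinearMap.finrank_range_add_finrank_ker ev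
  have h10 := finrank_quadraticForm_le (L := L)
  have hlt : LinearMap.range ev < ⊤ := by
    refine lt_top_iff_ne_top.2 fun h => ?_
    rw [h, finrank_top, Module.finrank_fin_fun] at hsum
    omega
  obtain ⟨f, hf0, hf⟩ := Submodule.exists_le_ker_of_lt_top _ hlt
  have hsingle : ∀ g : Fin 8 → L, f g = ∑ i, f (Pi.single i 1) * g i := by
    intro g
    conv_lhs => rw [pi_eq_sum_univ' g, map_sum]
    exact Finset.sum_congr rfl fun i _ => by rw [map_smul, smul_eq_mul, mul_comm]
  refine ⟨fun i => f (Pi.single i 1), fun h => hf0 ?_, fun a b => ?_⟩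
  · refine LinearMap.ext fun g => ?_
    rw [hsingle]
    exact Finset.sum_eq_zero fun i _ => by rw [show f (Pi.single i 1) = 0 from congrFun h i, zero_mul]
  -- The functional is tested on the quadric given by the product of the coordinates `a` and `b`.
  · have := hf ⟨QuadraticMap.linMulLin (LinearMap.proj a) (LinearMap.proj b), rfl⟩
    rw [LinearMap.mem_ker, hsingle] at this
    exact this

lemma exists_isLift (O : Octad L) : ∃ x, IsLift x O :=
  ⟨fun i => (O i).rep, fun i => ⟨(O i).rep_nonzero, Projectivization.mk_rep _⟩⟩

lemma IsLift.ne_zero {x : Fin 8 → Fin 4 → L} {O : Octad L} (h : IsLift x O) (i : Fin 8) :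
    x i ≠ 0 := (h i).1

lemma IsLift.smul {x : Fin 8 → Fin 4 → L} {O : Octad L} (h : IsLift x O) {c : Fin 8 → L}
    (hc : ∀ i, c i ≠ 0) : IsLift (fun i => c i • x i) O := by
  intro i
  obtain ⟨h0, h1⟩ := h i
  refine ⟨smul_ne_zero (hc i) h0, ?_⟩
  rw [← h1, Projectivization.mk_eq_mk_iff']
  exact ⟨c i, rfl⟩

lemma IsLift.exists_smul {x y : Fin 8 → Fin 4 → L} {O : Octad L} (hx : IsLift x O)
    (hy : IsLift y O) : ∃ c : Fin 8 → L, (∀ i, c i ≠ 0) ∧ ∀ i, y i = c i • x i := by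
  have : ∀ i, ∃ c : L, c • x i = y i := by
    intro i
    obtain ⟨h0, h1⟩ := hx i
    obtain ⟨h2, h3⟩ := hy i
    rw [← h1, Projectivization.mk_eq_mk_iff'] at h3
    exact h3
  choose c hc using this
  refine ⟨c, fun i h => hy.ne_zero i ?_, fun i => (hc i).symm⟩
  rw [← hc, h, zero_smul]

lemma IsLift.comp {x : Fin 8 → Fin 4 → L} {O : Octad L} (h : IsLift x O)
    (ρ : Equiv.Perm (Fin 8)) : IsLift (x ∘ ρ.symm) (permOctad ρ O) := fun i => h (ρ.symm i)

lemma mulVec_ne_zero {M : Matrix (Fin 4) (Fin 4) L} (hM : M.det ≠ 0) {v : Fin 4 → L}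
    (hv : v ≠ 0) : M.mulVec v ≠ 0 := fun h =>
  hM (Matrix.exists_mulVec_eq_zero_iff.1 ⟨v, hv, h⟩)

lemma PGLEquiv.projEquiv {x y : Fin 8 → Fin 4 → L} {O O' : Octad L} (h : PGLEquiv O O')
    (hx : IsLift x O) (hy : IsLift y O') : ProjEquiv x y := by
  obtain ⟨M, hM⟩ := h
  let A : Matrix (Fin 4) (Fin 4) L := LinearMap.toMatrix' (M.toLinearEquiv : (Fin 4 → L) →ₗ[L] _)
  have hA : ∀ v, A.mulVec v = M • v := fun v => LinearMap.toMatrix'_mulVec _ v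
  have hdet : A.det ≠ 0 := by
    rw [LinearMap.det_toMatrix']
    exact (LinearEquiv.isUnit_det' M.toLinearEquiv).ne_zero
  have hlift : IsLift (fun i => A.mulVec (x i)) O' := by
    intro i
    obtain ⟨h0, h1⟩ := hx i
    refine ⟨mulVec_ne_zero hdet h0, ?_⟩
    rw [hM, ← h1, Projectivization.smul_mk]
    simp only [hA]
  obtain ⟨c, hc, hy⟩ := hlift.exists_smul hy
  exact ⟨A, c, hdet, hc, hy⟩

lemma exists_pglEquiv {x : Fin 8 → Fin 4 → L} {O : Octad L} (hx : IsLift x O)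
    {A : Matrix (Fin 4) (Fin 4) L} (hA : A.det ≠ 0) :
    ∃ O', PGLEquiv O O' ∧ IsLift (fun i => A.mulVec (x i)) O' := by
  let e : (Fin 4 → L) ≃ₗ[L] (Fin 4 → L) := LinearEquiv.ofIsUnitDet (f := Matrix.toLin' A)
    (v := Pi.basisFun L (Fin 4)) (v' := Pi.basisFun L (Fin 4))
    (by
      have : LinearMap.toMatrix (Pi.basisFun L (Fin 4)) (Pi.basisFun L (Fin 4))
          (Matrix.toLin' A) = A := LinearMap.toMatrix'_toLin' A
      rw [this]; exact isUnit_iff_ne_zero.2 hA)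
  let M : LinearMap.GeneralLinearGroup L (Fin 4 → L) :=
    LinearMap.GeneralLinearGroup.ofLinearEquiv e
  refine ⟨fun i => M • O i, ⟨M, fun _ => rfl⟩, fun i => ?_⟩
  obtain ⟨h0, h1⟩ := hx i
  refine ⟨mulVec_ne_zero hA h0, ?_⟩
  change _ = M • O i
  rw [← h1, Projectivization.smul_mk]
  rfl

/-- The points of the tuple are the base points of a net of quadrics. -/
def IsNetBase (x : Fin 8 → Fin 4 → L) : Prop :=
  ∃ Q : Fin 3 → QuadraticForm L (Fin 4 → L), LinearIndependent L Q ∧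
    ∀ v : Fin 4 → L, v ≠ 0 → ((∀ k, Q k v = 0) ↔ ∃ (i : Fin 8) (c : L), v = c • x i)

lemma isCayleyOctad_iff {x : Fin 8 → Fin 4 → L} {O : Octad L} (hx : IsLift x O) :
    IsCayleyOctad O ↔ Function.Injective O ∧ IsNetBase x := by
  unfold IsCayleyOctad IsNetBase
  refine and_congr Iff.rfl (exists_congr fun Q => and_congr Iff.rfl
    (forall_congr' fun v => forall_congr' fun hv => iff_congr Iff.rfl (exists_congr fun i => ?_)))
  obtain ⟨h0, h1⟩ := hx i
  rw [← h1, eq_comm, Projectivization.mk_eq_mk_iff']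
  exact exists_congr fun c => eq_comm

lemma GeneralPosition.injective {x : Fin 8 → Fin 4 → L} {O : Octad L} (hx : IsLift x O)
    (hg : GeneralPosition x) : Function.Injective O := by
  intro i j hij
  by_contra hne
  obtain ⟨h0, h1⟩ := hx i
  obtain ⟨h2, h3⟩ := hx j
  rw [← h1, ← h3, Projectivization.mk_eq_mk_iff'] at hij
  obtain ⟨c, hc⟩ := hij
  obtain ⟨π, rfl, rfl⟩ := exists_perm_zero_seven hne
  have hinj : Function.Injective (![π 0, π 7, π 2, π 3] : Fin 4 → Fin 8) := by
    have : (![π 0, π 7, π 2, π 3] : Fin 4 → Fin 8) = π ∘ ![0, 7, 2, 3] := by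
      ext a; fin_cases a <;> rfl
    rw [this]; exact π.injective.comp (by decide)
  refine hg _ hinj ?_
  rw [← plucker_eq_minor, plucker, det_four, ← hc]
  simp
  ring

lemma IsNetBase.comp {x : Fin 8 → Fin 4 → L} (h : IsNetBase x) (ρ : Equiv.Perm (Fin 8)) :
    IsNetBase (x ∘ ρ) := by
  obtain ⟨Q, hQ, hv⟩ := h
  exact ⟨Q, hQ, fun v hv0 => (hv v hv0).trans
    ⟨fun ⟨i, c, h⟩ => ⟨ρ.symm i, c, by simpa using h⟩, fun ⟨i, c, h⟩ => ⟨ρ i, c, h⟩⟩⟩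

lemma IsNetBase.projEquiv {x y : Fin 8 → Fin 4 → L} (h : IsNetBase x) (hxy : ProjEquiv x y) :
    IsNetBase y := by
  obtain ⟨Q, hQ, hv⟩ := h
  obtain ⟨M, c, hM, hc, hy⟩ := hxy
  have hM' : IsUnit M.det := isUnit_iff_ne_zero.2 hM
  have hinv : ∀ v, M⁻¹.mulVec (M.mulVec v) = v := fun v => by
    rw [Matrix.mulVec_mulVec, Matrix.nonsing_inv_mul _ hM', Matrix.one_mulVec]
  have hinv' : ∀ v, M.mulVec (M⁻¹.mulVec v) = v := fun v => by
    rw [Matrix.mulVec_mulVec, Matrix.mul_nonsing_inv _ hM', Matrix.one_mulVec]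
  refine ⟨fun k => (Q k).comp (Matrix.toLin' M⁻¹), ?_, fun v hv0 => ?_⟩
  · rw [Fintype.linearIndependent_iff] at hQ ⊢
    intro g hg
    refine hQ g (QuadraticMap.ext fun v => ?_)
    have := congrArg (fun q : QuadraticForm L (Fin 4 → L) => q (M.mulVec v)) hg
    simpa [sum_apply, hinv] using this
  · have hv1 : M⁻¹.mulVec v ≠ 0 := fun h => hv0 (by rw [← hinv' v, h, Matrix.mulVec_zero])
    simp only [QuadraticMap.comp_apply, Matrix.toLin'_apply]
    rw [hv _ hv1]
    refine exists_congr fun i => ⟨fun ⟨d, h⟩ => ⟨d * (c i)⁻¹, ?_⟩, fun ⟨d, h⟩ => ⟨d * c i, ?_⟩⟩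
    · rw [hy, smul_smul, mul_assoc, inv_mul_cancel₀ (hc i), mul_one, ← hinv' v, h,
        Matrix.mulVec_smul]
    · rw [h, hy, smul_smul, Matrix.mulVec_smul, hinv]

end Nets

/-! ### Images of nets under the standard Cremona transformation. -/

section CremonaNet
variable {L : Type*} [Field L]

/-- The tuple `y` is the image of `x` under the standard Cremona transformation based at the
points `0, …, 3`. -/
structure IsInversion (x y : Fin 8 → Fin 4 → L) : Prop where
  left : StandardFrame x
  right : StandardFrame y
  ne_zero : ∀ j : Fin 4, ∀ a, x (Fin.natAdd 4 j) a ≠ 0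
  inv : ∀ j : Fin 4, ∀ a, y (Fin.natAdd 4 j) a = (x (Fin.natAdd 4 j) a)⁻¹

/-- The quadratic form with given mixed coefficients and no squares. -/
def mixedForm (c : Fin 6 → L) : QuadraticForm L (Fin 4 → L) :=
  c 0 • QuadraticMap.linMulLin (LinearMap.proj 0) (LinearMap.proj 1) +
  c 1 • QuadraticMap.linMulLin (LinearMap.proj 0) (LinearMap.proj 2) +
  c 2 • QuadraticMap.linMulLin (LinearMap.proj 0) (LinearMap.proj 3) +
  c 3 • QuadraticMap.linMulLin (LinearMap.proj 1) (LinearMap.proj 2) +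
  c 4 • QuadraticMap.linMulLin (LinearMap.proj 1) (LinearMap.proj 3) +
  c 5 • QuadraticMap.linMulLin (LinearMap.proj 2) (LinearMap.proj 3)

lemma mixedForm_apply (c : Fin 6 → L) (v : Fin 4 → L) : mixedForm c v =
    c 0 * (v 0 * v 1) + c 1 * (v 0 * v 2) + c 2 * (v 0 * v 3) + c 3 * (v 1 * v 2) +
      c 4 * (v 1 * v 3) + c 5 * (v 2 * v 3) := rfl

/-- A linear system whose solutions all satisfy a second, invertible system, has full rank. -/
lemma eq_zero_of_transpose_system {A R P : Matrix (Fin 3) (Fin 3) L} (hP : P.det ≠ 0)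
    (hLI : ∀ g, Matrix.vecMul g A = 0 → Matrix.vecMul g R = 0 → g = 0)
    (hz : ∀ g, Matrix.vecMul g A = 0 → P.mulVec (Matrix.vecMul g R) = 0)
    {G : Fin 3 → L} (hG : A.mulVec G = 0) : G = 0 := by
  by_contra hG0
  have hdet : A.det = 0 := Matrix.exists_mulVec_eq_zero_iff.1 ⟨G, hG0, hG⟩
  -- A singular square matrix also has a left kernel vector, and the hypotheses speak about left
  -- kernels.
  obtain ⟨g, hg0, hg⟩ := Matrix.exists_vecMul_eq_zero_iff.2 hdet
  refine hg0 (hLI g hg ?_)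
  by_contra hR
  exact hP (Matrix.exists_mulVec_eq_zero_iff.1 ⟨_, hR, hz g hg⟩)

lemma two_zero_of_products {p q r : L} (h1 : q * r = 0) (h2 : p * r = 0) (h3 : p * q = 0) :
    (q = 0 ∧ r = 0) ∨ (p = 0 ∧ r = 0) ∨ (p = 0 ∧ q = 0) := by
  rcases mul_eq_zero.1 h1 with h | h <;> rcases mul_eq_zero.1 h2 with h' | h' <;>
    rcases mul_eq_zero.1 h3 with h'' | h'' <;> tauto

/-- The mixed coefficients of a net through the frame: the coordinates of index `s` and `t`
separate the coefficients involving a fixed coordinate from the others. -/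
lemma net_products_eq_zero {c : Fin 3 → Fin 6 → L}
    (hLI : ∀ g : Fin 3 → L, (∀ e, ∑ k, g k * c k e = 0) → g = 0)
    {p : Fin 3 → Fin 6 → L} (hp : ∀ k j, ∑ e, c k e * p j e = 0)
    {s t : Fin 3 → Fin 6} (hst : Function.Bijective (Sum.elim s t))
    (hP : Matrix.det (Matrix.of fun j i => p j (t i)) ≠ 0)
    {G : Fin 3 → L} (hG : ∀ k, ∑ i, c k (s i) * G i = 0) : G = 0 := by
  have hsum : ∀ f : Fin 6 → L, ∑ e, f e = ∑ i, f (s i) + ∑ i, f (t i) := fun f => by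
    rw [← hst.sum_comp f, Fintype.sum_sum_type]; rfl
  -- A left kernel vector of the `s`-coefficients is a member of the net with `t`-terms only. It
  -- vanishes at three further points, and the invertible matrix of their `t`-products forces it to
  -- be zero, against the independence of the net.
  refine eq_zero_of_transpose_system (A := Matrix.of fun k i => c k (s i))
    (R := Matrix.of fun k i => c k (t i)) hP ?_ ?_ (funext hG)
  · intro g h1 h2
    refine hLI g fun e => ?_
    obtain ⟨i | i, rfl⟩ := hst.2 e
    · exact congrFun h1 i
    · exact congrFun h2 i
  · intro g h1
    ext j
    have h3 : ∀ i, ∑ k, g k * c k (s i) = 0 := fun i => congrFun h1 i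
    change ∑ i, p j (t i) * ∑ k, g k * c k (t i) = 0
    have h4 : ∑ k, g k * ∑ e, c k e * p j e = 0 := by simp [hp]
    calc ∑ i, p j (t i) * ∑ k, g k * c k (t i)
        = ∑ i, p j (s i) * ∑ k, g k * c k (s i) + ∑ i, p j (t i) * ∑ k, g k * c k (t i) := by
          simp [h3]
      _ = ∑ e, p j e * ∑ k, g k * c k e := (hsum fun e => p j e * ∑ k, g k * c k e).symm
      _ = ∑ k, g k * ∑ e, c k e * p j e := by
          simp only [Finset.mul_sum]
          rw [Finset.sum_comm]
          exact Finset.sum_congr rfl fun k _ => Finset.sum_congr rfl fun e _ => by ring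
      _ = 0 := h4

/-- The six products of two coordinates. -/
def pairProducts (v : Fin 4 → L) : Fin 6 → L :=
  ![v 0 * v 1, v 0 * v 2, v 0 * v 3, v 1 * v 2, v 1 * v 3, v 2 * v 3]

/-- After projection from a frame point, the other three frame points are the coordinate points of a
plane. Conics through these are combinations of the three mixed products, so the conic condition is
the determinant of these products at the remaining three points. -/
lemma conicForm_eq_det {x : Fin 8 → Fin 4 → L} (hf : StandardFrame x) :
    conicForm x 0 1 2 3 4 5 6 = -Matrix.det (Matrix.of fun (j i : Fin 3) =>
      pairProducts (x (![4, 5, 6] j)) (![3, 4, 5] i)) ∧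
    conicForm x 1 0 2 3 4 5 6 = -Matrix.det (Matrix.of fun (j i : Fin 3) =>
      pairProducts (x (![4, 5, 6] j)) (![1, 2, 5] i)) ∧
    conicForm x 2 0 1 3 4 5 6 = -Matrix.det (Matrix.of fun (j i : Fin 3) =>
      pairProducts (x (![4, 5, 6] j)) (![0, 2, 4] i)) ∧
    conicForm x 3 0 1 2 4 5 6 = -Matrix.det (Matrix.of fun (j i : Fin 3) =>
      pairProducts (x (![4, 5, 6] j)) (![0, 1, 3] i)) := by
  obtain ⟨h0, h1, h2, h3⟩ := hf
  simp only [conicForm, plucker, h0, h1, h2, h3, det_four, Matrix.det_fin_three]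
  simp [pairProducts]
  refine ⟨?_, ?_, ?_, ?_⟩ <;> ring

lemma StandardFrame.apply_single {x : Fin 8 → Fin 4 → L} (hf : StandardFrame x) (a : Fin 4) :
    x (Fin.castAdd 4 a) = Pi.single a 1 := by
  obtain ⟨h0, h1, h2, h3⟩ := hf
  fin_cases a
  · exact h0.trans (by ext b; fin_cases b <;> rfl)
  · exact h1.trans (by ext b; fin_cases b <;> rfl)
  · exact h2.trans (by ext b; fin_cases b <;> rfl)
  · exact h3.trans (by ext b; fin_cases b <;> rfl)

lemma sum_pairProducts (c : Fin 6 → L) (v : Fin 4 → L) : ∑ e, c e * pairProducts v e =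
    c 0 * (v 0 * v 1) + c 1 * (v 0 * v 2) + c 2 * (v 0 * v 3) + c 3 * (v 1 * v 2) +
      c 4 * (v 1 * v 3) + c 5 * (v 2 * v 3) := by
  rw [Fin.sum_univ_six]; rfl

/-- Inversion of the coordinates exchanges complementary products. -/
lemma sum_rev_pairProducts (c : Fin 6 → L) {v : Fin 4 → L} (hv : ∀ a, v a ≠ 0) :
    ∑ e, c (Fin.rev e) * pairProducts v e =
      (v 0 * v 1 * v 2 * v 3) * ∑ e, c e * pairProducts (fun a => (v a)⁻¹) e := by
  have h0 := hv 0
  have h1 := hv 1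
  have h2 := hv 2
  have h3 := hv 3
  rw [sum_pairProducts, sum_pairProducts]
  change c 5 * _ + c 4 * _ + c 3 * _ + c 2 * _ + c 1 * _ + c 0 * _ = _
  field_simp
  ring

lemma exists_eq_smul_single {v : Fin 4 → L} (b : Fin 4) (h : ∀ a, a ≠ b → v a = 0) :
    v = v b • Pi.single b 1 := by
  ext a
  by_cases hab : a = b
  · subst hab; simp
  · simp [h a hab, hab]

lemma conicForm_ne_zero {x : Fin 8 → Fin 4 → L} (hc : ∀ π, cubicForm x π ≠ 0)
    (f : Fin 8 → Fin 8) (hf : Function.Injective f) :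
    conicForm x (f 0) (f 1) (f 2) (f 3) (f 4) (f 5) (f 6) ≠ 0 :=
  hc (Equiv.ofBijective f (Finite.injective_iff_bijective.1 hf))

/-- The standard Cremona transformation maps base loci of nets to base loci of nets. -/
lemma IsInversion.isNetBase {x y : Fin 8 → Fin 4 → L} (h : IsInversion x y)
    (hx : IsNetBase x) (hc : ∀ π, cubicForm x π ≠ 0) : IsNetBase y := by
  obtain ⟨Q, hQ, hQv⟩ := hx
  have hx0 : ∀ i, x i ≠ 0 := by
    intro i
    obtain ⟨a, rfl⟩ | ⟨j, rfl⟩ : (∃ a : Fin 4, Fin.castAdd 4 a = i) ∨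
        ∃ j : Fin 4, Fin.natAdd 4 j = i := by
      induction i using Fin.addCases (m := 4) (n := 4) with
      | left a => exact Or.inl ⟨a, rfl⟩
      | right a => exact Or.inr ⟨a, rfl⟩
    · rw [h.left.apply_single]; simp
    · exact fun h' => h.ne_zero j 0 (congrFun h' 0)
  have hQx : ∀ k i, Q k (x i) = 0 := fun k i =>
    (hQv _ (hx0 i)).2 ⟨i, 1, (one_smul _ _).symm⟩ k
  set c : Fin 3 → Fin 6 → L := fun k => (quadCoeffs (Q k)).2 with hcdef
  -- Vanishing at the coordinate points kills the coefficients of the squares.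
  have hdiag : ∀ k, (quadCoeffs (Q k)).1 = 0 := by
    intro k
    ext a
    have := hQx k (Fin.castAdd 4 a)
    rwa [h.left.apply_single] at this
  have hQc : ∀ k v, Q k v = ∑ e, c k e * pairProducts v e := by
    intro k v
    rw [quadraticForm_apply, hdiag, sum_pairProducts]
    simp [hcdef]
  have hLI : ∀ g : Fin 3 → L, (∀ e, ∑ k, g k * c k e = 0) → g = 0 := by
    intro g hg
    refine funext (Fintype.linearIndependent_iff.1 hQ g (QuadraticMap.ext fun v => ?_))
    simp only [sum_apply, smul_apply, hQc, smul_eq_mul, zero_apply,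
      Finset.mul_sum]
    rw [Finset.sum_comm]
    refine Finset.sum_eq_zero fun e _ => ?_
    simp only [← mul_assoc]
    rw [← Finset.sum_mul, hg, zero_mul]
  have hQ' : ∀ k v, mixedForm (fun e => c k (Fin.rev e)) v =
      ∑ e, c k (Fin.rev e) * pairProducts v e := fun k v => by
    rw [mixedForm_apply, sum_pairProducts]
  refine ⟨fun k => mixedForm fun e => c k (Fin.rev e), ?_, fun v hv0 => ?_⟩
  · rw [Fintype.linearIndependent_iff]
    intro g hg
    have key : ∀ v, ∑ e, (∑ k, g k * c k (Fin.rev e)) * pairProducts v e = 0 := by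
      intro v
      have := congrArg (fun q : QuadraticForm L (Fin 4 → L) => q v) hg
      simp only [sum_apply, smul_apply, hQ', smul_eq_mul, zero_apply,
        Finset.mul_sum] at this
      rw [Finset.sum_comm] at this
      rw [← this]
      exact Finset.sum_congr rfl fun e _ => by
        rw [Finset.sum_mul]; exact Finset.sum_congr rfl fun k _ => mul_assoc _ _ _
    refine congrFun (hLI g fun e => ?_)
    -- A vector with two ones isolates a single mixed coefficient.
    have k0 := key ![1, 1, 0, 0]
    have k1 := key ![1, 0, 1, 0]
    have k2 := key ![1, 0, 0, 1]
    have k3 := key ![0, 1, 1, 0]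
    have k4 := key ![0, 1, 0, 1]
    have k5 := key ![0, 0, 1, 1]
    rw [sum_pairProducts] at k0 k1 k2 k3 k4 k5
    fin_cases e
    · simpa using k5
    · simpa using k4
    · simpa using k3
    · simpa using k2
    · simpa using k1
    · simpa using k0
  · simp only [hQ']
    constructor
    · intro hv
      -- Off the coordinate planes inversion is a bijection between base points. On the planes it
      -- must be shown that only the coordinate points remain.
      by_cases hall : ∀ a, v a ≠ 0
      · have hw0 : (fun a => (v a)⁻¹) ≠ 0 := fun h' => inv_ne_zero (hall 0) (congrFun h' 0)
        obtain ⟨i, d, hi⟩ := (hQv _ hw0).1 (fun k => by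
          have := hv k
          rw [sum_rev_pairProducts _ hall] at this
          rw [hQc]
          exact (mul_eq_zero.1 this).resolve_left
            (mul_ne_zero (mul_ne_zero (mul_ne_zero (hall 0) (hall 1)) (hall 2)) (hall 3)))
        induction i using Fin.addCases (m := 4) (n := 4) with
        | left a =>
          exfalso
          rw [h.left.apply_single] at hi
          obtain ⟨b, hb⟩ := exists_ne a
          have := congrFun hi b
          simp [hb, hall] at this
        | right j =>
          refine ⟨Fin.natAdd 4 j, d⁻¹, ?_⟩
          ext a
          have := congrFun hi a
          simp only [Pi.smul_apply, smul_eq_mul] at this ⊢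
          rw [h.inv, ← mul_inv, ← this, inv_inv]
      · push Not at hall
        obtain ⟨a, ha⟩ := hall
        suffices ∃ b, ∀ a, a ≠ b → v a = 0 by
          obtain ⟨b, hb⟩ := this
          exact ⟨Fin.castAdd 4 b, v b, by
            rw [h.right.apply_single]; exact exists_eq_smul_single b hb⟩
        have hp : ∀ k (j : Fin 3), ∑ e, c k e * pairProducts (x (![4, 5, 6] j)) e = 0 :=
          fun k j => by rw [← hQc, hQx]
        obtain ⟨d0, d1, d2, d3⟩ := conicForm_eq_det h.left
        have n0 := neg_ne_zero.1 (d0 ▸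
          conicForm_ne_zero hc ![0, 1, 2, 3, 4, 5, 6, 7] (by decide))
        have n1 := neg_ne_zero.1 (d1 ▸
          conicForm_ne_zero hc ![1, 0, 2, 3, 4, 5, 6, 7] (by decide))
        have n2 := neg_ne_zero.1 (d2 ▸
          conicForm_ne_zero hc ![2, 0, 1, 3, 4, 5, 6, 7] (by decide))
        have n3 := neg_ne_zero.1 (d3 ▸
          conicForm_ne_zero hc ![3, 0, 1, 2, 4, 5, 6, 7] (by decide))
        have hv' : ∀ k, c k 5 * (v 0 * v 1) + c k 4 * (v 0 * v 2) + c k 3 * (v 0 * v 3) +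
            c k 2 * (v 1 * v 2) + c k 1 * (v 1 * v 3) + c k 0 * (v 2 * v 3) = 0 := fun k => by
          have := hv k
          rwa [sum_pairProducts] at this
        -- On the plane `v a = 0` only the products without `v a` survive. Inversion has paired them
        -- with the coefficients of the products that involve the index `a`, so `s` lists these and
        -- `t` the other three. The determinant at `t` is the conic condition projected from the
        -- frame point `a`. The three surviving products must vanish, which leaves at most one
        -- nonzero coordinate.
        fin_cases a
        · have := net_products_eq_zero hLI hp (s := ![0, 1, 2]) (t := ![3, 4, 5]) (by decide) n0
            (G := ![v 2 * v 3, v 1 * v 3, v 1 * v 2]) (fun k => by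
              have := hv' k
              rw [show v 0 = 0 from ha] at this
              rw [Fin.sum_univ_three]
              simp
              linear_combination this)
          rcases two_zero_of_products (congrFun this 0) (congrFun this 1) (congrFun this 2) with
            ⟨h1, h2⟩ | ⟨h1, h2⟩ | ⟨h1, h2⟩
          · exact ⟨1, fun a h => by fin_cases a <;> first | assumption | exact absurd rfl h⟩
          · exact ⟨2, fun a h => by fin_cases a <;> first | assumption | exact absurd rfl h⟩
          · exact ⟨3, fun a h => by fin_cases a <;> first | assumption | exact absurd rfl h⟩
        · have := net_products_eq_zero hLI hp (s := ![0, 3, 4]) (t := ![1, 2, 5]) (by decide) n1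
            (G := ![v 2 * v 3, v 0 * v 3, v 0 * v 2]) (fun k => by
              have := hv' k
              rw [show v 1 = 0 from ha] at this
              rw [Fin.sum_univ_three]
              simp
              linear_combination this)
          rcases two_zero_of_products (congrFun this 0) (congrFun this 1) (congrFun this 2) with
            ⟨h1, h2⟩ | ⟨h1, h2⟩ | ⟨h1, h2⟩
          · exact ⟨0, fun a h => by fin_cases a <;> first | assumption | exact absurd rfl h⟩
          · exact ⟨2, fun a h => by fin_cases a <;> first | assumption | exact absurd rfl h⟩
          · exact ⟨3, fun a h => by fin_cases a <;> first | assumption | exact absurd rfl h⟩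
        · have := net_products_eq_zero hLI hp (s := ![1, 3, 5]) (t := ![0, 2, 4]) (by decide) n2
            (G := ![v 1 * v 3, v 0 * v 3, v 0 * v 1]) (fun k => by
              have := hv' k
              rw [show v 2 = 0 from ha] at this
              rw [Fin.sum_univ_three]
              simp
              linear_combination this)
          rcases two_zero_of_products (congrFun this 0) (congrFun this 1) (congrFun this 2) with
            ⟨h1, h2⟩ | ⟨h1, h2⟩ | ⟨h1, h2⟩
          · exact ⟨0, fun a h => by fin_cases a <;> first | assumption | exact absurd rfl h⟩
          · exact ⟨1, fun a h => by fin_cases a <;> first | assumption | exact absurd rfl h⟩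
          · exact ⟨3, fun a h => by fin_cases a <;> first | assumption | exact absurd rfl h⟩
        · have := net_products_eq_zero hLI hp (s := ![2, 4, 5]) (t := ![0, 1, 3]) (by decide) n3
            (G := ![v 1 * v 2, v 0 * v 2, v 0 * v 1]) (fun k => by
              have := hv' k
              rw [show v 3 = 0 from ha] at this
              rw [Fin.sum_univ_three]
              simp
              linear_combination this)
          rcases two_zero_of_products (congrFun this 0) (congrFun this 1) (congrFun this 2) with
            ⟨h1, h2⟩ | ⟨h1, h2⟩ | ⟨h1, h2⟩
          · exact ⟨0, fun a h => by fin_cases a <;> first | assumption | exact absurd rfl h⟩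
          · exact ⟨1, fun a h => by fin_cases a <;> first | assumption | exact absurd rfl h⟩
          · exact ⟨2, fun a h => by fin_cases a <;> first | assumption | exact absurd rfl h⟩
    · rintro ⟨i, d, rfl⟩ k
      have hscale : ∀ w : Fin 4 → L, (∑ e, c k (Fin.rev e) * pairProducts w e = 0) →
          ∑ e, c k (Fin.rev e) * pairProducts (d • w) e = 0 := by
        intro w hw
        rw [sum_pairProducts] at hw ⊢
        simp only [Pi.smul_apply, smul_eq_mul]
        linear_combination d ^ 2 * hw
      refine hscale _ ?_
      induction i using Fin.addCases (m := 4) (n := 4) with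
      | left a =>
        rw [h.right.apply_single, sum_pairProducts]
        fin_cases a <;> simp
      | right j =>
        have hy : ∀ a, y (Fin.natAdd 4 j) a ≠ 0 := fun a => by
          rw [h.inv]; exact inv_ne_zero (h.ne_zero j a)
        rw [sum_rev_pairProducts _ hy]
        have : (fun a => (y (Fin.natAdd 4 j) a)⁻¹) = x (Fin.natAdd 4 j) := by
          ext a; rw [h.inv, inv_inv]
        rw [this, ← hQc, hQx, mul_zero]

end CremonaNet

/-! ### Valuations of minors and of conic conditions of regular tuples. -/

section Valuation
variable {L : Type*} [Field L] (ν : AddValuation L (WithTop ℚ))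

/-- The valuation of a nonzero element, as a rational number. -/
def nu (a : L) : ℚ := (ν a).untopD 0

variable {ν}

lemma coe_nu {a : L} (ha : a ≠ 0) : ν a = (nu ν a : WithTop ℚ) := by
  have : ν a ≠ ⊤ := fun h => ha (ν.top_iff.1 h)
  obtain ⟨q, hq⟩ := WithTop.ne_top_iff_exists.1 this
  rw [nu, ← hq]; rfl

lemma nu_eq_iff {a : L} {q : ℚ} : ν a = (q : WithTop ℚ) ↔ a ≠ 0 ∧ nu ν a = q := by
  constructor
  · intro h
    have ha : a ≠ 0 := by
      rintro rfl
      rw [ν.map_zero] at h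
      exact WithTop.top_ne_coe h
    rw [coe_nu ha] at h
    exact ⟨ha, WithTop.coe_injective h⟩
  · rintro ⟨ha, rfl⟩
    exact coe_nu ha

lemma nu_mul {a b : L} (ha : a ≠ 0) (hb : b ≠ 0) : nu ν (a * b) = nu ν a + nu ν b := by
  have := ν.map_mul a b
  rw [coe_nu ha, coe_nu hb, coe_nu (mul_ne_zero ha hb), ← WithTop.coe_add] at this
  exact WithTop.coe_injective this

lemma nu_one : nu ν (1 : L) = 0 := (nu_eq_iff.1 (ν.map_one : ν 1 = ((0 : ℚ) : WithTop ℚ))).2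

lemma nu_pow {a : L} (ha : a ≠ 0) (n : ℕ) : nu ν (a ^ n) = n * nu ν a := by
  induction n with
  | zero => simp [nu_one]
  | succ n ih => rw [pow_succ, nu_mul (pow_ne_zero _ ha) ha, ih]; push_cast; ring

lemma nu_neg (a : L) : nu ν (-a) = nu ν a := by rw [nu, ν.map_neg]; rfl

/-- Valuations do not see signs. This is why identities up to sign are recorded throughout as
equalities of squares. -/
lemma nu_eq_of_sq {a b : L} (h : a ^ 2 = b ^ 2) : nu ν a = nu ν b := by
  rcases sq_eq_sq_iff_eq_or_eq_neg.1 h with rfl | rfl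
  · rfl
  · exact nu_neg b

lemma nu_prod {ι : Type*} (s : Finset ι) {f : ι → L} (hf : ∀ i, f i ≠ 0) :
    nu ν (∏ i ∈ s, f i) = ∑ i ∈ s, nu ν (f i) := by
  classical
  induction s using Finset.induction_on with
  | empty => simp [nu_one]
  | insert i s hi ih =>
    rw [Finset.prod_insert hi, Finset.sum_insert hi,
      nu_mul (hf i) (Finset.prod_ne_zero_iff.2 fun j _ => hf j), ih]

variable (ν)

/-- The valuation of the minor with a given set of four labels. -/
def minorNu (x : Fin 8 → Fin 4 → L) (S : Finset (Fin 8)) : ℚ :=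
  if h : S.card = 4 then nu ν (minor x (S.orderEmbOfFin h)) else 0

/-- The valuation of the conic condition. -/
def cubicNu (x : Fin 8 → Fin 4 → L) : ℚ := nu ν (cubicForm x 1)

variable {ν}

lemma minorNu_image (x : Fin 8 → Fin 4 → L) {f : Fin 4 → Fin 8} (hf : Function.Injective f) :
    minorNu ν x (Finset.univ.image f) = nu ν (minor x f) := by
  have hc : (Finset.univ.image f).card = 4 := by
    rw [Finset.card_image_of_injective _ hf]; rfl
  rw [minorNu, dif_pos hc]
  refine nu_eq_of_sq (minor_sq_congr x (Finset.orderEmbOfFin _ hc).injective hf ?_)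
  rw [Finset.range_orderEmbOfFin]
  simp

lemma minorNu_plucker (x : Fin 8 → Fin 4 → L) {i j k l : Fin 8}
    (h : Function.Injective ![i, j, k, l]) :
    minorNu ν x {i, j, k, l} = nu ν (plucker x i j k l) := by
  have : ({i, j, k, l} : Finset (Fin 8)) = Finset.univ.image ![i, j, k, l] := by
    ext m
    simp only [Finset.mem_insert, Finset.mem_singleton, Finset.mem_image, Finset.mem_univ,
      true_and, Fin.exists_fin_succ]
    simp [eq_comm]
  rw [this, minorNu_image x h, plucker_eq_minor]

lemma exists_image_eq {S : Finset (Fin 8)} (hS : S.card = 4) :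
    ∃ f : Fin 4 → Fin 8, Function.Injective f ∧ Finset.univ.image f = S :=
  ⟨S.orderEmbOfFin hS, (S.orderEmbOfFin hS).injective, by simp⟩

lemma minorNu_comp (x : Fin 8 → Fin 4 → L) (ρ : Equiv.Perm (Fin 8)) {S : Finset (Fin 8)}
    (hS : S.card = 4) : minorNu ν (x ∘ ρ) S = minorNu ν x (S.image ρ) := by
  obtain ⟨f, hf, rfl⟩ := exists_image_eq hS
  rw [minorNu_image _ hf, Finset.image_image, minorNu_image _ (ρ.injective.comp hf), minor_comp]

lemma minorNu_smul_mulVec {x : Fin 8 → Fin 4 → L} (hx : GeneralPosition x)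
    {M : Matrix (Fin 4) (Fin 4) L} {c : Fin 8 → L} (hM : M.det ≠ 0) (hc : ∀ i, c i ≠ 0)
    {S : Finset (Fin 8)} (hS : S.card = 4) :
    minorNu ν (fun i => c i • M.mulVec (x i)) S =
      minorNu ν x S + nu ν M.det + ∑ i ∈ S, nu ν (c i) := by
  obtain ⟨f, hf, rfl⟩ := exists_image_eq hS
  rw [minorNu_image _ hf, minorNu_image _ hf, minor_smul_mulVec,
    nu_mul (Finset.prod_ne_zero_iff.2 fun a _ => hc _) (mul_ne_zero hM (hx f hf)),
    nu_mul hM (hx f hf), nu_prod _ fun a => hc (f a), Finset.sum_image fun a _ b _ h => hf h]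
  ring

lemma SelfDual.minorNu_compl {x : Fin 8 → Fin 4 → L} (hx : SelfDual x) {S : Finset (Fin 8)}
    (hS : S.card = 4) : minorNu ν x Sᶜ = minorNu ν x S := by
  have hS' : Sᶜ.card = 4 := by rw [Finset.card_compl, hS]; rfl
  obtain ⟨f, hf, h1⟩ := exists_image_eq hS
  obtain ⟨g, hg, h2⟩ := exists_image_eq hS'
  rw [← h2, ← h1, minorNu_image _ hf, minorNu_image _ hg]
  refine nu_eq_of_sq (hx.minor_sq_compl hg hf fun a b h => ?_)
  have ha : g a ∈ Sᶜ := h2 ▸ Finset.mem_image_of_mem g (Finset.mem_univ a)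
  have hb : f b ∈ S := h1 ▸ Finset.mem_image_of_mem f (Finset.mem_univ b)
  exact Finset.mem_compl.1 ha (h ▸ hb)

/-- A self-dual tuple in general position whose points lie on no twisted cubic. -/
structure IsRegular (x : Fin 8 → Fin 4 → L) : Prop where
  selfDual : SelfDual x
  general : GeneralPosition x
  cubic : ∀ π, cubicForm x π ≠ 0

lemma IsRegular.nu_cubicForm {x : Fin 8 → Fin 4 → L} (hx : IsRegular x)
    (π : Equiv.Perm (Fin 8)) : nu ν (cubicForm x π) = cubicNu ν x :=
  nu_eq_of_sq (hx.selfDual.cubicForm_sq hx.general π)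

/-- All conic conditions have the same square, so one nonvanishing condition suffices. -/
lemma IsRegular.of_cubic {x : Fin 8 → Fin 4 → L} (h1 : SelfDual x) (h2 : GeneralPosition x)
    {π : Equiv.Perm (Fin 8)} (h3 : cubicForm x π ≠ 0) : IsRegular x := by
  refine ⟨h1, h2, fun σ h => h3 ?_⟩
  have := (h1.cubicForm_sq h2 π).trans (h1.cubicForm_sq h2 σ).symm
  rw [h] at this
  simpa using this

lemma IsRegular.comp {x : Fin 8 → Fin 4 → L} (hx : IsRegular x) (ρ : Equiv.Perm (Fin 8)) :
    IsRegular (x ∘ ρ) :=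
  ⟨hx.selfDual.comp ρ, hx.general.comp ρ, fun π => hx.cubic (ρ * π)⟩

lemma IsRegular.cubicNu_comp {x : Fin 8 → Fin 4 → L} (hx : IsRegular x)
    (ρ : Equiv.Perm (Fin 8)) : cubicNu ν (x ∘ ρ) = cubicNu ν x := by
  rw [cubicNu, cubicForm_comp, hx.nu_cubicForm]

lemma cubicFactor_ne_zero {d : L} {c : Fin 8 → L} (hd : d ≠ 0) (hc : ∀ i, c i ≠ 0)
    (π : Equiv.Perm (Fin 8)) : cubicFactor d c π ≠ 0 := by
  simp [cubicFactor, hd, hc]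

/-- The label `π 0` occurs in all four minors of each monomial, `π 1, …, π 6` in two of them and `π
7` in none. The determinant enters once for every minor. -/
lemma nu_cubicFactor {d : L} {c : Fin 8 → L} (hd : d ≠ 0) (hc : ∀ i, c i ≠ 0)
    (π : Equiv.Perm (Fin 8)) : nu ν (cubicFactor d c π) =
      4 * nu ν d + 4 * nu ν (c (π 0)) + 2 * (nu ν (c (π 1)) + nu ν (c (π 2)) + nu ν (c (π 3)) +
        nu ν (c (π 4)) + nu ν (c (π 5)) + nu ν (c (π 6))) := by
  unfold cubicFactor
  have h1 := pow_ne_zero 2 (hc (π 0))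
  have h2 := mul_ne_zero h1 (hc (π 1))
  have h3 := mul_ne_zero h2 (hc (π 2))
  have h4 := mul_ne_zero h3 (hc (π 3))
  have h5 := mul_ne_zero h4 (hc (π 4))
  have h6 := mul_ne_zero h5 (hc (π 5))
  have h7 := mul_ne_zero h6 (hc (π 6))
  have h8 := pow_ne_zero 2 hd
  rw [nu_pow (mul_ne_zero h7 h8), nu_mul h7 h8, nu_mul h6 (hc _), nu_mul h5 (hc _),
    nu_mul h4 (hc _), nu_mul h3 (hc _), nu_mul h2 (hc _), nu_mul h1 (hc _), nu_pow (hc _),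
    nu_pow hd]
  push_cast
  ring

lemma IsRegular.mulVec {x : Fin 8 → Fin 4 → L} (hx : IsRegular x)
    {M : Matrix (Fin 4) (Fin 4) L} (hM : M.det ≠ 0) : IsRegular fun i => M.mulVec (x i) := by
  have hc : ∀ i : Fin 8, (1 : L) ≠ 0 := fun _ => one_ne_zero
  refine ⟨hx.selfDual.mulVec M, ?_, fun π => ?_⟩
  · simpa using hx.general.smul_mulVec hM hc
  · have := cubicForm_smul_mulVec M (fun _ => 1) x π
    simp only [one_smul] at this
    rw [this]
    exact mul_ne_zero (cubicFactor_ne_zero hM hc π) (hx.cubic π)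

lemma IsRegular.minorNu_mulVec {x : Fin 8 → Fin 4 → L} (hx : IsRegular x)
    {M : Matrix (Fin 4) (Fin 4) L} (hM : M.det ≠ 0) {S : Finset (Fin 8)} (hS : S.card = 4) :
    minorNu ν (fun i => M.mulVec (x i)) S = minorNu ν x S + nu ν M.det := by
  have := minorNu_smul_mulVec (ν := ν) hx.general hM (c := fun _ => 1)
    (fun _ => one_ne_zero) hS
  simpa [nu_one] using this

lemma IsRegular.cubicNu_mulVec {x : Fin 8 → Fin 4 → L} (hx : IsRegular x)
    {M : Matrix (Fin 4) (Fin 4) L} (hM : M.det ≠ 0) :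
    cubicNu ν (fun i => M.mulVec (x i)) = cubicNu ν x + 4 * nu ν M.det := by
  have hc : ∀ i : Fin 8, (1 : L) ≠ 0 := fun _ => one_ne_zero
  have := cubicForm_smul_mulVec M (fun _ => 1) x 1
  simp only [one_smul] at this
  rw [cubicNu, this, nu_mul (cubicFactor_ne_zero hM hc 1) (hx.cubic 1), nu_cubicFactor hM hc,
    nu_one, cubicNu]
  ring

end Valuation

/-! ### The square relation of the inverted tuple, and symmetries fixing the frame. -/

section CremonaValuation
variable {L : Type*} [Field L] {ν : AddValuation L (WithTop ℚ)}

/-- The coefficients of the relation between the squares of the inverted tuple. -/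
def inversionCoeff (x : Fin 8 → Fin 4 → L) : Fin 8 → L :=
  Fin.append (m := 4) (n := 4)
    (fun a => -∑ j : Fin 4, (∏ b, x (Fin.natAdd 4 j) b) * ((x (Fin.natAdd 4 j) a)⁻¹) ^ 2)
    (fun j => ∏ b, x (Fin.natAdd 4 j) b)

/-- Clearing denominators turns a product of two inverted coordinates into the product of the other
two coordinates. -/
lemma exists_complementary_product {a b : Fin 4} (hab : a ≠ b) :
    ∃ c d : Fin 4, c ≠ d ∧ ∀ v : Fin 4 → L, (∀ e, v e ≠ 0) →
      (∏ e, v e) * ((v a)⁻¹ * (v b)⁻¹) = v c * v d := by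
  obtain ⟨c, d, hcd, h⟩ : ∃ c d : Fin 4, c ≠ d ∧ Function.Bijective ![a, b, c, d] := by
    revert a b; decide
  refine ⟨c, d, hcd, fun v hv => ?_⟩
  have ha := hv a
  have hb := hv b
  rw [← h.prod_comp, Fin.prod_univ_four]
  simp only [Matrix.cons_val]
  field_simp

/-- Weighting an inverted point by the product of its original coordinates turns the off-diagonal
entries into sums of complementary products, which vanish by the orthogonality of rows. The diagonal
entries need not vanish; the coefficients of the frame points are chosen to cancel them. -/
lemma IsInversion.squareRelation {x y : Fin 8 → Fin 4 → L} (h : IsInversion x y)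
    (hx : SelfDual x) : SquareRelation (inversionCoeff x) y := by
  intro a b
  have key : ∑ i, inversionCoeff x i * (y i a * y i b) =
      (∑ c : Fin 4, (-∑ j : Fin 4, (∏ b, x (Fin.natAdd 4 j) b) * ((x (Fin.natAdd 4 j) c)⁻¹) ^ 2) *
        ((Pi.single c 1 : Fin 4 → L) a * (Pi.single c 1 : Fin 4 → L) b)) +
      ∑ j : Fin 4, (∏ b, x (Fin.natAdd 4 j) b) *
        ((x (Fin.natAdd 4 j) a)⁻¹ * (x (Fin.natAdd 4 j) b)⁻¹) := by
    refine (Fin.sum_univ_add (a := 4) (b := 4) _).trans ?_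
    refine congrArg₂ _ (Finset.sum_congr rfl fun c _ => ?_) (Finset.sum_congr rfl fun j _ => ?_)
    · rw [h.right.apply_single, inversionCoeff, Fin.append_left]
    · rw [h.inv, h.inv, inversionCoeff, Fin.append_right]
  rw [key]
  by_cases hab : a = b
  · subst hab
    have : ∀ f : Fin 4 → L, ∑ c, f c * ((Pi.single c 1 : Fin 4 → L) a *
        (Pi.single c 1 : Fin 4 → L) a) = f a := by
      intro f
      rw [Finset.sum_eq_single a]
      · simp
      · intro c _ hc
        simp [hc.symm]
      · simp
    rw [this]
    simp only [sq]
    ring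
  · have h1 : ∀ f : Fin 4 → L, ∑ c, f c * ((Pi.single c 1 : Fin 4 → L) a *
        (Pi.single c 1 : Fin 4 → L) b) = 0 := by
      intro f
      refine Finset.sum_eq_zero fun c _ => ?_
      by_cases hc : c = a
      · subst hc; simp [hab]
      · simp [Ne.symm hc]
    rw [h1, zero_add]
    obtain ⟨c, d, hcd, hp⟩ := exists_complementary_product (L := L) hab
    simp only [hp _ (h.ne_zero _)]
    have := hx.frame_rows h.left c d
    rw [if_neg hcd] at this
    rw [Fin.sum_univ_four]
    exact this

/-- The permutation of the labels that permutes the first four and the last four separately. -/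
def blockPerm (α β : Equiv.Perm (Fin 4)) : Equiv.Perm (Fin 8) :=
  (finSumFinEquiv (m := 4) (n := 4)).permCongr (Equiv.sumCongr α β)

lemma blockPerm_castAdd (α β : Equiv.Perm (Fin 4)) (a : Fin 4) :
    blockPerm α β (Fin.castAdd 4 a) = Fin.castAdd 4 (α a) := by
  rw [blockPerm, Equiv.permCongr_apply, finSumFinEquiv_symm_apply_castAdd]; rfl

lemma blockPerm_natAdd (α β : Equiv.Perm (Fin 4)) (j : Fin 4) :
    blockPerm α β (Fin.natAdd 4 j) = Fin.natAdd 4 (β j) := by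
  rw [blockPerm, Equiv.permCongr_apply, finSumFinEquiv_symm_apply_natAdd]; rfl

/-- Relabelling of a tuple by `blockPerm`, with the corresponding permutation of coordinates. -/
def blockMap (α β : Equiv.Perm (Fin 4)) (x : Fin 8 → Fin 4 → L) : Fin 8 → Fin 4 → L :=
  fun i a => x (blockPerm α β i) (α a)

lemma standardFrame_iff {x : Fin 8 → Fin 4 → L} :
    StandardFrame x ↔ ∀ a : Fin 4, x (Fin.castAdd 4 a) = Pi.single a 1 := by
  refine ⟨fun h => h.apply_single, fun h => ⟨?_, ?_, ?_, ?_⟩⟩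
  · exact (h 0).trans (by ext b; fin_cases b <;> rfl)
  · exact (h 1).trans (by ext b; fin_cases b <;> rfl)
  · exact (h 2).trans (by ext b; fin_cases b <;> rfl)
  · exact (h 3).trans (by ext b; fin_cases b <;> rfl)

lemma StandardFrame.blockMap {x : Fin 8 → Fin 4 → L} (h : StandardFrame x)
    (α β : Equiv.Perm (Fin 4)) : StandardFrame (blockMap α β x) := by
  rw [standardFrame_iff] at h ⊢
  intro a
  ext b
  rw [CayleyOctad.blockMap, blockPerm_castAdd, h]
  simp [Pi.single_apply]

lemma IsInversion.blockMap {x y : Fin 8 → Fin 4 → L} (h : IsInversion x y)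
    (α β : Equiv.Perm (Fin 4)) : IsInversion (blockMap α β x) (blockMap α β y) where
  left := h.left.blockMap α β
  right := h.right.blockMap α β
  ne_zero j a := by
    rw [CayleyOctad.blockMap, blockPerm_natAdd]; exact h.ne_zero _ _
  inv j a := by
    rw [CayleyOctad.blockMap, CayleyOctad.blockMap, blockPerm_natAdd]; exact h.inv _ _

/-- Permuting the coordinates with the frame labels restores the frame at the cost of a sign.
Formulas proved for one choice of labels thereby extend to all choices inside and outside the frame.
-/
lemma minor_blockMap (α β : Equiv.Perm (Fin 4)) (x : Fin 8 → Fin 4 → L) (f : Fin 4 → Fin 8) :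
    minor (blockMap α β x) f = (Equiv.Perm.sign α : ℤ) * minor x (blockPerm α β ∘ f) := by
  have := Matrix.det_permute' α (Matrix.of fun a => x (blockPerm α β (f a)))
  rw [minor, minor]
  exact this

lemma minor_blockMap_sq (α β : Equiv.Perm (Fin 4)) (x : Fin 8 → Fin 4 → L) (f : Fin 4 → Fin 8) :
    minor (blockMap α β x) f ^ 2 = minor x (blockPerm α β ∘ f) ^ 2 := by
  rw [minor_blockMap, mul_pow]
  rcases Int.units_eq_one_or (Equiv.Perm.sign α) with h | h <;> simp [h]

lemma cubicForm_blockMap (α β : Equiv.Perm (Fin 4)) (x : Fin 8 → Fin 4 → L)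
    (π : Equiv.Perm (Fin 8)) :
    cubicForm (blockMap α β x) π = cubicForm x (blockPerm α β * π) := by
  simp only [cubicForm, cubicMonomial₁, cubicMonomial₂, plucker_eq_minor, minor_blockMap]
  have e : ∀ i j k l, blockPerm α β ∘ ![i, j, k, l] =
      ![blockPerm α β i, blockPerm α β j, blockPerm α β k, blockPerm α β l] := by
    intros; ext m; fin_cases m <;> rfl
  simp only [e, Equiv.Perm.mul_apply]
  rcases Int.units_eq_one_or (Equiv.Perm.sign α) with h | h <;> simp [h]

lemma IsRegular.blockMap {x : Fin 8 → Fin 4 → L} (h : IsRegular x)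
    (α β : Equiv.Perm (Fin 4)) : IsRegular (blockMap α β x) where
  selfDual a b := h.selfDual.comp (blockPerm α β) (α a) (α b)
  general f hf := by
    have h1 := h.general _ ((blockPerm α β).injective.comp hf)
    intro h2
    have h3 := minor_blockMap_sq α β x f
    rw [h2] at h3
    exact pow_ne_zero 2 h1 (h3.symm.trans (by simp))
  cubic π := by
    rw [cubicForm_blockMap]; exact h.cubic _

lemma inversionCoeff_blockMap (α β : Equiv.Perm (Fin 4)) (x : Fin 8 → Fin 4 → L) (i : Fin 8) :
    inversionCoeff (blockMap α β x) i = inversionCoeff x (blockPerm α β i) := by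
  induction i using Fin.addCases (m := 4) (n := 4) with
  | left a =>
    rw [blockPerm_castAdd, inversionCoeff, inversionCoeff, Fin.append_left, Fin.append_left]
    simp only [blockMap, blockPerm_natAdd]
    congr 1
    rw [← Equiv.sum_comp β fun j => (∏ b, x (Fin.natAdd 4 j) b) *
      ((x (Fin.natAdd 4 j) (α a))⁻¹) ^ 2]
    refine Finset.sum_congr rfl fun j _ => ?_
    rw [Equiv.prod_comp α (fun b => x (Fin.natAdd 4 (β j)) b)]
  | right j =>
    rw [blockPerm_natAdd, inversionCoeff, inversionCoeff, Fin.append_right, Fin.append_right]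
    simp only [blockMap, blockPerm_natAdd]
    exact Equiv.prod_comp α (fun b => x (Fin.natAdd 4 (β j)) b)

end CremonaValuation

/-! ### Minors of the inverted tuple and valuations of its square relation. -/

section CremonaFormulas
variable {L : Type*} [Field L] {ν : AddValuation L (WithTop ℚ)}

lemma StandardFrame.plucker_values {x : Fin 8 → Fin 4 → L} (h : StandardFrame x) :
    plucker x 0 1 2 3 = 1 ∧ plucker x 1 2 3 4 = -x 4 0 ∧
    plucker x 0 1 2 5 = x 5 3 ∧
    plucker x 2 3 4 5 = x 4 0 * x 5 1 - x 4 1 * x 5 0 ∧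
    plucker x 0 3 6 7 = x 6 1 * x 7 2 - x 6 2 * x 7 1 ∧
    plucker x 4 1 2 5 = x 4 0 * x 5 3 - x 4 3 * x 5 0 := by
  obtain ⟨h0, h1, h2, h3⟩ := h
  simp only [plucker, h0, h1, h2, h3, det_four]
  refine ⟨?_, ?_, ?_, ?_, ?_, ?_⟩ <;> simp

lemma IsInversion.coord_ne_zero {x y : Fin 8 → Fin 4 → L} (h : IsInversion x y) (a : Fin 4) :
    x 4 a ≠ 0 ∧ x 5 a ≠ 0 ∧ x 6 a ≠ 0 ∧ x 7 a ≠ 0 :=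
  ⟨h.ne_zero 0 a, h.ne_zero 1 a, h.ne_zero 2 a, h.ne_zero 3 a⟩

lemma IsInversion.coord_inv {x y : Fin 8 → Fin 4 → L} (h : IsInversion x y) (a : Fin 4) :
    y 4 a = (x 4 a)⁻¹ ∧ y 5 a = (x 5 a)⁻¹ ∧ y 6 a = (x 6 a)⁻¹ ∧ y 7 a = (x 7 a)⁻¹ :=
  ⟨h.inv 0 a, h.inv 1 a, h.inv 2 a, h.inv 3 a⟩

lemma IsInversion.symm {x y : Fin 8 → Fin 4 → L} (h : IsInversion x y) : IsInversion y x where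
  left := h.right
  right := h.left
  ne_zero j a := by rw [h.inv]; exact inv_ne_zero (h.ne_zero j a)
  inv j a := by rw [h.inv, inv_inv]

lemma two_minor_inv {a b c d : L} (ha : a ≠ 0) (hb : b ≠ 0) (hc : c ≠ 0) (hd : d ≠ 0) :
    (a⁻¹ * b⁻¹ - c⁻¹ * d⁻¹) * (a * b * (c * d)) = -(a * b - c * d) := by
  field_simp
  ring

/-- In the frame, a quadruple with two frame labels gives a two-rowed minor of coordinates.
Inverting the entries changes such a minor only by a sign and a monomial. -/
lemma IsInversion.plucker_two {x y : Fin 8 → Fin 4 → L} (h : IsInversion x y) :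
    plucker y 2 3 4 5 * (x 4 0 * x 5 1 * (x 4 1 * x 5 0)) = -plucker x 2 3 4 5 ∧
    plucker y 0 3 6 7 * (x 6 1 * x 7 2 * (x 6 2 * x 7 1)) = -plucker x 0 3 6 7 ∧
    plucker y 4 1 2 5 * (x 4 0 * x 5 3 * (x 4 3 * x 5 0)) = -plucker x 4 1 2 5 := by
  obtain ⟨-, -, -, h1, h2, h3⟩ := h.left.plucker_values
  obtain ⟨-, -, -, k1, k2, k3⟩ := h.right.plucker_values
  have hy := h.coord_inv
  have h0 := h.coord_ne_zero
  rw [h1, h2, h3, k1, k2, k3]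
  simp only [hy]
  exact ⟨two_minor_inv (h0 0).1 (h0 1).2.1 (h0 1).1 (h0 0).2.1,
    two_minor_inv (h0 1).2.2.1 (h0 2).2.2.2 (h0 2).2.2.1 (h0 1).2.2.2,
    two_minor_inv (h0 0).1 (h0 3).2.1 (h0 3).1 (h0 0).2.1⟩

/-- A three-rowed minor of the inverted tuple is a conic condition on the tuple. -/
lemma IsInversion.plucker_three {x y : Fin 8 → Fin 4 → L} (h : IsInversion x y) :
    plucker y 0 4 5 6 * (x 4 1 * x 4 2 * x 4 3 * (x 5 1 * x 5 2 * x 5 3) *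
      (x 6 1 * x 6 2 * x 6 3)) = conicForm x 0 1 2 3 4 5 6 ∧
    plucker y 4 3 6 7 * (x 4 0 * x 4 1 * x 4 2 * (x 6 0 * x 6 1 * x 6 2) *
      (x 7 0 * x 7 1 * x 7 2)) = conicForm x 3 0 1 2 4 6 7 := by
  have hy := h.coord_inv
  have h0 := h.coord_ne_zero
  have p0 := h0 0
  have p1 := h0 1
  have p2 := h0 2
  have p3 := h0 3
  obtain ⟨e0, e1, e2, e3⟩ := h.left
  obtain ⟨f0, f1, f2, f3⟩ := h.right
  obtain ⟨h40, h50, h60, h70⟩ := p0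
  obtain ⟨h41, h51, h61, h71⟩ := p1
  obtain ⟨h42, h52, h62, h72⟩ := p2
  obtain ⟨h43, h53, h63, h73⟩ := p3
  constructor
  · simp only [conicForm, plucker, e0, e1, e2, e3, f0, det_four, hy]
    simp
    field_simp
    ring
  · simp only [conicForm, plucker, e0, e1, e2, e3, f3, det_four, hy]
    simp
    field_simp
    ring

/-- The tuple `x` is regular, `y` is its inversion, and rescaling `y` by `s` makes it self-dual. -/
structure CremonaLift (x y : Fin 8 → Fin 4 → L) (s : Fin 8 → L) : Prop where
  inversion : IsInversion x y
  regular : IsRegular x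
  sq : ∀ i, s i ^ 2 = inversionCoeff x i

lemma CremonaLift.selfDual {x y : Fin 8 → Fin 4 → L} {s : Fin 8 → L} (h : CremonaLift x y s) :
    SelfDual fun i => s i • y i := by
  intro a b
  rw [← h.inversion.squareRelation h.regular.selfDual a b]
  refine Finset.sum_congr rfl fun i _ => ?_
  rw [← h.sq]
  simp only [Pi.smul_apply, smul_eq_mul]
  ring

lemma IsInversion.plucker_ne_zero {x y : Fin 8 → Fin 4 → L} (h : IsInversion x y)
    (hx : IsRegular x) : plucker y 2 3 4 5 ≠ 0 ∧ plucker y 0 3 6 7 ≠ 0 ∧ plucker y 4 1 2 5 ≠ 0 ∧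
      plucker y 0 4 5 6 ≠ 0 ∧ plucker y 4 3 6 7 ≠ 0 := by
  obtain ⟨h1, h2, h3⟩ := h.plucker_two
  obtain ⟨h4, h5⟩ := h.plucker_three
  have g : ∀ i j k l, Function.Injective ![i, j, k, l] → plucker x i j k l ≠ 0 :=
    fun i j k l hi => by rw [plucker_eq_minor]; exact hx.general _ hi
  refine ⟨fun h0 => ?_, fun h0 => ?_, fun h0 => ?_, fun h0 => ?_, fun h0 => ?_⟩
  · rw [h0, zero_mul, eq_comm, neg_eq_zero] at h1
    exact g _ _ _ _ (by decide) h1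
  · rw [h0, zero_mul, eq_comm, neg_eq_zero] at h2
    exact g _ _ _ _ (by decide) h2
  · rw [h0, zero_mul, eq_comm, neg_eq_zero] at h3
    exact g _ _ _ _ (by decide) h3
  · rw [h0, zero_mul] at h4
    exact conicForm_ne_zero hx.cubic ![0, 1, 2, 3, 4, 5, 6, 7] (by decide) h4.symm
  · rw [h0, zero_mul] at h5
    exact conicForm_ne_zero hx.cubic ![3, 0, 1, 2, 4, 6, 7, 5] (by decide) h5.symm

lemma IsRegular.nu_conicForm {x : Fin 8 → Fin 4 → L} (hx : IsRegular x) (f : Fin 8 → Fin 8)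
    (hf : Function.Injective f) :
    nu ν (conicForm x (f 0) (f 1) (f 2) (f 3) (f 4) (f 5) (f 6)) = cubicNu ν x :=
  hx.nu_cubicForm (Equiv.ofBijective f (Finite.injective_iff_bijective.1 hf))

lemma inversionCoeff_natAdd (x : Fin 8 → Fin 4 → L) (j : Fin 4) :
    inversionCoeff x (Fin.natAdd 4 j) = ∏ b, x (Fin.natAdd 4 j) b := by
  rw [inversionCoeff, Fin.append_right]

lemma nu_mul_four {a b c d : L} (ha : a ≠ 0) (hb : b ≠ 0) (hc : c ≠ 0) (hd : d ≠ 0) :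
    nu ν (a * b * (c * d)) = nu ν a + nu ν b + nu ν c + nu ν d := by
  rw [nu_mul (mul_ne_zero ha hb) (mul_ne_zero hc hd), nu_mul ha hb, nu_mul hc hd]
  ring

lemma nu_mul_nine {a b c d e f g h i : L} (ha : a ≠ 0) (hb : b ≠ 0) (hc : c ≠ 0) (hd : d ≠ 0)
    (he : e ≠ 0) (hf : f ≠ 0) (hg : g ≠ 0) (hh : h ≠ 0) (hi : i ≠ 0) :
    a * b * c * (d * e * f) * (g * h * i) ≠ 0 ∧
    nu ν (a * b * c * (d * e * f) * (g * h * i)) = nu ν a + nu ν b + nu ν c +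
      (nu ν d + nu ν e + nu ν f) + (nu ν g + nu ν h + nu ν i) := by
  have h1 := mul_ne_zero (mul_ne_zero ha hb) hc
  have h2 := mul_ne_zero (mul_ne_zero hd he) hf
  have h3 := mul_ne_zero (mul_ne_zero hg hh) hi
  refine ⟨mul_ne_zero (mul_ne_zero h1 h2) h3, ?_⟩
  rw [nu_mul (mul_ne_zero h1 h2) h3, nu_mul h1 h2, nu_mul (mul_ne_zero ha hb) hc, nu_mul ha hb,
    nu_mul (mul_ne_zero hd he) hf, nu_mul hd he, nu_mul (mul_ne_zero hg hh) hi, nu_mul hg hh]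

lemma nu_inv {a : L} (ha : a ≠ 0) : nu ν a⁻¹ = -nu ν a := by
  have := nu_mul (ν := ν) ha (inv_ne_zero ha)
  rw [mul_inv_cancel₀ ha, nu_one] at this
  linarith

lemma IsInversion.inversionCoeff_zero_ne_zero {x y : Fin 8 → Fin 4 → L} (h : IsInversion x y)
    (hx : IsRegular x) : inversionCoeff x 0 ≠ 0 ∧ inversionCoeff x 4 ≠ 0 ∧
      inversionCoeff x 0 * (plucker y 0 1 2 5 * plucker y 0 3 6 7) =
        -(inversionCoeff x 4 * (plucker y 4 1 2 5 * plucker y 4 3 6 7)) := by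
  obtain ⟨-, n1, n2, -, n3⟩ := h.plucker_ne_zero hx
  -- This order puts the labels 0 and 4 at the ends and uses the planes 1, 2, 5 and 3, 6, 7. The
  -- four minors in the exchange identity are then a coordinate, two two-rowed minors and one
  -- three-rowed minor.
  have hinj : Function.Injective (![0, 1, 2, 5, 3, 6, 7, 4] : Fin 8 → Fin 8) := by decide
  have hex := (h.squareRelation hx.selfDual).exchange
    (Equiv.ofBijective _ (Finite.injective_iff_bijective.1 hinj))
  change inversionCoeff x 0 * (plucker y 0 1 2 5 * plucker y 0 3 6 7) +
    inversionCoeff x 4 * (plucker y 4 1 2 5 * plucker y 4 3 6 7) = 0 at hex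
  have n4 : inversionCoeff x 4 ≠ 0 := by
    rw [show (4 : Fin 8) = Fin.natAdd 4 (0 : Fin 4) from rfl, inversionCoeff_natAdd]
    exact Finset.prod_ne_zero_iff.2 fun b _ => h.ne_zero 0 b
  have n0 : inversionCoeff x 0 ≠ 0 := by
    intro h'
    rw [h', zero_mul, zero_add] at hex
    exact mul_ne_zero n4 (mul_ne_zero n2 n3) hex
  exact ⟨n0, n4, eq_neg_of_add_eq_zero_left hex⟩

/-- The frame coefficient is a sum of four terms, in which cancellation is possible, so its
valuation is not read off from the definition. The exchange identity expresses it through the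
monomial coefficient at 4 and minors of known valuation. The two-rowed minors of `x` that occur
belong to the complementary quadruples `{0, 3, 6, 7}` and `{4, 1, 2, 5}`, so they cancel by
self-duality. The three-rowed minor contributes `cubicNu`. -/
lemma IsInversion.nu_inversionCoeff_zero {x y : Fin 8 → Fin 4 → L} (h : IsInversion x y)
    (hx : IsRegular x) : nu ν (inversionCoeff x 0) =
      cubicNu ν x - (nu ν (x 4 0) + nu ν (x 5 0) + nu ν (x 6 0) + nu ν (x 7 0)) := by
  obtain ⟨-, n1, n2, -, n3⟩ := h.plucker_ne_zero hx
  obtain ⟨-, h1, h2⟩ := h.plucker_two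
  obtain ⟨-, h3⟩ := h.plucker_three
  obtain ⟨-, -, h4, -⟩ := h.right.plucker_values
  obtain ⟨n0, n4, hex⟩ := h.inversionCoeff_zero_ne_zero hx
  have h0 := h.coord_ne_zero
  have e4 : inversionCoeff x 4 = x 4 0 * x 4 1 * (x 4 2 * x 4 3) := by
    refine (inversionCoeff_natAdd x 0).trans ?_
    rw [Fin.prod_univ_four]
    change x 4 0 * x 4 1 * x 4 2 * x 4 3 = _
    ring
  have n5 : plucker y 0 1 2 5 ≠ 0 := by
    rw [h4, (h.coord_inv 3).2.1]; exact inv_ne_zero (h0 3).2.1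
  have v1 := congrArg (nu ν) hex
  rw [nu_neg, nu_mul n0 (mul_ne_zero n5 n1), nu_mul n5 n1, nu_mul n4 (mul_ne_zero n2 n3),
    nu_mul n2 n3, e4, nu_mul_four (h0 0).1 (h0 1).1 (h0 2).1 (h0 3).1, h4, (h.coord_inv 3).2.1,
    nu_inv (h0 3).2.1] at v1
  have v2 := congrArg (nu ν) h1
  rw [nu_neg, nu_mul n1 (mul_ne_zero (mul_ne_zero (h0 1).2.2.1 (h0 2).2.2.2)
    (mul_ne_zero (h0 2).2.2.1 (h0 1).2.2.2)),
    nu_mul_four (h0 1).2.2.1 (h0 2).2.2.2 (h0 2).2.2.1 (h0 1).2.2.2] at v2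
  have v3 := congrArg (nu ν) h2
  rw [nu_neg, nu_mul n2 (mul_ne_zero (mul_ne_zero (h0 0).1 (h0 3).2.1)
    (mul_ne_zero (h0 3).1 (h0 0).2.1)),
    nu_mul_four (h0 0).1 (h0 3).2.1 (h0 3).1 (h0 0).2.1] at v3
  have v4 := congrArg (nu ν) h3
  obtain ⟨n9, v9⟩ := nu_mul_nine (ν := ν) (h0 0).1 (h0 1).1 (h0 2).1 (h0 0).2.2.1 (h0 1).2.2.1
    (h0 2).2.2.1 (h0 0).2.2.2 (h0 1).2.2.2 (h0 2).2.2.2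
  rw [nu_mul n3 n9, v9] at v4
  have v6 := v4.trans (hx.nu_conicForm (ν := ν) ![3, 0, 1, 2, 4, 6, 7, 5] (by decide))
  have v5 : nu ν (plucker x 0 3 6 7) = nu ν (plucker x 4 1 2 5) := by
    rw [plucker_eq_minor, plucker_eq_minor]
    exact nu_eq_of_sq (hx.selfDual.minor_sq_compl (by decide) (by decide) (by decide))
  linarith

/-- For the other frame labels the case of label 0 is transported by exchanging 0 and `a`, both as
labels and as coordinates. -/
lemma IsInversion.inversionCoeff_ne_zero {x y : Fin 8 → Fin 4 → L} (h : IsInversion x y)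
    (hx : IsRegular x) (i : Fin 8) : inversionCoeff x i ≠ 0 := by
  induction i using Fin.addCases (m := 4) (n := 4) with
  | left a =>
    have := ((h.blockMap (Equiv.swap 0 a) 1).inversionCoeff_zero_ne_zero
      (hx.blockMap (Equiv.swap 0 a) 1)).1
    rw [inversionCoeff_blockMap] at this
    have e := blockPerm_castAdd (Equiv.swap 0 a) 1 0
    rw [Equiv.swap_apply_left] at e
    rw [← e]
    exact this
  | right j =>
    rw [inversionCoeff_natAdd]
    exact Finset.prod_ne_zero_iff.2 fun b _ => h.ne_zero j b

lemma IsInversion.nu_inversionCoeff_natAdd {x y : Fin 8 → Fin 4 → L} (h : IsInversion x y)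
    (j : Fin 4) : nu ν (inversionCoeff x (Fin.natAdd 4 j)) = ∑ b, nu ν (x (Fin.natAdd 4 j) b) := by
  rw [inversionCoeff_natAdd, nu_prod _ (h.ne_zero j)]

lemma IsRegular.cubicNu_blockMap {x : Fin 8 → Fin 4 → L} (hx : IsRegular x)
    (α β : Equiv.Perm (Fin 4)) : cubicNu ν (CayleyOctad.blockMap α β x) = cubicNu ν x := by
  rw [cubicNu, cubicForm_blockMap, hx.nu_cubicForm]

lemma IsInversion.nu_inversionCoeff_castAdd {x y : Fin 8 → Fin 4 → L} (h : IsInversion x y)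
    (hx : IsRegular x) (a : Fin 4) : nu ν (inversionCoeff x (Fin.castAdd 4 a)) =
      cubicNu ν x - ∑ j : Fin 4, nu ν (x (Fin.natAdd 4 j) a) := by
  have := (h.blockMap (Equiv.swap 0 a) 1).nu_inversionCoeff_zero (ν := ν)
      (hx.blockMap (Equiv.swap 0 a) 1)
  rw [inversionCoeff_blockMap, hx.cubicNu_blockMap] at this
  have e := blockPerm_castAdd (Equiv.swap 0 a) 1 0
  rw [Equiv.swap_apply_left] at e
  rw [← e, Fin.sum_univ_four]
  refine this.trans ?_
  have e2 : ∀ j : Fin 4, CayleyOctad.blockMap (Equiv.swap 0 a) 1 x (Fin.natAdd 4 j) 0 =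
      x (Fin.natAdd 4 j) a := by
    intro j
    rw [CayleyOctad.blockMap, blockPerm_natAdd, Equiv.swap_apply_left]
    rfl
  rw [← e2, ← e2, ← e2, ← e2]
  rfl

end CremonaFormulas

/-! ### Quadruples classified by their position relative to the frame. -/

/-- The labels `0, …, 3`. -/
def frameSet : Finset (Fin 8) := {0, 1, 2, 3}

/-- The quadruple in which the label `a` of the frame is replaced by the `j`-th other label. -/
def exch (a j : Fin 4) : Finset (Fin 8) :=
  insert (Fin.natAdd 4 j) (frameSet.erase (Fin.castAdd 4 a))

/-- The quadruple in which two labels of the frame are replaced by two other labels. -/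
def exchTwo (a b i j : Fin 4) : Finset (Fin 8) :=
  insert (Fin.natAdd 4 i) (insert (Fin.natAdd 4 j)
    ((frameSet.erase (Fin.castAdd 4 a)).erase (Fin.castAdd 4 b)))

lemma exch_card : ∀ a j, (exch a j).card = 4 := by decide

lemma exchTwo_card : ∀ a b i j : Fin 4, a ≠ b → i ≠ j → (exchTwo a b i j).card = 4 := by
  decide +kernel

/-- The count is `70 = 1 + 1 + 16 + 16 + 36`. The 36 quadruples with two frame labels form a class
closed under complementation. -/
lemma quadruple_cases : ∀ S : Finset (Fin 8), S.card = 4 → S = frameSet ∨ S = frameSetᶜ ∨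
    (∃ a j, S = exch a j ∨ S = (exch a j)ᶜ) ∨
    ∃ a b i j, a ≠ b ∧ i ≠ j ∧ S = exchTwo a b i j := by
  decide +kernel

lemma exists_perm_two : ∀ a b : Fin 4, a ≠ b → ∃ α : Equiv.Perm (Fin 4), α 0 = a ∧ α 1 = b := by
  decide

/-! ### The linear equations between the valuations of a self-dual tuple and of its Cremona image.
-/

section CremonaEquations
variable {L : Type*} [Field L] {ν : AddValuation L (WithTop ℚ)}

/-- A coordinate is, up to sign, the minor in which one frame vector is replaced by the given point.
-/
lemma StandardFrame.exists_minor_exch {x : Fin 8 → Fin 4 → L} (h : StandardFrame x)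
    (a j : Fin 4) : ∃ f : Fin 4 → Fin 8, Function.Injective f ∧ Finset.univ.image f = exch a j ∧
      minor x f ^ 2 = x (Fin.natAdd 4 j) a ^ 2 := by
  obtain ⟨h0, h1, h2, h3⟩ := h
  fin_cases a
  · refine ⟨![1, 2, 3, Fin.natAdd 4 j], ?_, ?_, ?_⟩
    · revert j; decide
    · revert j; decide
    · rw [← plucker_eq_minor, plucker, h1, h2, h3, det_four]; simp
  · refine ⟨![0, 2, 3, Fin.natAdd 4 j], ?_, ?_, ?_⟩
    · revert j; decide
    · revert j; decide
    · rw [← plucker_eq_minor, plucker, h0, h2, h3, det_four]; simp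
  · refine ⟨![0, 1, 3, Fin.natAdd 4 j], ?_, ?_, ?_⟩
    · revert j; decide
    · revert j; decide
    · rw [← plucker_eq_minor, plucker, h0, h1, h3, det_four]; simp
  · refine ⟨![0, 1, 2, Fin.natAdd 4 j], ?_, ?_, ?_⟩
    · revert j; decide
    · revert j; decide
    · rw [← plucker_eq_minor, plucker, h0, h1, h2, det_four]; simp

lemma StandardFrame.nu_coord {x : Fin 8 → Fin 4 → L} (h : StandardFrame x) (a j : Fin 4) :
    nu ν (x (Fin.natAdd 4 j) a) = minorNu ν x (exch a j) := by
  obtain ⟨f, hf, h1, h2⟩ := h.exists_minor_exch a j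
  rw [← h1, minorNu_image x hf]
  exact (nu_eq_of_sq h2).symm

lemma StandardFrame.minorNu_frameSet {x : Fin 8 → Fin 4 → L} (h : StandardFrame x) :
    minorNu ν x frameSet = 0 := by
  rw [frameSet, minorNu_plucker x (by decide), h.plucker_values.1, nu_one]

lemma minor_smul (s : Fin 8 → L) (y : Fin 8 → Fin 4 → L) (f : Fin 4 → Fin 8) :
    minor (fun i => s i • y i) f = (∏ a, s (f a)) * minor y f := by
  have := minor_smul_mulVec (1 : Matrix (Fin 4) (Fin 4) L) s y f
  simpa using this

lemma minorNu_smul {s : Fin 8 → L} (hs : ∀ i, s i ≠ 0) {y : Fin 8 → Fin 4 → L}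
    {f : Fin 4 → Fin 8} (hf : Function.Injective f) (h : minor y f ≠ 0) :
    minorNu ν (fun i => s i • y i) (Finset.univ.image f) =
      minorNu ν y (Finset.univ.image f) + ∑ i ∈ Finset.univ.image f, nu ν (s i) := by
  rw [minorNu_image _ hf, minorNu_image _ hf, minor_smul,
    nu_mul (Finset.prod_ne_zero_iff.2 fun a _ => hs _) h, nu_prod _ fun a => hs (f a),
    Finset.sum_image fun a _ b _ h => hf h, add_comm]

lemma minor_ne_zero_of_image_eq {x : Fin 8 → Fin 4 → L} {f g : Fin 4 → Fin 8}
    (hf : Function.Injective f) (hg : Function.Injective g)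
    (h : Finset.univ.image f = Finset.univ.image g) (hx : minor x g ≠ 0) : minor x f ≠ 0 := by
  have h' : Set.range f = Set.range g := by
    have := congrArg (fun S : Finset (Fin 8) => (S : Set (Fin 8))) h
    simpa using this
  intro h0
  have := minor_sq_congr x hf hg h'
  rw [h0] at this
  exact pow_ne_zero 2 hx (this.symm.trans (by simp))

lemma SelfDual.minor_ne_zero_of_image_compl {x : Fin 8 → Fin 4 → L} (hd : SelfDual x)
    {f g : Fin 4 → Fin 8} (hf : Function.Injective f) (hg : Function.Injective g)
    (h : Finset.univ.image f = (Finset.univ.image g)ᶜ) (hx : minor x g ≠ 0) :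
    minor x f ≠ 0 := by
  intro h0
  have := hd.minor_sq_compl hf hg fun a b hab => by
    have h1 : f a ∈ (Finset.univ.image g)ᶜ := h ▸ Finset.mem_image_of_mem f (Finset.mem_univ a)
    exact Finset.mem_compl.1 h1 (hab ▸ Finset.mem_image_of_mem g (Finset.mem_univ b))
  rw [h0] at this
  exact pow_ne_zero 2 hx (this.symm.trans (by simp))

lemma image_blockPerm_exchTwo {α β : Equiv.Perm (Fin 4)} :
    Finset.univ.image (blockPerm α β ∘ ![2, 3, 4, 5]) = exchTwo (α 0) (α 1) (β 0) (β 1) := by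
  revert α β; decide +kernel

/-- The labels `2, 3, 4, 5` are the model case. A permutation of the frame and one of its complement
carry it to any two removed and two added labels. -/
lemma IsInversion.exists_minor_exchTwo {x y : Fin 8 → Fin 4 → L} (h : IsInversion x y)
    (hx : IsRegular x) {a b i j : Fin 4} (hab : a ≠ b) (hij : i ≠ j) :
    ∃ f : Fin 4 → Fin 8, Function.Injective f ∧ Finset.univ.image f = exchTwo a b i j ∧
      minor y f ≠ 0 ∧ nu ν (minor y f) = minorNu ν x (exchTwo a b i j) -
        (nu ν (x (Fin.natAdd 4 i) a) + nu ν (x (Fin.natAdd 4 i) b) +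
          nu ν (x (Fin.natAdd 4 j) a) + nu ν (x (Fin.natAdd 4 j) b)) := by
  obtain ⟨α, rfl, rfl⟩ := exists_perm_two a b hab
  obtain ⟨β, rfl, rfl⟩ := exists_perm_two i j hij
  have h' := h.blockMap α β
  have hx' := hx.blockMap α β
  have hinj : Function.Injective (blockPerm α β ∘ ![2, 3, 4, 5]) :=
    (blockPerm α β).injective.comp (by decide)
  have h1 := h'.plucker_two.1
  have h2 := (h'.plucker_ne_zero hx').1
  rw [plucker_eq_minor] at h2
  have h3 := minor_blockMap_sq α β y ![2, 3, 4, 5]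
  have h4 := minor_blockMap_sq α β x ![2, 3, 4, 5]
  have h0 := h'.coord_ne_zero
  refine ⟨_, hinj, image_blockPerm_exchTwo, ?_, ?_⟩
  · intro h5
    rw [h5] at h3
    exact pow_ne_zero 2 h2 (h3.trans (by simp))
  · rw [← nu_eq_of_sq h3, ← image_blockPerm_exchTwo, minorNu_image _ hinj, ← nu_eq_of_sq h4]
    have v := congrArg (nu ν) h1
    rw [nu_neg, plucker_eq_minor, plucker_eq_minor,
      nu_mul h2 (mul_ne_zero (mul_ne_zero (h0 0).1 (h0 1).2.1)
        (mul_ne_zero (h0 1).1 (h0 0).2.1)),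
      nu_mul_four (h0 0).1 (h0 1).2.1 (h0 1).1 (h0 0).2.1] at v
    have e : ∀ k c : Fin 4, CayleyOctad.blockMap α β x (Fin.natAdd 4 k) c =
        x (Fin.natAdd 4 (β k)) (α c) := by
      intro k c
      rw [CayleyOctad.blockMap, blockPerm_natAdd]
    rw [← e, ← e, ← e, ← e]
    change _ = _ - (nu ν (CayleyOctad.blockMap α β x 4 0) + nu ν (CayleyOctad.blockMap α β x 4 1) +
      nu ν (CayleyOctad.blockMap α β x 5 0) + nu ν (CayleyOctad.blockMap α β x 5 1))
    linarith

lemma CremonaLift.scale_ne_zero {x y : Fin 8 → Fin 4 → L} {s : Fin 8 → L}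
    (h : CremonaLift x y s) (i : Fin 8) : s i ≠ 0 := by
  intro h0
  have := h.sq i
  rw [h0] at this
  exact h.inversion.inversionCoeff_ne_zero h.regular i (this.symm.trans (by simp))

lemma CremonaLift.nu_scale {x y : Fin 8 → Fin 4 → L} {s : Fin 8 → L}
    (h : CremonaLift x y s) (i : Fin 8) : 2 * nu ν (s i) = nu ν (inversionCoeff x i) := by
  rw [← h.sq, nu_pow (h.scale_ne_zero i)]
  norm_num

lemma CremonaLift.nu_scale_natAdd {x y : Fin 8 → Fin 4 → L} {s : Fin 8 → L}
    (h : CremonaLift x y s) (j : Fin 4) :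
    2 * nu ν (s (Fin.natAdd 4 j)) = ∑ a, minorNu ν x (exch a j) := by
  rw [h.nu_scale, h.inversion.nu_inversionCoeff_natAdd]
  exact Finset.sum_congr rfl fun a _ => h.inversion.left.nu_coord a j

lemma CremonaLift.nu_scale_castAdd {x y : Fin 8 → Fin 4 → L} {s : Fin 8 → L}
    (h : CremonaLift x y s) (a : Fin 4) :
    2 * nu ν (s (Fin.castAdd 4 a)) = cubicNu ν x - ∑ j, minorNu ν x (exch a j) := by
  rw [h.nu_scale, h.inversion.nu_inversionCoeff_castAdd h.regular]
  congr 1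
  exact Finset.sum_congr rfl fun j _ => h.inversion.left.nu_coord a j

/-- In the frame, the minors at `frameSet`, `exch` and `exchTwo` are 1, inverted coordinates and
two-rowed minors up to sign. Self-duality supplies the complements. -/
lemma CremonaLift.generalPosition (ν : AddValuation L (WithTop ℚ)) {x y : Fin 8 → Fin 4 → L}
    {s : Fin 8 → L} (h : CremonaLift x y s) : GeneralPosition fun i => s i • y i := by
  have hscale : ∀ g : Fin 4 → Fin 8, minor y g ≠ 0 → minor (fun i => s i • y i) g ≠ 0 := by
    intro g hg
    rw [minor_smul]
    exact mul_ne_zero (Finset.prod_ne_zero_iff.2 fun a _ => h.scale_ne_zero _) hg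
  have hF : minor (fun i => s i • y i) ![0, 1, 2, 3] ≠ 0 := hscale _ (by
    rw [← plucker_eq_minor, h.inversion.right.plucker_values.1]; exact one_ne_zero)
  have hE : ∀ a j, ∃ g : Fin 4 → Fin 8, Function.Injective g ∧ Finset.univ.image g = exch a j ∧
      minor (fun i => s i • y i) g ≠ 0 := by
    intro a j
    obtain ⟨g, hg, h1, h2⟩ := h.inversion.right.exists_minor_exch a j
    refine ⟨g, hg, h1, hscale g fun h0 => ?_⟩
    rw [h0] at h2
    exact pow_ne_zero 2 (h.inversion.symm.ne_zero j a) (h2.symm.trans (by simp))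
  intro f hf
  have hc : (Finset.univ.image f).card = 4 := by rw [Finset.card_image_of_injective _ hf]; rfl
  rcases quadruple_cases _ hc with h1 | h1 | ⟨a, j, h1 | h1⟩ | ⟨a, b, i, j, hab, hij, h1⟩
  · exact minor_ne_zero_of_image_eq hf (by decide) (h1.trans (by decide)) hF
  · exact h.selfDual.minor_ne_zero_of_image_compl hf (by decide) (h1.trans (by decide)) hF
  · obtain ⟨g, hg, h2, h3⟩ := hE a j
    exact minor_ne_zero_of_image_eq hf hg (h1.trans h2.symm) h3
  · obtain ⟨g, hg, h2, h3⟩ := hE a j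
    exact h.selfDual.minor_ne_zero_of_image_compl hf hg (h1.trans (by rw [h2])) h3
  · obtain ⟨g, hg, h2, h3, -⟩ := h.inversion.exists_minor_exchTwo (ν := ν) h.regular hab hij
    exact minor_ne_zero_of_image_eq hf hg (h1.trans h2.symm) (hscale g h3)

/-- Inversion is symmetric, so the formula for three-rowed minors applies with source and image
exchanged. It gives the conic condition of `y` as the minor of `x` at `{0, 4, 5, 6}` times a
monomial. Self-duality of `x` replaces this quadruple by its complement `exch 0 3`. -/
lemma IsInversion.cubicForm_one {x y : Fin 8 → Fin 4 → L} (h : IsInversion x y)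
    (hx : IsRegular x) : cubicForm y 1 ≠ 0 ∧ nu ν (cubicForm y 1) =
      minorNu ν x (exch 0 3) - ∑ a : Fin 3, ∑ j : Fin 3, minorNu ν x (exch a.succ j.castSucc) := by
  have h0 := h.symm.coord_ne_zero
  have h1 := h.symm.plucker_three.1
  have h2 : plucker x 0 4 5 6 ≠ 0 := by rw [plucker_eq_minor]; exact hx.general _ (by decide)
  obtain ⟨n9, v9⟩ := nu_mul_nine (ν := ν) (h0 1).1 (h0 2).1 (h0 3).1 (h0 1).2.1 (h0 2).2.1
    (h0 3).2.1 (h0 1).2.2.1 (h0 2).2.2.1 (h0 3).2.2.1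
  have h3 : nu ν (plucker x 0 4 5 6) = minorNu ν x (exch 0 3) := by
    rw [← minorNu_plucker x (by decide), ← hx.selfDual.minorNu_compl (exch_card 0 3)]
    congr 1
  have hy : ∀ j a : Fin 4, nu ν (y (Fin.natAdd 4 j) a) = -minorNu ν x (exch a j) := by
    intro j a
    rw [h.inv, nu_inv (h.ne_zero j a), h.left.nu_coord]
  change conicForm y 0 1 2 3 4 5 6 ≠ 0 ∧ nu ν (conicForm y 0 1 2 3 4 5 6) = _
  rw [← h1]
  refine ⟨mul_ne_zero h2 n9, ?_⟩
  rw [nu_mul h2 n9, v9, h3]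
  have e4 : ∀ a, nu ν (y 4 a) = -minorNu ν x (exch a 0) := hy 0
  have e5 : ∀ a, nu ν (y 5 a) = -minorNu ν x (exch a 1) := hy 1
  have e6 : ∀ a, nu ν (y 6 a) = -minorNu ν x (exch a 2) := hy 2
  simp only [e4, e5, e6, Fin.sum_univ_three]
  simp only [Fin.isValue, Fin.reduceSucc, Fin.reduceCastSucc]
  ring

lemma cubicForm_smul_one (s : Fin 8 → L) (y : Fin 8 → Fin 4 → L) :
    cubicForm (fun i => s i • y i) 1 = cubicFactor 1 s 1 * cubicForm y 1 := by
  have := cubicForm_smul_mulVec (1 : Matrix (Fin 4) (Fin 4) L) s y 1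
  simpa using this

lemma CremonaLift.isRegular (ν : AddValuation L (WithTop ℚ)) {x y : Fin 8 → Fin 4 → L}
    {s : Fin 8 → L} (h : CremonaLift x y s) : IsRegular fun i => s i • y i := by
  refine IsRegular.of_cubic h.selfDual (h.generalPosition ν) (π := 1) ?_
  rw [cubicForm_smul_one]
  exact mul_ne_zero (cubicFactor_ne_zero one_ne_zero h.scale_ne_zero 1)
    (h.inversion.cubicForm_one (ν := ν) h.regular).1

/-- The effect of the Cremona transformation based at the points `0, …, 3` on the valuations of the
minors of self-dual tuples. -/
structure CremonaEquations (w : Finset (Fin 8) → ℚ) (k : ℚ) (w' : Finset (Fin 8) → ℚ) (k' : ℚ) :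
    Prop where
  one : ∀ a j, 2 * w' (exch a j) + 2 * w (exch a j) + k + 2 * w frameSet =
    2 * w' frameSet + ∑ j', w (exch a j') + ∑ a', w (exch a' j)
  two : ∀ a b i j, a ≠ b → i ≠ j → 2 * w' (exchTwo a b i j) + 2 * k + 2 * w frameSet +
      2 * (w (exch a i) + w (exch b i) + w (exch a j) + w (exch b j)) =
    2 * w' frameSet + ∑ l, w (exch a l) + ∑ l, w (exch b l) + ∑ c, w (exch c i) +
      ∑ c, w (exch c j) + 2 * w (exchTwo a b i j)
  cubic : k' + 3 * k + 4 * w frameSet = ∑ a, ∑ j, w (exch a j) + 4 * w' frameSet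

lemma sum_frameSet (f : Fin 8 → ℚ) : ∑ i ∈ frameSet, f i = ∑ a : Fin 4, f (Fin.castAdd 4 a) := by
  rw [show frameSet = Finset.univ.image (Fin.castAdd 4 : Fin 4 → Fin 8) by decide,
    Finset.sum_image fun a _ b _ h => Fin.castAdd_injective 4 4 h]

lemma sum_exch (f : Fin 8 → ℚ) (a j : Fin 4) : ∑ i ∈ exch a j, f i =
    ∑ c : Fin 4, f (Fin.castAdd 4 c) - f (Fin.castAdd 4 a) + f (Fin.natAdd 4 j) := by
  rw [exch, Finset.sum_insert (by revert a j; decide), ← sum_frameSet,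
    ← Finset.sum_erase_add frameSet f (a := Fin.castAdd 4 a) (by revert a; decide)]
  ring

lemma sum_exchTwo (f : Fin 8 → ℚ) {a b i j : Fin 4} (hab : a ≠ b) (hij : i ≠ j) :
    ∑ l ∈ exchTwo a b i j, f l = ∑ c : Fin 4, f (Fin.castAdd 4 c) - f (Fin.castAdd 4 a) -
      f (Fin.castAdd 4 b) + f (Fin.natAdd 4 i) + f (Fin.natAdd 4 j) := by
  rw [exchTwo, Finset.sum_insert (by revert a b i j; decide +kernel),
    Finset.sum_insert (by clear hij; revert a b j; decide +kernel), ← sum_frameSet,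
    ← Finset.sum_erase_add frameSet f (a := Fin.castAdd 4 a) (by clear hab; revert a; decide),
    ← Finset.sum_erase_add (frameSet.erase _) f (a := Fin.castAdd 4 b)
      (by clear hij; revert a b; decide)]
  ring

lemma CremonaLift.equations {x y : Fin 8 → Fin 4 → L} {s : Fin 8 → L}
    (h : CremonaLift x y s) : CremonaEquations (minorNu ν x) (cubicNu ν x)
      (minorNu ν fun i => s i • y i) (cubicNu ν fun i => s i • y i) := by
  have hs := h.scale_ne_zero
  -- In the standard frame the terms `w frameSet` of the equations vanish. They are present to make
  -- the equations independent of the frame.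
  have h0 : minorNu ν x frameSet = 0 := h.inversion.left.minorNu_frameSet
  have hF : minorNu ν (fun i => s i • y i) frameSet = ∑ a : Fin 4, nu ν (s (Fin.castAdd 4 a)) := by
    have h1 : frameSet = Finset.univ.image ![0, 1, 2, 3] := by decide
    have h2 : minor y ![0, 1, 2, 3] ≠ 0 := by
      rw [← plucker_eq_minor, h.inversion.right.plucker_values.1]; exact one_ne_zero
    have h3 := minorNu_smul (ν := ν) hs (by decide) h2
    rw [← h1, h.inversion.right.minorNu_frameSet, sum_frameSet, zero_add] at h3
    exact h3
  have hc := h.nu_scale_castAdd (ν := ν)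
  have hn := h.nu_scale_natAdd (ν := ν)
  -- Relative to the frame minor, a minor of the rescaled image gains the valuation of the scale of
  -- each added label and loses that of each removed label. The scales are square roots, so the
  -- equations are doubled.
  refine ⟨fun a j => ?_, fun a b i j hab hij => ?_, ?_⟩
  · obtain ⟨f, hf, h1, h2⟩ := h.inversion.right.exists_minor_exch a j
    have h3 : minor y f ≠ 0 := fun h0 => by
      rw [h0] at h2
      exact pow_ne_zero 2 (h.inversion.symm.ne_zero j a) (h2.symm.trans (by simp))
    have h4 := minorNu_smul (ν := ν) hs hf h3
    rw [h1, ← h.inversion.right.nu_coord, h.inversion.inv, nu_inv (h.inversion.ne_zero j a),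
      h.inversion.left.nu_coord, sum_exch] at h4
    rw [h4, hF, h0]
    linear_combination hn j - hc a
  · obtain ⟨f, hf, h1, h2, h3⟩ := h.inversion.exists_minor_exchTwo (ν := ν) h.regular hab hij
    have h4 := minorNu_smul (ν := ν) hs hf h2
    rw [minorNu_image y hf, h1, h3, sum_exchTwo _ hab hij] at h4
    simp only [h.inversion.left.nu_coord] at h4
    rw [h4, hF, h0]
    linear_combination hn i + hn j - hc a - hc b
  · obtain ⟨h1, h2⟩ := h.inversion.cubicForm_one (ν := ν) h.regular
    rw [cubicNu, cubicForm_smul_one, nu_mul (cubicFactor_ne_zero one_ne_zero hs 1) h1, h2,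
      nu_cubicFactor one_ne_zero hs, hF, h0, nu_one]
    have c0 : 2 * nu ν (s 0) = _ := hc 0
    have c1 : 2 * nu ν (s 1) = _ := hc 1
    have c2 : 2 * nu ν (s 2) = _ := hc 2
    have c3 : 2 * nu ν (s 3) = _ := hc 3
    have n0 : 2 * nu ν (s 4) = _ := hn 0
    have n1 : 2 * nu ν (s 5) = _ := hn 1
    have n2 : 2 * nu ν (s 6) = _ := hn 2
    simp only [Equiv.Perm.one_apply, Fin.sum_univ_four, Fin.sum_univ_three] at *
    simp only [Fin.isValue, Fin.reduceSucc, Fin.reduceCastSucc, Fin.reduceCastAdd] at *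
    change _ = _ + 4 * (nu ν (s 0) + nu ν (s 1) + nu ν (s 2) + nu ν (s 3))
    linarith

end CremonaEquations

/-! ### Octads: regular lifts, projective equivalence and normalisation. -/

section OctadLevel
variable {L : Type*} [Field L]

lemma PGLEquiv.symm {O O' : Octad L} (h : PGLEquiv O O') : PGLEquiv O' O := by
  obtain ⟨M, hM⟩ := h
  exact ⟨M⁻¹, fun i => by rw [hM, inv_smul_smul]⟩

lemma PGLEquiv.trans {O O' O'' : Octad L} (h : PGLEquiv O O') (h' : PGLEquiv O' O'') :
    PGLEquiv O O'' := by
  obtain ⟨M, hM⟩ := h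
  obtain ⟨N, hN⟩ := h'
  exact ⟨N * M, fun i => by rw [hN, hM, mul_smul]⟩

lemma IsNetBase.smul {x : Fin 8 → Fin 4 → L} (h : IsNetBase x) {c : Fin 8 → L}
    (hc : ∀ i, c i ≠ 0) : IsNetBase fun i => c i • x i :=
  h.projEquiv ⟨1, c, by simp, hc, fun _ => by simp⟩

lemma IsNetBase.mulVec {x : Fin 8 → Fin 4 → L} (h : IsNetBase x) {M : Matrix (Fin 4) (Fin 4) L}
    (hM : M.det ≠ 0) : IsNetBase fun i => M.mulVec (x i) :=
  h.projEquiv ⟨M, fun _ => 1, hM, fun _ => one_ne_zero, fun _ => (one_smul _ _).symm⟩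

/-- Lifts of projectively equivalent octads correspond under an invertible matrix. -/
lemma PGLEquiv.exists_lift {x : Fin 8 → Fin 4 → L} {O O' : Octad L} (h : PGLEquiv O O')
    (hx : IsLift x O) : ∃ M : Matrix (Fin 4) (Fin 4) L, M.det ≠ 0 ∧
      IsLift (fun i => M.mulVec (x i)) O' := by
  obtain ⟨y, hy⟩ := exists_isLift O'
  obtain ⟨M, c, hM, hc, hxy⟩ := h.projEquiv hx hy
  refine ⟨M, hM, ?_⟩
  have := hy.smul fun i => inv_ne_zero (hc i)
  convert this using 2 with i
  rw [hxy, smul_smul, inv_mul_cancel₀ (hc i), one_smul]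

lemma isLift_mk {x : Fin 8 → Fin 4 → L} (hx : ∀ i, x i ≠ 0) :
    IsLift x fun i => Projectivization.mk L (x i) (hx i) := fun i => ⟨hx i, rfl⟩

/-- A Cayley octad in general position whose points lie on no twisted cubic has a regular lift. -/
lemma IsCayleyOctad.exists_isRegular [IsAlgClosed L] {O : Octad L} (hO : IsCayleyOctad O)
    {x : Fin 8 → Fin 4 → L} (hx : IsLift x O) (hg : GeneralPosition x)
    {π : Equiv.Perm (Fin 8)} (hc : cubicForm x π ≠ 0) :
    ∃ c : Fin 8 → L, (∀ i, c i ≠ 0) ∧ IsRegular fun i => c i • x i := by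
  obtain ⟨-, Q, hQ, hQx⟩ := (isCayleyOctad_iff hx).1 hO
  obtain ⟨lam, h0, hlam⟩ := exists_squareRelation hQ fun k i =>
    (hQx _ (hx.ne_zero i)).2 ⟨i, 1, (one_smul _ _).symm⟩ k
  obtain ⟨c, hcl, hsd⟩ := hlam.exists_selfDual
  have hc0 : ∀ i, c i ≠ 0 := fun i h => hlam.ne_zero hg h0 i (by rw [← hcl, h]; simp)
  refine ⟨c, hc0, IsRegular.of_cubic hsd ?_ (π := π) ?_⟩
  · simpa using hg.smul_mulVec (M := 1) (by simp) hc0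
  · have := cubicForm_smul_mulVec 1 c x π
    simp only [Matrix.one_mulVec] at this
    rw [this]
    exact mul_ne_zero (cubicFactor_ne_zero (by simp) hc0 π) hc

lemma IsRegular.isCayleyOctad {x : Fin 8 → Fin 4 → L} (h : IsRegular x) (hn : IsNetBase x)
    {O : Octad L} (hx : IsLift x O) : IsCayleyOctad O :=
  (isCayleyOctad_iff hx).2 ⟨h.general.injective hx, hn⟩

lemma det_diagonal_ne_zero {d : Fin 4 → L} (hd : ∀ a, d a ≠ 0) : (Matrix.diagonal d).det ≠ 0 := by
  rw [Matrix.det_diagonal]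
  exact Finset.prod_ne_zero_iff.2 fun a _ => hd a

/-- An octad with a frame and a further point off the coordinate planes can be normalised. -/
lemma exists_normalised {V : Fin 8 → Fin 4 → L} {O : Octad L} (hV : IsLift V O)
    (π : Equiv.Perm (Fin 8)) (hf : StandardFrame (V ∘ π)) (h4 : ∀ a, V (π 4) a ≠ 0) :
    ∃ O', PGLEquiv O O' ∧ IsNormalised O' := by
  have hd : ∀ a, (V (π 4) a)⁻¹ ≠ 0 := fun a => inv_ne_zero (h4 a)
  obtain ⟨O', hO', hlift⟩ := exists_pglEquiv hV (det_diagonal_ne_zero hd)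
  -- The diagonal matrix that sends the fifth point to `(1, 1, 1, 1)` also scales the frame vectors.
  -- The factors `c` restore these to unit vectors and leave the other labels alone.
  let c : Fin 8 → L := fun i => if h : (π.symm i : ℕ) < 4 then V (π 4) ⟨π.symm i, h⟩ else 1
  have hc : ∀ i, c i ≠ 0 := by
    intro i
    by_cases h : (π.symm i : ℕ) < 4
    · simp only [c, dif_pos h]; exact h4 _
    · simp only [c, dif_neg h]; exact one_ne_zero
  refine ⟨O', hO', (Fin.castLEEmb (by norm_num : 5 ≤ 8)).trans π.toEmbedding, _,
    hlift.smul hc, fun k => ?_, ?_⟩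
  · have e1 : ((Fin.castLEEmb (by norm_num : 5 ≤ 8)).trans π.toEmbedding) k.castSucc =
        π (Fin.castAdd 4 k) := rfl
    have e2 : V (π (Fin.castAdd 4 k)) = Pi.single k 1 := hf.apply_single k
    have e3 : c (π (Fin.castAdd 4 k)) = V (π 4) k := by
      have : ((π.symm (π (Fin.castAdd 4 k)) : Fin 8) : ℕ) = k := by
        rw [Equiv.symm_apply_apply]; rfl
      simp only [c]
      rw [dif_pos (by rw [this]; exact k.2)]
      congr 1
      ext
      exact this
    rw [e1, e2, e3]
    ext a
    rw [Pi.smul_apply, Matrix.mulVec_diagonal, smul_eq_mul]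
    by_cases h : a = k
    · subst h; simp [h4]
    · simp [h]
  · have e1 : ((Fin.castLEEmb (by norm_num : 5 ≤ 8)).trans π.toEmbedding) (Fin.last 4) = π 4 := rfl
    have e3 : c (π 4) = 1 := by
      simp only [c]
      rw [dif_neg]
      rw [Equiv.symm_apply_apply]
      decide
    rw [e1, e3]
    ext a
    rw [Pi.smul_apply, Matrix.mulVec_diagonal, smul_eq_mul, inv_mul_cancel₀ (h4 a), mul_one]

/-- A general octad can be moved to the standard frame. -/
lemma GeneralPosition.exists_frame {x : Fin 8 → Fin 4 → L} (hg : GeneralPosition x)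
    (π : Equiv.Perm (Fin 8)) : ∃ M : Matrix (Fin 4) (Fin 4) L, M.det ≠ 0 ∧
      StandardFrame ((fun i => M.mulVec (x i)) ∘ π) ∧
      ∀ j a : Fin 4, M.mulVec (x (π (Fin.natAdd 4 j))) a ≠ 0 := by
  have h0 : plucker (x ∘ π) 0 1 2 3 ≠ 0 := by
    rw [plucker_eq_minor]; exact hg.comp π _ (by decide)
  obtain ⟨M, hM, hf⟩ := exists_standardFrame (x ∘ π) h0
  have hM0 := left_ne_zero_of_mul_eq_one hM
  refine ⟨M, hM0, hf, fun j a h => ?_⟩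
  obtain ⟨f, hf1, -, hf2⟩ := hf.exists_minor_exch a j
  have hg' : GeneralPosition fun i => M.mulVec ((x ∘ π) i) := by
    simpa using (hg.comp π).smul_mulVec hM0 (c := fun _ => 1) fun _ => one_ne_zero
  rw [show M.mulVec ((x ∘ π) (Fin.natAdd 4 j)) a = 0 from h] at hf2
  exact pow_ne_zero 2 (hg' f hf1) (hf2.trans (by simp))

lemma GeneralPosition.exists_pglEquiv_normalised {x : Fin 8 → Fin 4 → L}
    (hg : GeneralPosition x) {O : Octad L} (hx : IsLift x O) :
    ∃ O', PGLEquiv O O' ∧ IsNormalised O' := by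
  obtain ⟨M, hM, hf, hn⟩ := hg.exists_frame 1
  obtain ⟨O₁, hO₁, hl⟩ := exists_pglEquiv hx hM
  obtain ⟨O', h1, h2⟩ := exists_normalised hl 1 hf (hn 0)
  exact ⟨O', hO₁.trans h1, h2⟩

/-- The embedding of the first four labels, followed by a permutation. -/
def frameEmb (π : Equiv.Perm (Fin 8)) : Fin 4 ↪ Fin 8 :=
  (Fin.castAddEmb 4 : Fin 4 ↪ Fin (4 + 4)).trans π.toEmbedding

lemma map_frameEmb (π : Equiv.Perm (Fin 8)) :
    Finset.univ.map (frameEmb π) = frameSet.image π := by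
  rw [frameEmb, ← Finset.map_map, Finset.map_eq_image]
  congr 1

lemma notMem_range_frameEmb {π : Equiv.Perm (Fin 8)} {i : Fin 8} :
    i ∉ Set.range (frameEmb π) ↔ ∃ j : Fin 4, π (Fin.natAdd 4 j) = i := by
  constructor
  · intro h
    obtain ⟨k, rfl⟩ := π.surjective i
    induction k using Fin.addCases (m := 4) (n := 4) with
    | left a => exact absurd ⟨a, rfl⟩ h
    | right j => exact ⟨j, rfl⟩
  · rintro ⟨j, rfl⟩ ⟨a, ha⟩
    have h1 : Fin.castAdd 4 a = Fin.natAdd 4 j := π.injective ha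
    have h2 := congrArg Fin.val h1
    simp at h2
    omega

/-- Two injective tuples of labels differ by a permutation. -/
lemma exists_perm_apply_eq {n : ℕ} (e s : Fin n ↪ Fin 8) :
    ∃ π : Equiv.Perm (Fin 8), ∀ a, π (e a) = s a := by
  let f : {x // x ∈ Set.range e} ≃ {x // x ∈ Set.range s} :=
    (Equiv.ofInjective e e.injective).symm.trans (Equiv.ofInjective s s.injective)
  refine ⟨Equiv.extendSubtype f, fun a => ?_⟩
  refine (Equiv.extendSubtype_apply_of_mem f (e a) ⟨a, rfl⟩).trans ?_
  have h : (⟨e a, a, rfl⟩ : {x // x ∈ Set.range e}) = Equiv.ofInjective e e.injective a := rfl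
  rw [h]
  simp only [f, Equiv.trans_apply, Equiv.symm_apply_apply]
  rfl

lemma exists_frameEmb (s : Fin 4 ↪ Fin 8) : ∃ π : Equiv.Perm (Fin 8), frameEmb π = s := by
  obtain ⟨π, h⟩ := exists_perm_apply_eq (Fin.castAddEmb 4 : Fin 4 ↪ Fin (4 + 4)) s
  exact ⟨π, DFunLike.ext _ _ h⟩

end OctadLevel

/-! ### Cremona images of octads. -/

section CremonaOctads
variable {L : Type*} [Field L]

/-- A linear change of coordinates adds the valuation of its determinant to every minor and four
times as much to the conic condition. The equations are homogeneous enough to be insensitive to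
this, on either side separately. -/
lemma CremonaEquations.shift {w w₁ w' w₁' : Finset (Fin 8) → ℚ} {k k₁ k' k₁' c c' : ℚ}
    (h : CremonaEquations w k w' k') (hw : ∀ T, T.card = 4 → w₁ T = w T + c) (hk : k₁ = k + 4 * c)
    (hw' : ∀ T, T.card = 4 → w₁' T = w' T + c') (hk' : k₁' = k' + 4 * c') :
    CremonaEquations w₁ k₁ w₁' k₁' := by
  have hF : frameSet.card = 4 := by decide
  refine ⟨fun a j => ?_, fun a b i j hab hij => ?_, ?_⟩
  · have := h.one a j
    simp only [hw _ (exch_card _ _), hw' _ (exch_card _ _), hw _ hF, hw' _ hF, hk, Fin.sum_univ_four]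
      at this ⊢
    linarith
  · have := h.two a b i j hab hij
    simp only [hw _ (exch_card _ _), hw _ hF, hw' _ hF, hk, Fin.sum_univ_four,
      hw _ (exchTwo_card a b i j hab hij), hw' _ (exchTwo_card a b i j hab hij)] at this ⊢
    linarith
  · have := h.cubic
    simp only [hw _ (exch_card _ _), hw _ hF, hw' _ hF, hk, hk', Fin.sum_univ_four] at this ⊢
    linarith

/-- The lift `x` is prescribed, since rescaling its vectors separately would destroy self-duality.
Its discrepancy with the lift provided by the definition is absorbed into two diagonal matrices,
which act on all vectors at once, and into the choice of `V`, whose scaling is free. -/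
lemma IsStandardCremona.exists_isInversion {O₁ O₂ : Octad L} {π : Equiv.Perm (Fin 8)}
    (h : IsStandardCremona (frameEmb π) O₁ O₂) {x : Fin 8 → Fin 4 → L} (hx : IsLift x O₁) :
    ∃ (M N : Matrix (Fin 4) (Fin 4) L) (V : Fin 8 → Fin 4 → L), M.det ≠ 0 ∧ N.det ≠ 0 ∧
      IsInversion ((fun i => M.mulVec (x i)) ∘ π) ((fun i => N.mulVec (V i)) ∘ π) ∧ IsLift V O₂ := by
  obtain ⟨x', y, hx', hy, hs, hinv⟩ := h
  obtain ⟨c, hc, hcx⟩ := hx.exists_smul hx'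
  have hd : ∀ a, c (frameEmb π a) ≠ 0 := fun a => hc _
  have hd' : ∀ a, (c (frameEmb π a))⁻¹ ≠ 0 := fun a => inv_ne_zero (hc _)
  refine ⟨Matrix.diagonal fun a => c (frameEmb π a), Matrix.diagonal fun a => (c (frameEmb π a))⁻¹,
    fun i => c i • y i, det_diagonal_ne_zero hd, det_diagonal_ne_zero hd', ?_, hy.smul hc⟩
  have key : ∀ i a, c i * x i a = x' i a := fun i a => by rw [hcx]; rfl
  have hs' : ∀ a, π (Fin.castAdd 4 a) = frameEmb π a := fun _ => rfl
  refine ⟨standardFrame_iff.2 fun a => ?_, standardFrame_iff.2 fun a => ?_, fun j a => ?_,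
    fun j a => ?_⟩
  · ext b
    simp only [Function.comp_apply, Matrix.mulVec_diagonal, hs']
    have := key (frameEmb π a) b
    rw [(hs a).1] at this
    by_cases hab : b = a
    · subst hab; rw [this]
    · rw [Pi.single_eq_of_ne hab] at this ⊢
      rw [(mul_eq_zero.1 this).resolve_left (hc _), mul_zero]
  · ext b
    simp only [Function.comp_apply, Matrix.mulVec_diagonal, hs', Pi.smul_apply, smul_eq_mul, (hs a).2]
    by_cases hab : b = a
    · subst hab; simp [hc]
    · simp [hab]
  · have hi := hinv _ (notMem_range_frameEmb.2 ⟨j, rfl⟩) a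
    simp only [Function.comp_apply, Matrix.mulVec_diagonal]
    rw [← key] at hi
    exact mul_ne_zero (hc _) (right_ne_zero_of_mul hi.1)
  · have hi := hinv _ (notMem_range_frameEmb.2 ⟨j, rfl⟩) a
    simp only [Function.comp_apply, Matrix.mulVec_diagonal, Pi.smul_apply, smul_eq_mul]
    rw [hi.2, ← key, mul_inv, mul_inv, mul_inv_cancel_left₀ (hc _)]

/-- A regular octad has a regular Cremona image, whose valuations are given by the Cremona
equations. -/
lemma CremonaRel.exists_isRegular [IsAlgClosed L] (ν : AddValuation L (WithTop ℚ))
    {S : Finset (Fin 8)} {O O' : Octad L} (h : CremonaRel S O O') {x : Fin 8 → Fin 4 → L}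
    (hx : IsLift x O) (hr : IsRegular x) (hn : IsNetBase x) :
    ∃ (π : Equiv.Perm (Fin 8)) (z : Fin 8 → Fin 4 → L), frameSet.image π = S ∧ IsLift z O' ∧
      IsRegular z ∧ IsNetBase z ∧
      CremonaEquations (fun T => minorNu ν x (T.image π)) (cubicNu ν x)
        (fun T => minorNu ν z (T.image π)) (cubicNu ν z) := by
  obtain ⟨s, hs, O₁, O₂, h₁, hC, h₂⟩ := h
  obtain ⟨π, rfl⟩ := exists_frameEmb s
  obtain ⟨P, hP, hlP⟩ := h₁.exists_lift hx
  obtain ⟨M, N, V, hM, hN, hinv, hV⟩ := hC.exists_isInversion hlP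
  have hU := (hr.mulVec hP).mulVec hM
  have hUn := (hn.mulVec hP).mulVec hM
  have hcard : ∀ T : Finset (Fin 8), T.card = 4 → (T.image π).card = 4 := fun T hT => by
    rw [Finset.card_image_of_injective _ π.injective, hT]
  have hw : ∀ T : Finset (Fin 8), T.card = 4 → minorNu ν x (T.image π) =
      minorNu ν (fun i => M.mulVec (P.mulVec (x i))) (T.image π) +
        -(nu ν P.det + nu ν M.det) := fun T hT => by
    rw [(hr.mulVec hP).minorNu_mulVec hM (hcard T hT), hr.minorNu_mulVec hP (hcard T hT)]
    ring
  have hk : cubicNu ν x = cubicNu ν (fun i => M.mulVec (P.mulVec (x i))) +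
      4 * -(nu ν P.det + nu ν M.det) := by
    rw [(hr.mulVec hP).cubicNu_mulVec hM, hr.cubicNu_mulVec hP]
    ring
  generalize (fun i => M.mulVec (P.mulVec (x i))) = U at *
  have hUπ := hU.comp π
  have hVn := hinv.isNetBase (hUn.comp π) hUπ.cubic
  have : ∀ i, ∃ t : L, t ^ 2 = inversionCoeff (U ∘ π) i :=
    fun i => IsAlgClosed.exists_pow_nat_eq _ two_pos
  choose t ht using this
  have hl : CremonaLift _ _ t := ⟨hinv, hUπ, ht⟩
  have ht0 : ∀ i, t i ≠ 0 := hl.scale_ne_zero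
  obtain ⟨O₃, h₃, hl₃⟩ := exists_pglEquiv hV hN
  generalize (fun i => N.mulVec (V i)) = W at *
  have hreg := hl.isRegular ν
  have heq := hl.equations (ν := ν)
  have hl₃' := hl₃.smul fun i => ht0 (π.symm i)
  have hz : (fun i => t i • (W ∘ π) i) = (fun i => t (π.symm i) • W i) ∘ π := by
    funext i; simp
  rw [hz] at hreg heq
  have hzn : IsNetBase fun i => t (π.symm i) • W i := by
    have := (hVn.smul ht0).comp π.symm
    convert this using 1
    funext i; simp
  generalize (fun i => t (π.symm i) • W i) = z at *
  obtain ⟨R, hR, hlR⟩ := (h₃.symm.trans h₂).exists_lift hl₃'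
  have hzr : IsRegular z := by
    have := hreg.comp π.symm
    rwa [Function.comp_assoc, Equiv.self_comp_symm, Function.comp_id] at this
  refine ⟨π, _, (map_frameEmb π).symm.trans hs, hlR, hzr.mulVec hR, hzn.mulVec hR, ?_⟩
  -- The equations hold between the tuples in their frames. Undoing `P` and `M` on the source and
  -- applying `R` to the image only shifts the valuations.
  refine heq.shift (c := -(nu ν P.det + nu ν M.det)) (fun T hT => ?_) ?_ (c' := nu ν R.det) (fun T hT => ?_) ?_
  · exact (hw T hT).trans (by rw [minorNu_comp U π hT])
  · exact hk.trans (by rw [hU.cubicNu_comp])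
  · rw [hzr.minorNu_mulVec hR (hcard T hT), minorNu_comp z π hT]
  · rw [hzr.cubicNu_mulVec hR, hzr.cubicNu_comp]

lemma GeneralPosition.exists_cremonaRel_normalised {x : Fin 8 → Fin 4 → L}
    (hg : GeneralPosition x) {O : Octad L} (hx : IsLift x O) {S : Finset (Fin 8)}
    (hS : S.card = 4) : ∃ O', CremonaRel S O O' ∧ IsNormalised O' := by
  obtain ⟨π, hπ⟩ := exists_frameEmb (S.orderEmbOfFin hS).toEmbedding
  obtain ⟨M, hM, hf, hn⟩ := hg.exists_frame π
  obtain ⟨O₁, hO₁, hl⟩ := exists_pglEquiv hx hM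
  -- The inverted tuple itself is taken as the image, the frame vectors being kept.
  let V : Fin 8 → Fin 4 → L := fun i => if h : (π.symm i : ℕ) < 4 then Pi.single ⟨π.symm i, h⟩ 1
    else fun a => (M.mulVec (x i) a)⁻¹
  have hV1 : ∀ k : Fin 4, V (π (Fin.castAdd 4 k)) = Pi.single k 1 := fun k => by
    have : ((π.symm (π (Fin.castAdd 4 k)) : Fin 8) : ℕ) = k := by
      rw [Equiv.symm_apply_apply]; rfl
    simp only [V]
    rw [dif_pos (by rw [this]; exact k.2)]
    congr 1
    ext
    exact this
  have hV2 : ∀ j : Fin 4, V (π (Fin.natAdd 4 j)) =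
      fun a => (M.mulVec (x (π (Fin.natAdd 4 j))) a)⁻¹ := fun j => by
    have : ((π.symm (π (Fin.natAdd 4 j)) : Fin 8) : ℕ) = 4 + j := by
      rw [Equiv.symm_apply_apply]; rfl
    simp only [V]
    rw [dif_neg (by rw [this]; omega)]
  have hV0 : ∀ i, V i ≠ 0 := by
    intro i
    obtain ⟨i, rfl⟩ := π.surjective i
    induction i using Fin.addCases (m := 4) (n := 4) with
    | left a =>
      intro h
      have := congrFun ((hV1 a).symm.trans h) a
      simp at this
    | right j =>
      intro h
      exact inv_ne_zero (hn j 0) (congrFun ((hV2 j).symm.trans h) 0)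
  have hVf : StandardFrame (V ∘ π) := standardFrame_iff.2 hV1
  have h4 : ∀ a, V (π 4) a ≠ 0 := fun a => by
    rw [show V (π 4) = _ from hV2 0]; exact inv_ne_zero (hn 0 a)
  obtain ⟨O', h1, h2⟩ := exists_normalised (isLift_mk hV0) π hVf h4
  refine ⟨O', ⟨frameEmb π, ?_, O₁, _, hO₁, ⟨_, V, hl, isLift_mk hV0, fun k => ⟨?_, hV1 k⟩, ?_⟩, h1⟩, h2⟩
  · rw [hπ]
    ext i
    rw [Finset.mem_map, ← Finset.mem_coe (s := S), ← Finset.range_orderEmbOfFin S hS]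
    exact ⟨fun ⟨a, _, h⟩ => ⟨a, h⟩, fun ⟨a, h⟩ => ⟨a, Finset.mem_univ _, h⟩⟩
  · exact hf.apply_single k
  · intro i hi a
    obtain ⟨j, rfl⟩ := notMem_range_frameEmb.1 hi
    exact ⟨hn j a, congrFun (hV2 j) a⟩

end CremonaOctads

/-! ### Sets of labels as binary numbers, relabellings as octal codes. -/

section Masks

/-- The number whose binary digits are the indicator function of a set of labels. -/
def mask (S : Finset (Fin 8)) : ℕ := ∑ i ∈ S, 2 ^ (i : ℕ)

/-- A binary digit. -/
def bit (n i : ℕ) : ℕ := n / 2 ^ i % 2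

/-- The sum of eight values. -/
def sumEight (f : ℕ → ℕ) : ℕ := f 0 + f 1 + f 2 + f 3 + f 4 + f 5 + f 6 + f 7

/-- The number of nonzero binary digits of a number below `256`. -/
def bitCount (n : ℕ) : ℕ := sumEight (bit n)

/-- The `i`-th octal digit. -/
def digit (c i : ℕ) : ℕ := c / 8 ^ i % 8

/-- The effect on masks of the map of labels with the given octal digits. -/
def permMask (c n : ℕ) : ℕ := sumEight fun i => bit n i * 2 ^ digit c i

lemma sumEight_eq (f : ℕ → ℕ) : sumEight f = ∑ i : Fin 8, f i := by
  rw [Fin.sum_univ_eight]; rfl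

lemma bit_mask : ∀ (S : Finset (Fin 8)) (i : Fin 8), bit (mask S) i = if i ∈ S then 1 else 0 := by
  decide +kernel

lemma mask_lt : ∀ S : Finset (Fin 8), mask S < 256 := by decide +kernel

lemma mask_surjective {n : ℕ} (hn : n < 256) : ∃ S, mask S = n := by
  have : ∀ n < 256, ∃ S, mask S = n := by decide +kernel
  exact this n hn

lemma sumEight_mask (S : Finset (Fin 8)) (f : ℕ → ℕ) :
    (sumEight fun i => bit (mask S) i * f i) = ∑ i ∈ S, f i := by
  rw [sumEight_eq]
  simp only [bit_mask, ite_mul, one_mul, zero_mul, Finset.sum_ite_mem, Finset.univ_inter]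

lemma sumEight_mask_compl (S : Finset (Fin 8)) (f : ℕ → ℕ) :
    (sumEight fun i => (1 - bit (mask S) i) * f i) = ∑ i ∈ Sᶜ, f i := by
  rw [sumEight_eq, ← Finset.sum_filter_add_sum_filter_not Finset.univ (· ∈ S)]
  rw [Finset.sum_eq_zero, zero_add]
  · refine Finset.sum_congr (by ext; simp) fun i hi => ?_
    rw [Finset.mem_compl] at hi
    rw [bit_mask, if_neg hi, Nat.sub_zero, one_mul]
  · intro i hi
    rw [bit_mask, if_pos (Finset.mem_filter.1 hi).2, Nat.sub_self, zero_mul]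

lemma bitCount_mask (S : Finset (Fin 8)) : bitCount (mask S) = S.card := by
  have := sumEight_mask S fun _ => 1
  simp only [mul_one, Finset.sum_const, smul_eq_mul] at this
  exact this

lemma mask_insert_erase {S : Finset (Fin 8)} {a j : Fin 8} (ha : a ∈ S) (hj : j ∉ S) :
    mask (insert j (S.erase a)) = mask S - 2 ^ (a : ℕ) + 2 ^ (j : ℕ) := by
  have h1 : mask (insert j (S.erase a)) = 2 ^ (j : ℕ) + mask (S.erase a) :=
    Finset.sum_insert fun h => hj (Finset.mem_of_mem_erase h)
  have h2 : mask (S.erase a) + 2 ^ (a : ℕ) = mask S := Finset.sum_erase_add _ _ ha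
  omega

lemma mask_compl (S : Finset (Fin 8)) : mask Sᶜ = 255 - mask S := by
  have h1 : mask S + mask Sᶜ = ∑ i, 2 ^ (i : Fin 8).val := Finset.sum_add_sum_compl _ _
  rw [Fin.sum_univ_eight] at h1
  have : 2 ^ (0 : Fin 8).val + 2 ^ (1 : Fin 8).val + 2 ^ (2 : Fin 8).val + 2 ^ (3 : Fin 8).val +
    2 ^ (4 : Fin 8).val + 2 ^ (5 : Fin 8).val + 2 ^ (6 : Fin 8).val + 2 ^ (7 : Fin 8).val = 255 := rfl
  omega

lemma testBit_mask (S : Finset (Fin 8)) (i : ℕ) :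
    (mask S).testBit i = decide (∃ h : i < 8, ⟨i, h⟩ ∈ S) := by
  by_cases hi : i < 8
  · have : ∀ (S : Finset (Fin 8)) (i : Fin 8), (mask S).testBit i = decide (i ∈ S) := by
      decide +kernel
    rw [this S ⟨i, hi⟩]
    simp [hi]
  · rw [Nat.testBit_lt_two_pow ((mask_lt S).trans_le
      (Nat.pow_le_pow_right two_pos (not_lt.1 hi) : 2 ^ 8 ≤ 2 ^ i))]
    simp [hi]

lemma mask_symmDiff (S T : Finset (Fin 8)) : mask (symmDiff S T) = mask S ^^^ mask T := by
  refine Nat.eq_of_testBit_eq fun i => ?_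
  rw [Nat.testBit_xor, testBit_mask, testBit_mask, testBit_mask]
  by_cases hi : i < 8
  · by_cases h1 : (⟨i, hi⟩ : Fin 8) ∈ S <;> by_cases h2 : (⟨i, hi⟩ : Fin 8) ∈ T <;>
      simp [hi, h1, h2, Finset.mem_symmDiff]
  · simp [hi]

/-- The number of common binary digits. -/
def meet (m n : ℕ) : ℕ := sumEight fun i => bit m i * bit n i

lemma meet_mask (S T : Finset (Fin 8)) : meet (mask S) (mask T) = (S ∩ T).card := by
  rw [meet, sumEight_mask]
  simp only [bit_mask, Finset.sum_boole, Finset.filter_mem_eq_inter, Nat.cast_id]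

/-- The permutation of the labels with octal digits `c`. -/
def IsCode (c : ℕ) (r : Equiv.Perm (Fin 8)) : Prop := ∀ i : Fin 8, (r i : ℕ) = digit c i

lemma IsCode.mask_image {c : ℕ} {r : Equiv.Perm (Fin 8)} (h : IsCode c r) (S : Finset (Fin 8)) :
    mask (S.image r) = permMask c (mask S) := by
  rw [permMask, sumEight_mask, mask, Finset.sum_image fun _ _ _ _ h => r.injective h]
  exact Finset.sum_congr rfl fun i _ => by rw [h]

/-- The first eight octal digits are distinct. -/
def validCode (c : ℕ) : Bool :=
  (List.range 8).all fun i => (List.range i).all fun j => digit c i != digit c j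

lemma exists_isCode {c : ℕ} (h : validCode c = true) : ∃ r, IsCode c r := by
  simp only [validCode, List.all_eq_true, List.mem_range, bne_iff_ne] at h
  let f : Fin 8 → Fin 8 := fun i => ⟨digit c i, Nat.mod_lt _ (by norm_num)⟩
  have hf : Function.Injective f := by
    intro i j hij
    have hd : digit c i = digit c j := congrArg Fin.val hij
    rcases lt_trichotomy (i : ℕ) j with hl | hl | hl
    · exact absurd hd.symm (h j j.2 i hl)
    · exact Fin.ext hl
    · exact absurd hd (h i i.2 j hl)
  exact ⟨Equiv.ofBijective f (Finite.injective_iff_bijective.1 hf), fun i => rfl⟩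

end Masks

/-! ### The nine shapes, their weights and the tables for the finite verification. -/

section Shapes

/-- The shape of a block: block types share a shape when they share a picture. -/
inductive Shape : Type
  | alpha1 | alpha2 | chi1 | chi2 | phi1 | phi2 | phi3 | tcu | line

/-- The shape of a block. -/
def BlockType.shape : BlockType → Shape
  | .alpha1a | .alpha1b => .alpha1
  | .alpha2a | .alpha2b => .alpha2
  | .chi1a | .chi1b | .chi1c => .chi1
  | .chi2a | .chi2b | .chi2c => .chi2
  | .phi1a | .phi1b => .phi1
  | .phi2a | .phi2b | .phi2c => .phi2
  | .phi3a | .phi3b => .phi3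
  | .tcu => .tcu
  | .line => .line

namespace Shape

/-- The class of the blocks of a given shape. -/
def blockClass : Shape → BlockClass
  | .alpha1 | .alpha2 => .alpha
  | .chi1 | .chi2 => .chi
  | .phi1 | .phi2 | .phi3 => .phi
  | .tcu | .line => .hyperelliptic

/-- The twisted cubic index of the blocks of a given shape. -/
def cubicIndex : Shape → ℕ
  | .tcu => 1
  | _ => 0

/-- The shapes in a fixed order. -/
def ofIndex : ℕ → Shape
  | 0 => .alpha1
  | 1 => .alpha2
  | 2 => .chi1
  | 3 => .chi2
  | 4 => .phi1
  | 5 => .phi2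
  | 6 => .phi3
  | 7 => .tcu
  | _ => .line

/-- The eight elements of the span of three masks. -/
def spanList (a b c : ℕ) : List ℕ :=
  [0, a, b, a ^^^ b, c, a ^^^ c, b ^^^ c, a ^^^ b ^^^ c]

/-- The picture of a shape, as a list of lists of masks. -/
def picture : Shape → List (List ℕ)
  | .alpha1 => [spanList 3 0 0]
  | .alpha2 => [spanList 15 0 0]
  | .chi1 => [spanList 3 29 0]
  | .chi2 => [spanList 3 5 0]
  | .phi1 => [spanList 3 12 53, spanList 48 192 83]
  | .phi2 => [spanList 3 6 24, spanList 96 160 24]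
  | .phi3 => [spanList 3 5 9, spanList 48 80 144]
  | .tcu => [(List.range 256).filter fun n => n == 0 || bitCount n == 2]
  | .line => [(List.range 256).filter fun n =>
      n == 0 || meet n 15 == meet n 240 + 2 || meet n 240 == meet n 15 + 2]

/-- The valuations of the minors of a self-dual octad with a single block of the given shape, up to
scaling, as hexadecimal digits indexed by masks. -/
def weightTable : Shape → ℕ
  | .alpha1 => 0x1000000010001000000000001000100000001000000001000000000010001000000010000000010000001000000001000000010001000000000000001000100000001000000001000000100000000100000001000100000000001000000001000000010001000000000001000100000001000000000000000
  | .alpha2 => 0x2000000000000000000000000000000000000000000000000000000000000000000000000000000000000000000000000000000000000000000000000000000000000000000000000000000000000000000000000000000000000000000000000000000000000000000000000000000002000000000000000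
  | .chi1 => 0x1000000010001022000000001000100000001000000001000000000010001000000010000000010000001000000001000000010001000000000000001000100000001000000001000000100000000100000001000100000000001000000001000000010001000000002201000100000001000000000000000
  | .chi2 => 0x2000000020000000000000002000000000000000000000000000000020000000000000000000000000000000000000000000000002000000000000002000000000000000000000000000000000000000000000000200000000000000000000000000000002000000000000000200000002000000000000000
  | .phi1 => 0x2000000010001011000000001000101100002022002202000000000010001011000020000000020000002000000002000011010001000000000000001000101100002000000002000000200000000200001101000100000000002022002202000011010001000000001101000100000002000000000000000
  | .phi2 => 0x2000000020002022000000002000000000000000000000000000000020000000000000000000000000000000000000000000000002000000000000002000000000000000000000000000000000000000000000000200000000000000000000000000000002000000002202000200000002000000000000000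
  | .phi3 => 0x4000000010001011000000001000101100000000000000000000000010001011000000000000000000000000000000000011010001000000000000001000101100000000000000000000000000000000001101000100000000000000000000000011010001000000001101000100000004000000000000000
  | .tcu => 0x0
  | .line => 0x2000000010001011000000001000101100000000000000000000000010001011000000000000000000000000000000000011010001000000000000001000101100000000000000000000000000000000001101000100000000000000000000000011010001000000001101000100000002000000000000000

/-- Valuation of the conic condition, on the same scale. -/
def cubicWeight : Shape → ℕ
  | .alpha2 => 0
  | .alpha1 | .chi1 | .chi2 | .phi2 | .tcu | .line => 2
  | .phi1 | .phi3 => 4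

/-- A configuration for which the twisted cubic index is attained. -/
def cubicWitness : Shape → ℕ
  | .alpha1 => 0o76543210
  | .alpha2 => 0o76543210
  | .chi1 => 0o76543210
  | .chi2 => 0o76543210
  | .phi1 => 0o76543210
  | .phi2 => 0o76543210
  | .phi3 => 0o76543210
  | .tcu => 0o76543210
  | .line => 0o76543210

/-- Cremona images: the last two hexadecimal digits of an entry are the mask of a quadruple, the next
one the index of the resulting shape, and the remaining octal digits a relabelling. -/
def cremonaTable : Shape → List ℕ
  | .alpha1 =>
    [0xfac68800f, 0xfac688017, 0xfac688027, 0xfac688047, 0xfac68801b, 0xfac68802b, 0xfac68804b,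
    0xfac688033, 0xfac688053, 0xfac688063, 0x68fd6011d, 0x6b9d6012d, 0x7d1d6014d, 0x6be360135,
    0x7d6360155, 0x7f2360165, 0x6bea60139, 0x7d6a60159, 0x7f2a60169, 0x7f5460171, 0xfab46011e,
    0xf9d46012e, 0xef546014e, 0xf9aa60136, 0xef2a60156, 0xed6a60166, 0xf9a36013a, 0xef236015a,
    0xed636016a, 0xed1d60172, 0xfac68803c, 0xfac68805c, 0xfac68806c, 0xfac688074, 0xfac688078]
  | .alpha2 =>
    [0xfac68810f, 0xfa911a017, 0xf8d11a027, 0xe7511a047, 0xfa981a01b, 0xf8d81a02b, 0xe7581a04b,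
    0xfac688133, 0xfac688153, 0xfac688163, 0xfa98c201d, 0xf8d8c202d, 0xe758c204d, 0xfac688135,
    0xfac688155, 0xfac688165, 0xfac688139, 0xfac688159, 0xfac688169, 0x3f58d0071, 0xfa98d001e,
    0xf8d8d002e, 0xe758d004e, 0xfac688136, 0xfac688156, 0xfac688166, 0xfac68813a, 0xfac68815a,
    0xfac68816a, 0x3f58c2072, 0xfac68813c, 0xfac68815c, 0xfac68816c, 0x3f581a074, 0x3f511a078]
  | .chi1 =>
    [0xfaa8c830f, 0xfac4c8317, 0xfac688227, 0xfac688247, 0xfac68831b, 0xfac68822b, 0xfac68824b,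
    0xfac688233, 0xfac688253, 0x5f58c8363, 0xfac68821d, 0x8c8faa22d, 0x858faa24d, 0x8cf1aa235,
    0x85f1aa255, 0x3f462a265, 0x8cfc2a239, 0x85fc2a259, 0x3f40ea269, 0x3f08ea271, 0xfac68821e,
    0xf888ea22e, 0xe708ea24e, 0xf8c0ea236, 0xe740ea256, 0x31fc2a266, 0xf8c62a23a, 0xe7462a25a,
    0x31f1aa26a, 0x318faa272, 0xf958c833c, 0xeb58c835c, 0xfac68826c, 0xfac688274, 0xfac688278]
  | .chi2 =>
    [0xfac68830f, 0xfac688317, 0xfac688327, 0xfac688347, 0xfac68821b, 0xfa568822b, 0xf3568824b,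
    0xfa3a88233, 0xf33a88253, 0xf1ea88263, 0xfac65021d, 0xfa565022d, 0xf3565024d, 0xfa3a50235,
    0xf33a50255, 0xf1ea50265, 0x8fea42239, 0x9dea42259, 0x9f3a42269, 0x9f5642271, 0xfac64221e,
    0xfa564222e, 0xf3564224e, 0xfa3a42236, 0xf33a42256, 0xf1ea42266, 0x8fea5023a, 0x9dea5025a,
    0x9f3a5026a, 0x9f5650272, 0x8fea8823c, 0x9dea8825c, 0x9f3a8826c, 0x9f5688274, 0xfac688378]
  | .phi1 =>
    [0xfac68840f, 0xf94748517, 0xfa2748527, 0x53e748547, 0xf94ac851b, 0xfa2ac852b, 0x53eac854b,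
    0xfac688633, 0xfac688453, 0xfac688463, 0x47cd5851d, 0x467d5852d, 0xf11d5854d, 0xfac688435,
    0xbf42d0455, 0xf742d0465, 0xfac688439, 0xbf4650459, 0xf74650469, 0x9d1d43571, 0x47cd4351e,
    0x467d4352e, 0xf11d4354e, 0xfac688436, 0xbf4650456, 0xf74650466, 0xfac68843a, 0xbf42d045a,
    0xf742d046a, 0x9d1d58572, 0xfac68863c, 0xfac68845c, 0xfac68846c, 0x8beac8574, 0x8be748578]
  | .phi2 =>
    [0xfab88860f, 0xfac688617, 0xfac688527, 0xfac688547, 0xfac68851b, 0xf9ab0842b, 0xef2b0844b,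
    0xf9d508433, 0xef5508453, 0x5f4748563, 0xfac68851d, 0xf9aa6042d, 0xef2a6044d, 0xf9d460435,
    0xef5460455, 0x5f4668565, 0x47c7a8539, 0x5cc7a8559, 0xed1d60469, 0xed6360471, 0xfac68851e,
    0x6be36042e, 0x7d636044e, 0x6b9d60436, 0x7d1d60456, 0xe8c7a8566, 0xf9466853a, 0xeb466855a,
    0x7f546046a, 0x7f2a60472, 0xf9474853c, 0xeb474855c, 0x7f550846c, 0x7f2b08474, 0xfac688578]
  | .phi3 =>
    [0xfac68860f, 0xfac688517, 0xfa5688527, 0xf35688547, 0xfac4c851b, 0xfa54c852b, 0xf354c854b,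
    0xfac688433, 0xf74688453, 0xbf4688463, 0xfac45851d, 0xfa545852d, 0xf3545854d, 0xfac650435,
    0xf74650455, 0xbf4650465, 0xfac2d0439, 0xf742d0459, 0xbf42d0469, 0x9f5443571, 0xfac44351e,
    0xfa544352e, 0xf3544354e, 0xfac2d0436, 0xf742d0456, 0xbf42d0466, 0xfac65043a, 0xf7465045a,
    0xbf465046a, 0x9f5458572, 0xfac68843c, 0xf7468845c, 0xbf468846c, 0x9f54c8574, 0x9f5688578]
  | .tcu =>
    [0xfac68880f, 0xfab888817, 0xf9d888827, 0xef5888847, 0xfab50881b, 0xf9d50882b, 0xef550884b,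
    0xf9ab08833, 0xef2b08853, 0xed6b08863, 0xfab46081d, 0xf9d46082d, 0xef546084d, 0xf9aa60835,
    0xef2a60855, 0xed6a60865, 0xf9a360839, 0xef2360859, 0xed6360869, 0xed1d60871, 0x68fd6081e,
    0x6b9d6082e, 0x7d1d6084e, 0x6be360836, 0x7d6360856, 0x7f2360866, 0x6bea6083a, 0x7d6a6085a,
    0x7f2a6086a, 0x7f5460872, 0x6beb0883c, 0x7d6b0885c, 0x7f2b0886c, 0x7f5508874, 0x7f5888878]
  | .line =>
    [0xfac68870f, 0xfac688817, 0xfac688827, 0xfac688847, 0xfac68881b, 0xfac68882b, 0xfac68884b,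
    0x6beb08833, 0x7d6b08853, 0x7f2b08863, 0xfac68881d, 0xfac68882d, 0xfac68884d, 0x6bea60835,
    0x7d6a60855, 0x7f2a60865, 0x6be360839, 0x7d6360859, 0x7f2360869, 0xfac688871, 0xfac68881e,
    0xfac68882e, 0xfac68884e, 0xf9a360836, 0xef2360856, 0xed6360866, 0xf9aa6083a, 0xef2a6085a,
    0xed6a6086a, 0xfac688872, 0xf9ab0883c, 0xef2b0885c, 0xed6b0886c, 0xfac688874, 0xfac688878]

/-- Blocks and relabellings whose valuations vanish on given frames. -/
def frameTable : Shape → List (BlockType × ℕ)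
  | .alpha1 => [(.alpha1a, 0o76543210), (.alpha1b, 0o76543210)]
  | .alpha2 => [(.alpha2a, 0o76543210), (.alpha2b, 0o76543210), (.alpha2b, 0o32107654)]
  | .chi1 => [(.chi1b, 0o76543210), (.chi1a, 0o76543210), (.chi1c, 0o76543210), (.chi1c, 0o43276510)]
  | .chi2 => [(.chi2c, 0o76543210), (.chi2b, 0o76543210), (.chi2a, 0o76543210)]
  | .phi1 => [(.phi1a, 0o76543210), (.phi1a, 0o76541032), (.phi1a, 0o32107654), (.phi1a, 0o10327654), (.phi1b, 0o76543210), (.phi1b, 0o32107654)]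
  | .phi2 => [(.phi2a, 0o76543210), (.phi2c, 0o76543210), (.phi2c, 0o21043765), (.phi2b, 0o76543210), (.phi2b, 0o21043765)]
  | .phi3 => [(.phi3a, 0o76543210), (.phi3a, 0o32107654), (.phi3b, 0o76543210), (.phi3b, 0o32107654)]
  | .tcu => [(.tcu, 0o76543210)]
  | .line => [(.line, 0o76543210), (.line, 0o32107654)]

/-- An entry of the weight table. -/
def weight (t : Shape) (n : ℕ) : ℕ := weightTable t / 16 ^ n % 16

end Shape

/-- The valuation of the minor with a given mask, for each block. -/
def blockValue : BlockType → ℕ → ℕ := fun b n =>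
  let pt := fun T => meet n T - 1
  let ln := fun T => meet n T - 2
  let pln := fun T => meet n T - 3
  match b with
  | .alpha1a => pt 3
  | .alpha1b => pln 252
  | .alpha2a => pln 15 + pln 240
  | .alpha2b => pln 15 + pt 15
  | .chi1a => max (ln 28 + ln 224) (pln 252)
  | .chi1b => max (pt 3) (pln 31 + pln 227)
  | .chi1c => max (ln 31 + ln 28) (pt 28)
  | .chi2a => ln 248 + pln 248
  | .chi2b => ln 7 + pt 7
  | .chi2c => ln 7 + pln 248
  | .phi1a => ln 51 + ln 195 + pln 15 + pln 240
  | .phi1b => max (pt 3 + pt 12) (pln 63 + pln 207)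
  | .phi2a => max (ln 7 + ln 224) (pln 31 + pln 248)
  | .phi2b => pt 24 + ln 15 + ln 23
  | .phi2c => ln 15 + ln 23 + pln 231
  | .phi3a => ln 15 + pln 15 + pln 240
  | .phi3b => pt 15 + ln 15 + pln 15
  | .tcu => 0
  | .line => ln 15

/-- The rescaling of the points that relates a block to its shape, shifted by `4`. -/
def blockOffset : BlockType → ℕ
  | .alpha1a => 0x33333377
  | .alpha1b => 0x55555511
  | .alpha2a => 0x44444444
  | .alpha2b => 0x2222aaaa
  | .chi1a => 0x55555511
  | .chi1b => 0x33333377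
  | .chi1c => 0x11199955
  | .chi2a => 0x88888000
  | .chi2b => 0x22222aaa
  | .chi2c => 0x44444444
  | .phi1a => 0x44440088
  | .phi1b => 0x22226666
  | .phi2a => 0x44444444
  | .phi2b => 0x00088888
  | .phi2c => 0x22222aaa
  | .phi3a => 0x22226666
  | .phi3b => 0x0000cccc
  | .tcu => 0x44444444
  | .line => 0x22226666

/-- The masks of the quadruples. -/
def quadMasks : List ℕ := (List.range 256).filter fun n => bitCount n == 4

lemma mem_quadMasks {S : Finset (Fin 8)} (hS : S.card = 4) : mask S ∈ quadMasks := by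
  rw [quadMasks, List.mem_filter, List.mem_range, bitCount_mask, hS]
  exact ⟨mask_lt S, rfl⟩

/-- A block and its shape differ by a rescaling of the points. Weights count halves of the unit and
offsets count eighths, so the identity is multiplied by 8. The summand 16 is the shift 4 of the
offsets, summed over the four labels. -/
lemma blockValue_weight (b : BlockType) : (quadMasks.all fun n => 8 * blockValue b n + 16 ==
    4 * b.shape.weight n + sumEight fun i => bit n i * (blockOffset b / 16 ^ i % 16)) = true := by
  cases b <;> decide +kernel

/-- The weights are to be valuations of a self-dual lift, where complementary minors agree up to
sign. -/
lemma Shape.weight_compl (t : Shape) :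
    (quadMasks.all fun n => t.weight (255 - n) == t.weight n) = true := by
  cases t <;> decide +kernel

/-! ### The twisted cubic index -/

/-- The sum of the values of `f` over four quadruples through `c`. -/
def evenSum (f : ℕ → ℕ) (c a₁ b₁ a₂ b₂ a₃ b₃ : ℕ) : ℕ :=
  f (c + a₁ + a₂ + a₃) + f (c + a₁ + b₂ + b₃) + f (c + b₁ + a₂ + b₃) + f (c + b₁ + b₂ + a₃)

/-- The smaller of the weights of the two monomials, doubled cubic index added. -/
def Shape.gap (t : Shape) (c a₁ b₁ a₂ b₂ a₃ b₃ : ℕ) : ℕ :=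
  2 * t.cubicIndex +
    min (evenSum t.weight c a₁ b₁ a₂ b₂ a₃ b₃) (evenSum t.weight c a₁ b₁ a₂ b₂ b₃ a₃)

/-- Quantification over the labels above `lo` and outside the set with mask `u`. Labels are given by
their masks. -/
def allOutside (lo u : ℕ) (p : ℕ → Bool) : Bool :=
  [1, 2, 4, 8, 16, 32, 64, 128].all fun x => Nat.ble x lo || Nat.beq (u / x % 2) 1 || p x

/-- The bound for the twisted cubic index. -/
def Shape.gapCheck (t : Shape) : Bool :=
  -- The centre `c` and three disjoint pairs determine a binomial up to sign. Requiring the first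
  -- entries to increase, and each to be the smaller one of its pair, visits each of the `8 · 7 · 15
  -- = 840` configurations once.
  allOutside 0 0 fun c => allOutside 0 c fun a₁ => allOutside a₁ c fun b₁ =>
  allOutside a₁ (c + b₁) fun a₂ => allOutside a₂ (c + a₁ + b₁) fun b₂ =>
  allOutside a₂ (c + b₁ + b₂) fun a₃ => allOutside a₃ (c + a₁ + b₁ + a₂ + b₂) fun b₃ =>
    Nat.ble (t.gap c a₁ b₁ a₂ b₂ a₃ b₃) t.cubicWeight

lemma Shape.gapCheck_eq_true (t : Shape) : t.gapCheck = true := by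
  cases t <;> decide +kernel

end Shapes

/-! ### Boolean checks of the tables. -/

section Checks

/-- The eight label indices. -/
def labels : List ℕ := [0, 1, 2, 3, 4, 5, 6, 7]

/-- The mask `s`, with one label removed and another one added. -/
def swapMask (s a j : ℕ) : ℕ := s - 2 ^ a + 2 ^ j

/-- The sum of `f` over the exchanges of the label `a` of `s`. -/
def rowSum (f : ℕ → ℕ) (s a : ℕ) : ℕ := sumEight fun j => (1 - bit s j) * f (swapMask s a j)

/-- The sum of `f` over the exchanges with the label `j` outside `s`. -/
def colSum (f : ℕ → ℕ) (s j : ℕ) : ℕ := sumEight fun a => bit s a * f (swapMask s a j)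

/-- The first two Cremona equations at the quadruple with mask `s`, for weights `f`, `k` and the
relabelling `g` of some other weights. -/
def cremonaCheck (f : ℕ → ℕ) (k : ℕ) (g : ℕ → ℕ) (s c s' : ℕ) : Bool :=
  labels.all fun a => Nat.beq (bit s a) 0 || labels.all fun j => Nat.beq (bit s j) 1 ||
    (Nat.beq (2 * g (swapMask s' (digit c a) (digit c j)) + 2 * f (swapMask s a j) + k + 2 * f s)
      (2 * g s' + rowSum f s a + colSum f s j) &&
    labels.all fun b => Nat.ble a b || Nat.beq (bit s b) 0 || labels.all fun i =>
      Nat.ble j i || Nat.beq (bit s i) 1 ||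
      Nat.beq (2 * g (swapMask (swapMask s' (digit c a) (digit c j)) (digit c b) (digit c i)) +
          2 * k + 2 * f s + 2 * (f (swapMask s a i) + f (swapMask s b i) + f (swapMask s a j) +
          f (swapMask s b j)))
        (2 * g s' + rowSum f s a + rowSum f s b + colSum f s i + colSum f s j +
          2 * f (swapMask (swapMask s a j) b i)))

/-- The last Cremona equation. -/
def cremonaCubicCheck (f : ℕ → ℕ) (k : ℕ) (g : ℕ → ℕ) (k' s s' : ℕ) : Bool :=
  Nat.beq (k' + 3 * k + 4 * f s) (sumEight (fun a => bit s a * rowSum f s a) + 4 * g s')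

/-- Two masks of even sets have the same class in `E₃`. -/
def sameClass (m n : ℕ) : Bool := Nat.beq m n || Nat.beq (m + n) 255

/-- Two lists of masks describe the same subset of `E₃`. -/
def sameSet (l l' : List ℕ) : Bool :=
  (l.all fun m => l'.any fun n => sameClass m n) && l'.all fun n => l.any fun m => sameClass m n

/-- Two lists of lists of masks describe the same set of subsets of `E₃`. -/
def samePicture (P P' : List (List ℕ)) : Bool :=
  (P.all fun l => P'.any fun l' => sameSet l l') && P'.all fun l' => P.any fun l => sameSet l l'

/-- The effect of a transvection on masks. -/
def transvectMask (s n : ℕ) : ℕ := if meet n s % 2 = 1 then n ^^^ s else n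

/-- A number for the class of the blocks of a given shape. -/
def Shape.classIndex (t : Shape) : ℕ :=
  match t.blockClass with
  | .alpha => 0
  | .chi => 1
  | .phi => 2
  | .hyperelliptic => 3

lemma Shape.blockClass_eq {t t' : Shape} (h : t'.classIndex = t.classIndex) :
    t'.blockClass = t.blockClass := by
  unfold classIndex at h
  generalize t'.blockClass = b' at *
  generalize t.blockClass = b at *
  cases b <;> cases b' <;> first | rfl | simp at h

/-- The Cremona equations, the classes and the images of the pictures, for one entry of the table. -/
def Shape.entryCheck (t : Shape) (s e : ℕ) : Bool :=
  let t' := Shape.ofIndex (e / 256 % 16)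
  let c := e / 4096
  Nat.beq t'.classIndex t.classIndex && Nat.beq (e % 256) s && validCode c &&
    cremonaCheck t.weight t.cubicWeight t'.weight s c (permMask c s) &&
    cremonaCubicCheck t.weight t.cubicWeight t'.weight t'.cubicWeight s (permMask c s) &&
    samePicture (t.picture.map fun l => l.map fun n => permMask c (transvectMask s n)) t'.picture

/-- The Cremona table is correct. -/
def Shape.tableCheck (t : Shape) : Bool :=
  quadMasks.all fun s => Nat.ble 128 s || t.cremonaTable.any fun e => t.entryCheck s e

-- The computational core of the theorem. Masks below 128 are the quadruples without label 7, one
-- from each of the 35 complementary pairs.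
set_option maxHeartbeats 1000000 in
lemma Shape.tableCheck_eq_true (t : Shape) : t.tableCheck = true := by
  cases t <;> decide +kernel

/-- The relabelling with code `c` preserves the weights and the picture of a shape. -/
def Shape.symmetryCheck (t : Shape) (c : ℕ) : Bool :=
  validCode c && (quadMasks.all fun n => Nat.beq (t.weight (permMask c n)) (t.weight n)) &&
    samePicture (t.picture.map fun l => l.map (permMask c)) t.picture

/-- The relabelled block is compatible with a normalisation at the five labels of `u`. -/
def frameCheck (b : BlockType) (c u : ℕ) : Bool :=
  labels.all fun i => if bit u i = 1 then Nat.beq (blockValue b (permMask c (u - 2 ^ i))) 0 else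
    labels.any fun f => Nat.beq (bit u f) 1 && labels.any fun g => Nat.blt f g &&
      Nat.beq (bit u g) 1 && Nat.beq (blockValue b (permMask c (u - 2 ^ f - 2 ^ g + 2 ^ i))) 0

/-- The relabellings in the frame table are symmetries of weights and picture. Using them changes
the block but neither the shape nor the picture. -/
lemma Shape.frameTable_symmetry (t : Shape) :
    (t.frameTable.all fun e => t.symmetryCheck e.2) = true := by
  cases t <;> decide +kernel

/-- Every one of the 56 positions of the five frame labels is served by some entry. The vanishing
inside the frame matches the unit minors of a projective frame. The vanishing at one quadruple
through each further label serves to fix the scale of that point. -/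
lemma Shape.frameTable_frame (t : Shape) : ((List.range 256).all fun u =>
    !(Nat.beq (bitCount u) 5) || t.frameTable.any fun e => frameCheck e.1 e.2 u) = true := by
  cases t <;> decide +kernel

lemma Shape.shape_of_mem_frameTable {t : Shape} {e : BlockType × ℕ} (he : e ∈ t.frameTable) :
    e.1.shape = t := by
  cases t <;> simp only [frameTable, List.mem_cons, List.not_mem_nil, or_false] at he <;>
    aesop

/-- The twisted cubic index is attained. -/
def Shape.witnessCheck (t : Shape) : Bool :=
  let d := fun i => 2 ^ digit t.cubicWitness i
  validCode t.cubicWitness &&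
    Nat.beq (t.gap (d 0) (d 1) (d 6) (d 2) (d 5) (d 3) (d 4)) t.cubicWeight

lemma Shape.witnessCheck_eq_true (t : Shape) : t.witnessCheck = true := by
  cases t <;> decide +kernel

lemma Shape.picture_even (t : Shape) :
    (t.picture.all fun l => l.all fun n => Nat.blt n 256 && Nat.beq (bitCount n % 2) 0) = true := by
  cases t <;> decide +kernel

end Checks

/-! ### The Boolean checks as statements about blocks, quadruples and Cremona equations. -/

section CheckConsequences

/-! ### Blocks and shapes -/

lemma vpt_apply (T : Finset (Fin 8)) (S : Quadruple) :
    (vpt T).1 S = ((meet (mask S.1) (mask T) - 1 : ℕ) : ℚ) := by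
  rw [meet_mask, vpt]
  rcases Nat.eq_zero_or_pos (S.1 ∩ T).card with h | h
  · simp [h]
  · rw [Nat.cast_sub h, Nat.cast_one]
    exact max_eq_right (sub_nonneg.2 (by exact_mod_cast h))

lemma vln_apply (T : Finset (Fin 8)) (S : Quadruple) :
    (vln T).1 S = ((meet (mask S.1) (mask T) - 2 : ℕ) : ℚ) := by
  rw [meet_mask, vln]
  rcases le_total 2 (S.1 ∩ T).card with h | h
  · rw [Nat.cast_sub h]
    exact max_eq_right (sub_nonneg.2 (by exact_mod_cast h))
  · rw [Nat.sub_eq_zero_of_le h]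
    exact max_eq_left (sub_nonpos.2 (by exact_mod_cast h))

lemma vpln_apply (T : Finset (Fin 8)) (S : Quadruple) :
    (vpln T).1 S = ((meet (mask S.1) (mask T) - 3 : ℕ) : ℚ) := by
  rw [meet_mask, vpln]
  rcases le_total 3 (S.1 ∩ T).card with h | h
  · rw [Nat.cast_sub h]
    exact max_eq_right (sub_nonneg.2 (by exact_mod_cast h))
  · rw [Nat.sub_eq_zero_of_le h]
    exact max_eq_left (sub_nonpos.2 (by exact_mod_cast h))

lemma BlockType.valData_fst (b : BlockType) (S : Quadruple) :
    b.valData.1 S = (blockValue b (mask S.1) : ℚ) := by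
  cases b <;> simp only [BlockType.valData, blockValue, Prod.fst_add, Prod.fst_sup, Pi.add_apply,
    Pi.sup_apply, vpt_apply, vln_apply, vpln_apply, Nat.cast_add, Nat.cast_max, vtc,
    Nat.cast_zero] <;> rfl

lemma BlockType.valData_snd (b : BlockType) : b.valData.2 = (b.shape.cubicIndex : ℚ) := by
  cases b <;> simp [BlockType.valData, BlockType.shape, Shape.cubicIndex, vpt, vln, vpln, vtc]

lemma BlockType.shape_blockClass (b : BlockType) : b.shape.blockClass = b.blockClass := by
  cases b <;> rfl

/-- The function `g` is the rescaling, measured in eighths, that turns the block into its self-dual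
shape. -/
lemma BlockType.exists_offset (b : BlockType) : ∃ g : Fin 8 → ℚ, ∀ S : Quadruple,
    8 * b.valData.1 S = 4 * (b.shape.weight (mask S.1) : ℚ) + ∑ i ∈ S.1, g i := by
  refine ⟨fun i => (blockOffset b / 16 ^ (i : ℕ) % 16 : ℕ) - 4, fun S => ?_⟩
  have h := List.all_eq_true.1 (blockValue_weight b) _ (mem_quadMasks S.2)
  rw [beq_iff_eq, sumEight_mask S.1 fun i => blockOffset b / 16 ^ i % 16] at h
  rw [b.valData_fst, Finset.sum_sub_distrib, Finset.sum_const, S.2]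
  have h' := congrArg (Nat.cast (R := ℚ)) h
  push_cast [nsmul_eq_mul] at h' ⊢
  linarith

lemma Shape.weight_mask_compl (t : Shape) {S : Finset (Fin 8)} (hS : S.card = 4) :
    t.weight (mask Sᶜ) = t.weight (mask S) := by
  rw [mask_compl]
  exact beq_iff_eq.1 (List.all_eq_true.1 t.weight_compl _ (mem_quadMasks hS))

/-! ### The twisted cubic index -/

/-- `evenSum` runs over the triples that take one label from each pair and an even number of second
entries. Reversing one pair turns even into odd, so any single reversal yields the other monomial.
-/
lemma evenSum_comm_one (f : ℕ → ℕ) (c a₁ b₁ a₂ b₂ a₃ b₃ : ℕ) :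
    evenSum f c b₁ a₁ a₂ b₂ a₃ b₃ = evenSum f c a₁ b₁ a₂ b₂ b₃ a₃ := by
  unfold evenSum; ring

lemma evenSum_comm_two (f : ℕ → ℕ) (c a₁ b₁ a₂ b₂ a₃ b₃ : ℕ) :
    evenSum f c a₁ b₁ b₂ a₂ a₃ b₃ = evenSum f c a₁ b₁ a₂ b₂ b₃ a₃ := by
  unfold evenSum; ring

lemma evenSum_swap (f : ℕ → ℕ) (c a₁ b₁ a₂ b₂ a₃ b₃ : ℕ) :
    evenSum f c a₂ b₂ a₁ b₁ a₃ b₃ = evenSum f c a₁ b₁ a₂ b₂ a₃ b₃ := by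
  unfold evenSum
  rw [add_right_comm c a₂ a₁, add_right_comm c a₂ b₁, add_right_comm c b₂ a₁,
    add_right_comm c b₂ b₁]
  ring

lemma evenSum_rotate (f : ℕ → ℕ) (c a₁ b₁ a₂ b₂ a₃ b₃ : ℕ) :
    evenSum f c a₁ b₁ a₃ b₃ a₂ b₂ = evenSum f c a₁ b₁ a₂ b₂ a₃ b₃ := by
  unfold evenSum
  rw [add_right_comm (c + a₁) a₃ a₂, add_right_comm (c + a₁) b₃ b₂, add_right_comm (c + b₁) a₃ b₂,
    add_right_comm (c + b₁) b₃ a₂]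
  ring

namespace Shape

variable (t : Shape) (c a₁ b₁ a₂ b₂ a₃ b₃ : ℕ)

lemma gap_comm_one : t.gap c b₁ a₁ a₂ b₂ a₃ b₃ = t.gap c a₁ b₁ a₂ b₂ a₃ b₃ := by
  unfold gap
  rw [evenSum_comm_one _ _ a₁ b₁ a₂ b₂ a₃ b₃, evenSum_comm_one _ _ a₁ b₁ a₂ b₂ b₃ a₃, min_comm]

lemma gap_comm_two : t.gap c a₁ b₁ b₂ a₂ a₃ b₃ = t.gap c a₁ b₁ a₂ b₂ a₃ b₃ := by
  unfold gap
  rw [evenSum_comm_two _ _ a₁ b₁ a₂ b₂ a₃ b₃, evenSum_comm_two _ _ a₁ b₁ a₂ b₂ b₃ a₃, min_comm]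

lemma gap_comm_three : t.gap c a₁ b₁ a₂ b₂ b₃ a₃ = t.gap c a₁ b₁ a₂ b₂ a₃ b₃ := by
  unfold gap
  rw [min_comm]

lemma gap_swap : t.gap c a₂ b₂ a₁ b₁ a₃ b₃ = t.gap c a₁ b₁ a₂ b₂ a₃ b₃ := by
  unfold gap
  rw [evenSum_swap _ _ a₁ b₁ a₂ b₂ a₃ b₃, evenSum_swap _ _ a₁ b₁ a₂ b₂ b₃ a₃]

lemma gap_rotate : t.gap c a₁ b₁ a₃ b₃ a₂ b₂ = t.gap c a₁ b₁ a₂ b₂ a₃ b₃ := by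
  unfold gap
  rw [evenSum_rotate _ _ a₁ b₁ a₂ b₂ a₃ b₃, ← evenSum_comm_two _ _ a₁ b₁ a₃ b₃ a₂ b₂,
    evenSum_rotate _ _ a₁ b₁ a₂ b₂ b₃ a₃]

end Shape

/-- The excluded labels enter as a sum of powers of two; without repetitions this sum is the mask of
their set. -/
lemma allOutside_apply {lo : ℕ} {l : List (Fin 8)} {p : ℕ → Bool} (hl : l.Nodup)
    (h : allOutside lo (l.map fun i : Fin 8 => 2 ^ (i : ℕ)).sum p = true) {j : Fin 8} (hj : j ∉ l)
    (hlo : lo < 2 ^ (j : ℕ)) : p (2 ^ (j : ℕ)) = true := by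
  have hm : (l.map fun i : Fin 8 => 2 ^ (i : ℕ)).sum = mask l.toFinset :=
    (List.sum_toFinset (fun i : Fin 8 => 2 ^ (i : ℕ)) hl).symm
  rw [hm, allOutside, List.all_eq_true] at h
  have hj' : 2 ^ (j : ℕ) ∈ [1, 2, 4, 8, 16, 32, 64, 128] := by
    clear hlo hj; revert j; decide
  have := h _ hj'
  have hb : bit (mask l.toFinset) j = 0 := by
    rw [bit_mask, if_neg (by rwa [List.mem_toFinset])]
  simp only [Bool.or_eq_true, Nat.ble_eq, Nat.beq_eq] at this
  rcases this with (h1 | h1) | h1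
  · omega
  · exact absurd (hb.symm.trans h1) (by norm_num)
  · exact h1

lemma Shape.gap_le_of_sorted (t : Shape) {c a₁ b₁ a₂ b₂ a₃ b₃ : Fin 8}
    (h : [c, a₁, b₁, a₂, b₂, a₃, b₃].Nodup) (h1 : a₁ < b₁) (h2 : a₂ < b₂) (h3 : a₃ < b₃)
    (h12 : a₁ < a₂) (h23 : a₂ < a₃) : t.gap (2 ^ (c : ℕ)) (2 ^ (a₁ : ℕ)) (2 ^ (b₁ : ℕ))
      (2 ^ (a₂ : ℕ)) (2 ^ (b₂ : ℕ)) (2 ^ (a₃ : ℕ)) (2 ^ (b₃ : ℕ)) ≤ t.cubicWeight := by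
  have hlt : ∀ {i j : Fin 8}, i < j → 2 ^ (i : ℕ) < 2 ^ (j : ℕ) := fun h =>
    Nat.pow_lt_pow_right (by norm_num) h
  simp only [List.nodup_cons, List.mem_cons, List.not_mem_nil, not_or, or_false] at h
  obtain ⟨⟨c1, c2, c3, c4, c5, c6⟩, ⟨d1, d2, d3, d4, d5⟩, ⟨e1, e2, e3, e4⟩, ⟨f1, f2, f3⟩,
    ⟨g1, g2⟩, i1, -⟩ := h
  have k0 := t.gapCheck_eq_true
  rw [gapCheck] at k0
  have k1 := allOutside_apply (l := []) (by simp) k0 (j := c) (by simp) (by positivity)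
  have k2 := allOutside_apply (l := [c]) (by simp) (by simpa using k1) (j := a₁)
    (by simp [Ne.symm c1]) (by positivity)
  -- The label `a₁` is not among the excluded ones because the lower bound already rules it out. The
  -- same holds at the later steps where an earlier first entry is missing.
  have k3 := allOutside_apply (l := [c]) (by simp) (by simpa using k2) (j := b₁)
    (by simp [Ne.symm c2]) (hlt h1)
  have k4 := allOutside_apply (l := [c, b₁]) (by simp [c2]) (by simpa using k3) (j := a₂)
    (by simp [Ne.symm c3, Ne.symm e1]) (hlt h12)
  have k5 := allOutside_apply (l := [c, a₁, b₁]) (by simp [c1, c2, d1])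
    (by simpa [add_assoc] using k4) (j := b₂)
    (by simp [Ne.symm c4, Ne.symm d3, Ne.symm e2]) (hlt h2)
  have k6 := allOutside_apply (l := [c, b₁, b₂]) (by simp [c2, c4, e2])
    (by simpa [add_assoc] using k5) (j := a₃)
    (by simp [Ne.symm c5, Ne.symm e3, Ne.symm g1]) (hlt h23)
  have k7 := allOutside_apply (l := [c, a₁, b₁, a₂, b₂])
    (by simp [c1, c2, c3, c4, d1, d2, d3, e1, e2, f1])
    (by simpa [add_assoc] using k6) (j := b₃)
    (by simp [Ne.symm c6, Ne.symm d5, Ne.symm e4, Ne.symm f3, Ne.symm g2]) (hlt h3)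
  exact Nat.le_of_ble_eq_true k7

lemma Shape.gap_le (t : Shape) {c a₁ b₁ a₂ b₂ a₃ b₃ : Fin 8}
    (h : [c, a₁, b₁, a₂, b₂, a₃, b₃].Nodup) : t.gap (2 ^ (c : ℕ)) (2 ^ (a₁ : ℕ)) (2 ^ (b₁ : ℕ))
      (2 ^ (a₂ : ℕ)) (2 ^ (b₂ : ℕ)) (2 ^ (a₃ : ℕ)) (2 ^ (b₃ : ℕ)) ≤ t.cubicWeight := by
  have hne : a₁ ≠ b₁ ∧ a₂ ≠ b₂ ∧ a₃ ≠ b₃ ∧ a₁ ≠ a₂ ∧ a₁ ≠ a₃ ∧ a₂ ≠ a₃ := by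
    simp only [List.nodup_cons, List.mem_cons, List.not_mem_nil, not_or, or_false] at h
    exact ⟨h.2.1.1, h.2.2.2.1.1, h.2.2.2.2.2.1, h.2.1.2.1, h.2.1.2.2.2.1, h.2.2.2.1.2.1⟩
  -- Reversing a pair exchanges the two monomials and permuting pairs fixes both, so every
  -- configuration reduces to the sorted one that was checked.
  wlog h1 : a₁ < b₁ generalizing a₁ b₁
  · rw [gap_comm_one]
    exact this (h.perm ((List.Perm.swap _ _ _).cons _)) (by grind) (by grind)
  wlog h2 : a₂ < b₂ generalizing a₂ b₂
  · rw [gap_comm_two]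
    exact this (h.perm ((((List.Perm.swap _ _ _).cons _).cons _).cons _)) (by grind) (by grind)
  wlog h3 : a₃ < b₃ generalizing a₃ b₃
  · rw [gap_comm_three]
    exact this (h.perm ((((((List.Perm.swap _ _ _).cons _).cons _).cons _).cons _).cons _))
      (by grind) (by grind)
  have swap : ∀ {c a₁ b₁ a₂ b₂ a₃ b₃ : Fin 8}, [c, a₁, b₁, a₂, b₂, a₃, b₃].Nodup →
      [c, a₂, b₂, a₁, b₁, a₃, b₃].Nodup := fun {c a₁ b₁ a₂ b₂ a₃ b₃} h =>
    h.perm (((List.perm_append_comm (l₁ := [a₁, b₁]) (l₂ := [a₂, b₂])).append_right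
      [a₃, b₃]).cons c)
  have rotate : ∀ {c a₁ b₁ a₂ b₂ a₃ b₃ : Fin 8}, [c, a₁, b₁, a₂, b₂, a₃, b₃].Nodup →
      [c, a₁, b₁, a₃, b₃, a₂, b₂].Nodup := fun {c a₁ b₁ a₂ b₂ a₃ b₃} h =>
    h.perm ((((List.perm_append_comm (l₁ := [a₂, b₂]) (l₂ := [a₃, b₃])).cons b₁).cons a₁).cons c)
  obtain ⟨-, -, -, n12, n13, n23⟩ := hne
  rcases lt_or_gt_of_ne n12 with h12 | h12 <;> rcases lt_or_gt_of_ne n23 with h23 | h23 <;>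
    rcases lt_or_gt_of_ne n13 with h13 | h13
  · exact t.gap_le_of_sorted h h1 h2 h3 h12 h23
  · exact t.gap_le_of_sorted h h1 h2 h3 h12 h23
  · rw [gap_rotate]
    exact t.gap_le_of_sorted (rotate h) h1 h3 h2 h13 h23
  · rw [gap_rotate, gap_swap]
    exact t.gap_le_of_sorted (swap (rotate h)) h3 h1 h2 h13 h12
  · rw [gap_swap]
    exact t.gap_le_of_sorted (swap h) h2 h1 h3 h12 h13
  · rw [gap_swap, gap_rotate]
    exact t.gap_le_of_sorted (rotate (swap h)) h2 h3 h1 h23 h13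
  · exact absurd (h23.trans h12) h13.not_gt
  · rw [gap_rotate, gap_swap, gap_rotate]
    exact t.gap_le_of_sorted (rotate (swap (rotate h))) h3 h2 h1 h23 h12

/-- The sum of the values of `f` at the quadruples in the first monomial of the conic condition. -/
def monomialSum₁ {A : Type*} [Add A] (f : Finset (Fin 8) → A) (π : Equiv.Perm (Fin 8)) : A :=
  f {π 0, π 1, π 2, π 3} + f {π 0, π 1, π 4, π 5} + f {π 0, π 2, π 4, π 6} + f {π 0, π 3, π 5, π 6}

/-- The sum of the values of `f` at the quadruples in the second monomial. -/
def monomialSum₂ {A : Type*} [Add A] (f : Finset (Fin 8) → A) (π : Equiv.Perm (Fin 8)) : A :=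
  f {π 0, π 1, π 2, π 4} + f {π 0, π 1, π 3, π 5} + f {π 0, π 2, π 3, π 6} + f {π 0, π 4, π 5, π 6}

lemma mask_quad (π : Equiv.Perm (Fin 8)) {i j k l : Fin 8} (h : [i, j, k, l].Nodup) :
    mask {π i, π j, π k, π l} =
      2 ^ (π i : ℕ) + 2 ^ (π j : ℕ) + 2 ^ (π k : ℕ) + 2 ^ (π l : ℕ) := by
  have h1 : ({π i, π j, π k, π l} : Finset (Fin 8)) = ([i, j, k, l].map π).toFinset := by simp
  rw [h1, mask, List.sum_toFinset (fun i : Fin 8 => 2 ^ (i : ℕ)) (h.map π.injective)]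
  simp [add_assoc]

/-- In the binomial the labels `π 1` and `π 6` never share a minor, and likewise `π 2`, `π 5` and `π
3`, `π 4`. These are the three pairs of the configuration with centre `π 0`, and the first monomial
consists of the even triples. -/
lemma evenSum_eq_monomialSum₁ (f : ℕ → ℕ) (π : Equiv.Perm (Fin 8)) :
    evenSum f (2 ^ (π 0 : ℕ)) (2 ^ (π 1 : ℕ)) (2 ^ (π 6 : ℕ)) (2 ^ (π 2 : ℕ)) (2 ^ (π 5 : ℕ))
      (2 ^ (π 3 : ℕ)) (2 ^ (π 4 : ℕ)) = monomialSum₁ (fun S => f (mask S)) π := by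
  unfold evenSum monomialSum₁
  beta_reduce
  rw [mask_quad π (i := 0) (j := 1) (k := 2) (l := 3) (by decide),
    mask_quad π (i := 0) (j := 1) (k := 4) (l := 5) (by decide),
    mask_quad π (i := 0) (j := 2) (k := 4) (l := 6) (by decide),
    mask_quad π (i := 0) (j := 3) (k := 5) (l := 6) (by decide)]
  ring_nf

lemma evenSum_eq_monomialSum₂ (f : ℕ → ℕ) (π : Equiv.Perm (Fin 8)) :
    evenSum f (2 ^ (π 0 : ℕ)) (2 ^ (π 1 : ℕ)) (2 ^ (π 6 : ℕ)) (2 ^ (π 2 : ℕ)) (2 ^ (π 5 : ℕ))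
      (2 ^ (π 4 : ℕ)) (2 ^ (π 3 : ℕ)) = monomialSum₂ (fun S => f (mask S)) π := by
  unfold evenSum monomialSum₂
  beta_reduce
  rw [mask_quad π (i := 0) (j := 1) (k := 2) (l := 4) (by decide),
    mask_quad π (i := 0) (j := 1) (k := 3) (l := 5) (by decide),
    mask_quad π (i := 0) (j := 2) (k := 3) (l := 6) (by decide),
    mask_quad π (i := 0) (j := 4) (k := 5) (l := 6) (by decide)]
  ring_nf

lemma Shape.gap_eq (t : Shape) (π : Equiv.Perm (Fin 8)) :
    t.gap (2 ^ (π 0 : ℕ)) (2 ^ (π 1 : ℕ)) (2 ^ (π 6 : ℕ)) (2 ^ (π 2 : ℕ)) (2 ^ (π 5 : ℕ))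
      (2 ^ (π 3 : ℕ)) (2 ^ (π 4 : ℕ)) = 2 * t.cubicIndex +
      min (monomialSum₁ (fun S => t.weight (mask S)) π)
        (monomialSum₂ (fun S => t.weight (mask S)) π) := by
  rw [gap, evenSum_eq_monomialSum₁, evenSum_eq_monomialSum₂]

lemma Shape.monomial_bound (t : Shape) (π : Equiv.Perm (Fin 8)) :
    2 * t.cubicIndex + min (monomialSum₁ (fun S => t.weight (mask S)) π)
      (monomialSum₂ (fun S => t.weight (mask S)) π) ≤ t.cubicWeight := by
  rw [← t.gap_eq]
  exact t.gap_le ((by decide : [(0 : Fin 8), 1, 6, 2, 5, 3, 4].Nodup).map π.injective)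

lemma Shape.exists_monomial_eq (t : Shape) : ∃ π : Equiv.Perm (Fin 8),
    2 * t.cubicIndex + min (monomialSum₁ (fun S => t.weight (mask S)) π)
      (monomialSum₂ (fun S => t.weight (mask S)) π) = t.cubicWeight := by
  have h := t.witnessCheck_eq_true
  simp only [witnessCheck, Bool.and_eq_true, Nat.beq_eq] at h
  obtain ⟨r, hr⟩ := exists_isCode h.1
  refine ⟨r, ?_⟩
  rw [← t.gap_eq, ← h.2]
  simp only [hr _]
  rfl

/-! ### Cremona transformations -/

/-- The exchange of a label of `S` with a label outside `S`. -/
def swapLabel (S : Finset (Fin 8)) (a j : Fin 8) : Finset (Fin 8) := insert j (S.erase a)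

/-- The Cremona equations at an arbitrary quadruple, for integral weights. -/
structure CremonaAt (S : Finset (Fin 8)) (w : Finset (Fin 8) → ℕ) (k : ℕ)
    (w' : Finset (Fin 8) → ℕ) (k' : ℕ) : Prop where
  one : ∀ a ∈ S, ∀ j ∉ S, 2 * w' (swapLabel S a j) + 2 * w (swapLabel S a j) + k + 2 * w S =
    2 * w' S + ∑ j' ∈ Sᶜ, w (swapLabel S a j') + ∑ a' ∈ S, w (swapLabel S a' j)
  two : ∀ a ∈ S, ∀ b ∈ S, ∀ j ∉ S, ∀ i ∉ S, b < a → i < j →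
    2 * w' (swapLabel (swapLabel S a j) b i) + 2 * k + 2 * w S +
      2 * (w (swapLabel S a i) + w (swapLabel S b i) + w (swapLabel S a j) + w (swapLabel S b j)) =
    2 * w' S + ∑ l ∈ Sᶜ, w (swapLabel S a l) + ∑ l ∈ Sᶜ, w (swapLabel S b l) +
      ∑ c ∈ S, w (swapLabel S c i) + ∑ c ∈ S, w (swapLabel S c j) +
      2 * w (swapLabel (swapLabel S a j) b i)
  cubic : k' + 3 * k + 4 * w S = ∑ a ∈ S, ∑ j ∈ Sᶜ, w (swapLabel S a j) + 4 * w' S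

lemma mask_swapLabel {S : Finset (Fin 8)} {a j : Fin 8} (ha : a ∈ S) (hj : j ∉ S) :
    mask (swapLabel S a j) = swapMask (mask S) a j := mask_insert_erase ha hj

lemma rowSum_mask (f : ℕ → ℕ) {S : Finset (Fin 8)} {a : Fin 8} (ha : a ∈ S) :
    rowSum f (mask S) a = ∑ j ∈ Sᶜ, f (mask (swapLabel S a j)) := by
  rw [rowSum, sumEight_mask_compl S fun j => f (swapMask (mask S) a j)]
  exact Finset.sum_congr rfl fun j hj => by rw [mask_swapLabel ha (Finset.mem_compl.1 hj)]

lemma colSum_mask (f : ℕ → ℕ) {S : Finset (Fin 8)} {j : Fin 8} (hj : j ∉ S) :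
    colSum f (mask S) j = ∑ a ∈ S, f (mask (swapLabel S a j)) := by
  rw [colSum, sumEight_mask S fun a => f (swapMask (mask S) a j)]
  exact Finset.sum_congr rfl fun a ha => by rw [mask_swapLabel ha hj]

lemma mem_labels (i : Fin 8) : (i : ℕ) ∈ labels := by revert i; decide

lemma bit_mask_of_mem {S : Finset (Fin 8)} {i : Fin 8} (h : i ∈ S) : bit (mask S) i = 1 := by
  rw [bit_mask, if_pos h]

lemma bit_mask_of_notMem {S : Finset (Fin 8)} {i : Fin 8} (h : i ∉ S) : bit (mask S) i = 0 := by
  rw [bit_mask, if_neg h]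

lemma image_swapLabel (r : Equiv.Perm (Fin 8)) (S : Finset (Fin 8)) (a j : Fin 8) :
    (swapLabel S a j).image r = swapLabel (S.image r) (r a) (r j) := by
  rw [swapLabel, swapLabel, Finset.image_insert, Finset.image_erase r.injective]

lemma swapLabel_mem {S : Finset (Fin 8)} {a b j : Fin 8} (hb : b ∈ S) (hab : b ≠ a) :
    b ∈ swapLabel S a j := Finset.mem_insert_of_mem (Finset.mem_erase.2 ⟨hab, hb⟩)

lemma swapLabel_notMem {S : Finset (Fin 8)} {a i j : Fin 8} (hi : i ∉ S) (hij : i ≠ j) :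
    i ∉ swapLabel S a j := by
  rw [swapLabel, Finset.mem_insert, not_or]
  exact ⟨hij, fun h => hi (Finset.mem_of_mem_erase h)⟩

lemma CremonaAt.of_check {f g : ℕ → ℕ} {k k' c : ℕ} {r : Equiv.Perm (Fin 8)} (hr : IsCode c r)
    {S : Finset (Fin 8)} (h : cremonaCheck f k g (mask S) c (permMask c (mask S)) = true)
    (h' : cremonaCubicCheck f k g k' (mask S) (permMask c (mask S)) = true) :
    CremonaAt S (fun T => f (mask T)) k (fun T => g (mask (T.image r))) k' := by
  have hn : ∀ {T : Finset (Fin 8)} {j}, j ∉ T → r j ∉ T.image r := fun hj h => by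
    obtain ⟨i, hi, hij⟩ := Finset.mem_image.1 h
    exact hj (r.injective hij ▸ hi)
  have key : ∀ {T : Finset (Fin 8)}, ∀ a ∈ T, ∀ j ∉ T, mask ((swapLabel T a j).image r) =
      swapMask (mask (T.image r)) (digit c a) (digit c j) := fun a ha j hj => by
    rw [image_swapLabel, mask_swapLabel (Finset.mem_image_of_mem r ha) (hn hj), hr, hr]
  have one : ∀ a ∈ S, ∀ j ∉ S, _ ∧ _ := fun a ha j hj => by
    have h1 := List.all_eq_true.1 h a (mem_labels a)
    rw [Bool.or_eq_true, bit_mask_of_mem ha] at h1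
    have h2 := List.all_eq_true.1 (h1.resolve_left (by decide)) j (mem_labels j)
    rw [Bool.or_eq_true, bit_mask_of_notMem hj] at h2
    exact Bool.and_eq_true_iff.1 (h2.resolve_left (by decide))
  refine ⟨fun a ha j hj => ?_, fun a ha b hb j hj i hi hab hij => ?_, ?_⟩
  · have := (one a ha j hj).1
    rw [Nat.beq_eq] at this
    rw [key a ha j hj, hr.mask_image, mask_swapLabel ha hj, ← rowSum_mask f ha, ← colSum_mask f hj]
    exact this
  · have h1 := List.all_eq_true.1 (one a ha j hj).2 b (mem_labels b)
    rw [Bool.or_eq_true, bit_mask_of_mem hb, Bool.or_eq_true] at h1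
    have h2 := List.all_eq_true.1 (h1.resolve_left (by simpa using hab)) i (mem_labels i)
    rw [Bool.or_eq_true, Bool.or_eq_true, bit_mask_of_notMem hi] at h2
    have h3 := h2.resolve_left (by simpa using hij)
    rw [Nat.beq_eq] at h3
    have hb' := swapLabel_mem (j := j) hb hab.ne
    have hi' := swapLabel_notMem (a := a) hi hij.ne
    rw [key b hb' i hi', key a ha j hj, hr.mask_image, mask_swapLabel hb' hi',
      mask_swapLabel ha hj, mask_swapLabel ha hi, mask_swapLabel hb hj, mask_swapLabel hb hi,
      ← rowSum_mask f ha, ← rowSum_mask f hb, ← colSum_mask f hi, ← colSum_mask f hj]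
    exact h3
  · rw [cremonaCubicCheck, Nat.beq_eq, sumEight_mask S fun a => rowSum f (mask S) a,
      ← hr.mask_image] at h'
    rw [h']
    congr 1
    exact Finset.sum_congr rfl fun a ha => rowSum_mask f ha

lemma compl_swapLabel {S : Finset (Fin 8)} {a j : Fin 8} (ha : a ∈ S) (hj : j ∉ S) :
    swapLabel Sᶜ j a = (swapLabel S a j)ᶜ := by
  have hne : a ≠ j := fun h => hj (h ▸ ha)
  ext i
  simp only [swapLabel, Finset.mem_insert, Finset.mem_erase, Finset.mem_compl, not_or, not_and]
  constructor
  · rintro (rfl | ⟨h1, h2⟩)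
    · exact ⟨hne, fun h => absurd rfl h⟩
    · exact ⟨h1, fun _ h => h2 h⟩
  · rintro ⟨h1, h2⟩
    by_cases h : i = a
    · exact Or.inl h
    · exact Or.inr ⟨h1, h2 h⟩

lemma swapLabel_card {S : Finset (Fin 8)} (hS : S.card = 4) {a j : Fin 8} (ha : a ∈ S)
    (hj : j ∉ S) : (swapLabel S a j).card = 4 := by
  rw [swapLabel, Finset.card_insert_of_notMem fun h => hj (Finset.mem_of_mem_erase h),
    Finset.card_erase_of_mem ha, hS]

lemma swapLabel_comm {S : Finset (Fin 8)} {a b i j : Fin 8} (ha : a ∈ S) (hb : b ∈ S)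
    (hi : i ∉ S) (hj : j ∉ S) :
    swapLabel (swapLabel S a j) b i = swapLabel (swapLabel S b i) a j := by
  have h1 : i ≠ a := fun h => hi (h ▸ ha)
  have h2 : i ≠ b := fun h => hi (h ▸ hb)
  have h3 : j ≠ a := fun h => hj (h ▸ ha)
  have h4 : j ≠ b := fun h => hj (h ▸ hb)
  rw [swapLabel, swapLabel, swapLabel, swapLabel, Finset.erase_insert_of_ne h4,
    Finset.erase_insert_of_ne h1, Finset.insert_comm, Finset.erase_right_comm]

/-- The Cremona equations at a quadruple and at its complement agree. -/
lemma CremonaAt.compl {S : Finset (Fin 8)} {w w' : Finset (Fin 8) → ℕ} {k k' : ℕ}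
    (h : CremonaAt S w k w' k') (hS : S.card = 4) (hw : ∀ T, T.card = 4 → w Tᶜ = w T)
    (hw' : ∀ T, T.card = 4 → w' Tᶜ = w' T) : CremonaAt Sᶜ w k w' k' := by
  have e : ∀ a ∈ S, ∀ j ∉ S, w (swapLabel Sᶜ j a) = w (swapLabel S a j) := fun a ha j hj => by
    rw [compl_swapLabel ha hj, hw _ (swapLabel_card hS ha hj)]
  have e' : ∀ a ∈ S, ∀ j ∉ S, w' (swapLabel Sᶜ j a) = w' (swapLabel S a j) := fun a ha j hj => by
    rw [compl_swapLabel ha hj, hw' _ (swapLabel_card hS ha hj)]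
  have r : ∀ a ∈ S, ∑ j ∈ Sᶜ, w (swapLabel Sᶜ j a) = ∑ j ∈ Sᶜ, w (swapLabel S a j) :=
    fun a ha => Finset.sum_congr rfl fun j hj => e a ha j (Finset.mem_compl.1 hj)
  have c : ∀ j ∉ S, ∑ a ∈ S, w (swapLabel Sᶜ j a) = ∑ a ∈ S, w (swapLabel S a j) :=
    fun j hj => Finset.sum_congr rfl fun a ha => e a ha j hj
  refine ⟨fun j hj a ha => ?_, fun j hj i hi a ha b hb hij hab => ?_, ?_⟩
  · rw [Finset.mem_compl] at hj
    rw [Finset.mem_compl, not_not] at ha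
    rw [compl_compl, e' a ha j hj, e a ha j hj, r a ha, c j hj, hw S hS, hw' S hS]
    have := h.one a ha j hj
    omega
  · rw [Finset.mem_compl] at hj hi
    rw [Finset.mem_compl, not_not] at ha hb
    have hb' := swapLabel_mem (j := j) hb hab.ne
    have hi' := swapLabel_notMem (a := a) hi hij.ne
    have hc : swapLabel (swapLabel Sᶜ j a) i b = (swapLabel (swapLabel S a j) b i)ᶜ := by
      rw [compl_swapLabel ha hj, compl_swapLabel hb' hi']
    have hcard := swapLabel_card (swapLabel_card hS ha hj) hb' hi'
    rw [compl_compl, hc, hw _ hcard, hw' _ hcard, e a ha j hj, e a ha i hi, e b hb j hj,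
      e b hb i hi, r a ha, r b hb, c j hj, c i hi, hw S hS, hw' S hS]
    have := h.two a ha b hb j hj i hi hab hij
    omega
  · rw [compl_compl, hw S hS, hw' S hS, h.cubic, Finset.sum_comm]
    congr 1
    exact Finset.sum_congr rfl fun j hj => (c j (Finset.mem_compl.1 hj)).symm

lemma swapLabel_exchange {S : Finset (Fin 8)} {a b i j : Fin 8} (hb : b ∈ S) (hi : i ∉ S)
    (hj : j ∉ S) : swapLabel (swapLabel S a i) b j = swapLabel (swapLabel S a j) b i := by
  have h2 : i ≠ b := fun h => hi (h ▸ hb)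
  have h4 : j ≠ b := fun h => hj (h ▸ hb)
  rw [swapLabel, swapLabel, swapLabel, swapLabel, Finset.erase_insert_of_ne h2,
    Finset.erase_insert_of_ne h4, Finset.insert_comm]

/-- The Cremona equations in the position `S`, transported to the standard position. -/
lemma CremonaAt.equations {S : Finset (Fin 8)} {w w' : Finset (Fin 8) → ℕ} {k k' : ℕ}
    (h : CremonaAt S w k w' k') {π : Equiv.Perm (Fin 8)} (hπ : frameSet.image π = S) :
    CremonaEquations (fun T => w (T.image π)) k (fun T => w' (T.image π)) k' := by
  have hcast : ∀ a : Fin 4, π (Fin.castAdd 4 a) ∈ S := fun a => by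
    rw [← hπ]
    refine Finset.mem_image_of_mem _ ?_
    revert a; decide
  have hnat : ∀ j : Fin 4, π (Fin.natAdd 4 j) ∉ S := fun j => by
    rw [← hπ, Finset.mem_image]
    rintro ⟨i, hi, hij⟩
    rw [π.injective hij] at hi
    clear hij
    revert j; decide
  have hS : S = Finset.univ.map (frameEmb π) := by rw [map_frameEmb, hπ]
  have hc : Sᶜ = Finset.univ.image fun j : Fin 4 => π (Fin.natAdd 4 j) := by
    ext i
    rw [Finset.mem_compl, Finset.mem_image, hS, Finset.mem_map]
    have := notMem_range_frameEmb (π := π) (i := i)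
    simp only [Set.mem_range] at this
    simpa using this
  have hinj : Function.Injective fun j : Fin 4 => π (Fin.natAdd 4 j) := fun i j hij =>
    Fin.natAdd_injective 4 4 (π.injective hij)
  have sumS : ∀ f : Fin 8 → ℕ, ∑ a ∈ S, f a = ∑ a : Fin 4, f (π (Fin.castAdd 4 a)) := fun f => by
    rw [hS, Finset.sum_map]; rfl
  have sumC : ∀ f : Fin 8 → ℕ, ∑ j ∈ Sᶜ, f j = ∑ j : Fin 4, f (π (Fin.natAdd 4 j)) := fun f => by
    rw [hc, Finset.sum_image fun _ _ _ _ h => hinj h]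
  have hex : ∀ a j, (exch a j).image π =
      swapLabel S (π (Fin.castAdd 4 a)) (π (Fin.natAdd 4 j)) := fun a j => by
    rw [← hπ]; exact image_swapLabel _ _ _ _
  have hex2 : ∀ a b i j, (exchTwo a b i j).image π =
      swapLabel (swapLabel S (π (Fin.castAdd 4 a)) (π (Fin.natAdd 4 j)))
        (π (Fin.castAdd 4 b)) (π (Fin.natAdd 4 i)) := fun a b i j => by
    rw [← hπ, ← image_swapLabel, ← image_swapLabel]
    congr 1
    revert a b i j
    decide +kernel
  refine ⟨fun a j => ?_, fun a b i j hab hij => ?_, ?_⟩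
  · simp only [hex, hπ]
    have := h.one _ (hcast a) _ (hnat j)
    rw [sumS, sumC] at this
    exact_mod_cast this
  · have hab' : π (Fin.castAdd 4 a) ≠ π (Fin.castAdd 4 b) := fun h =>
      hab (Fin.castAdd_injective 4 4 (π.injective h))
    have hij' : π (Fin.natAdd 4 i) ≠ π (Fin.natAdd 4 j) := fun h => hij (hinj h)
    simp only [hex, hex2, hπ]
    have key : ∀ a b i j : Fin 4, π (Fin.castAdd 4 b) < π (Fin.castAdd 4 a) →
        π (Fin.natAdd 4 i) < π (Fin.natAdd 4 j) → _ := fun a b i j h1 h2 =>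
      h.two _ (hcast a) _ (hcast b) _ (hnat j) _ (hnat i) h1 h2
    simp only [sumS, sumC] at key
    have e1 := swapLabel_exchange (a := π (Fin.castAdd 4 a)) (hcast b) (hnat i) (hnat j)
    have e2 := swapLabel_exchange (a := π (Fin.castAdd 4 b)) (hcast a) (hnat i) (hnat j)
    have e3 := swapLabel_comm (hcast a) (hcast b) (hnat i) (hnat j)
    -- The table verifies the second equation only for `b < a` and `i < j`. The equation is
    -- symmetric under both exchanges once the doubly exchanged quadruples are identified by `e1`,
    -- `e2` and `e3`.
    rcases lt_or_gt_of_ne hab' with h1 | h1 <;> rcases lt_or_gt_of_ne hij' with h2 | h2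
    · have := congrArg (Nat.cast (R := ℚ)) (key b a i j h1 h2)
      rw [← e2, ← e3] at this
      push_cast at this
      linarith
    · have := congrArg (Nat.cast (R := ℚ)) (key b a j i h1 h2)
      rw [← e3] at this
      push_cast at this
      linarith
    · have := congrArg (Nat.cast (R := ℚ)) (key a b i j h1 h2)
      push_cast at this
      linarith
    · have := congrArg (Nat.cast (R := ℚ)) (key a b j i h1 h2)
      rw [e1] at this
      push_cast at this
      linarith
  · simp only [hex, hπ]
    have := h.cubic
    rw [sumS] at this
    simp only [sumC] at this
    exact_mod_cast this

lemma image_compl (r : Equiv.Perm (Fin 8)) (S : Finset (Fin 8)) : Sᶜ.image r = (S.image r)ᶜ := by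
  ext i
  obtain ⟨i, rfl⟩ := r.surjective i
  simp

/-- The Cremona table, in terms of sets of labels. -/
lemma Shape.exists_cremona (t : Shape) {S : Finset (Fin 8)} (hS : S.card = 4) :
    ∃ (t' : Shape) (c : ℕ) (r : Equiv.Perm (Fin 8)), t'.blockClass = t.blockClass ∧ IsCode c r ∧
      CremonaAt S (fun T => t.weight (mask T)) t.cubicWeight
        (fun T => t'.weight (mask (T.image r))) t'.cubicWeight ∧
      (samePicture (t.picture.map fun l => l.map fun n => permMask c (transvectMask (mask S) n))
        t'.picture = true ∨
      samePicture (t.picture.map fun l => l.map fun n => permMask c (transvectMask (mask Sᶜ) n))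
        t'.picture = true) := by
  have main : ∀ {S : Finset (Fin 8)}, S.card = 4 → mask S < 128 →
      ∃ (t' : Shape) (c : ℕ) (r : Equiv.Perm (Fin 8)), t'.blockClass = t.blockClass ∧ IsCode c r ∧
      CremonaAt S (fun T => t.weight (mask T)) t.cubicWeight
        (fun T => t'.weight (mask (T.image r))) t'.cubicWeight ∧
      samePicture (t.picture.map fun l => l.map fun n => permMask c (transvectMask (mask S) n))
        t'.picture = true := by
    intro S hS h
    have h1 := List.all_eq_true.1 t.tableCheck_eq_true _ (mem_quadMasks hS)
    rw [Bool.or_eq_true] at h1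
    obtain ⟨e, -, he⟩ := List.any_eq_true.1 (h1.resolve_left (by simpa using h))
    simp only [entryCheck, Bool.and_eq_true] at he
    obtain ⟨⟨⟨⟨⟨h0, -⟩, h2⟩, h3⟩, h4⟩, h5⟩ := he
    obtain ⟨r, hr⟩ := exists_isCode h2
    exact ⟨_, _, r, blockClass_eq (Nat.eq_of_beq_eq_true h0), hr, CremonaAt.of_check hr h3 h4, h5⟩
  -- A quadruple containing label 7 is replaced by its complement, for which the Cremona equations
  -- are the same. Only the set used for the transvection has to be remembered.
  by_cases h : mask S < 128
  · obtain ⟨t', c, r, h0, hr, h1, h2⟩ := main hS h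
    exact ⟨t', c, r, h0, hr, h1, Or.inl h2⟩
  · have hS' : Sᶜ.card = 4 := by rw [Finset.card_compl, hS]; rfl
    obtain ⟨t', c, r, h0, hr, h1, h2⟩ := main hS' (by rw [mask_compl]; omega)
    refine ⟨t', c, r, h0, hr, ?_, Or.inr h2⟩
    have := h1.compl hS' (fun T hT => t.weight_mask_compl hT) fun T hT => ?_
    · rwa [compl_compl] at this
    · rw [image_compl, t'.weight_mask_compl]
      rw [Finset.card_image_of_injective _ r.injective, hT]

/-- The frame table, in terms of sets of labels. -/
lemma Shape.exists_frame (t : Shape) {F : Finset (Fin 8)} (hF : F.card = 5) :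
    ∃ (b : BlockType) (c : ℕ) (r : Equiv.Perm (Fin 8)), b.shape = t ∧ IsCode c r ∧
      (∀ T, T.card = 4 → t.weight (mask (T.image r)) = t.weight (mask T)) ∧
      samePicture (t.picture.map fun l => l.map (permMask c)) t.picture = true ∧
      (∀ i ∈ F, blockValue b (mask ((F.erase i).image r)) = 0) ∧
      ∀ j ∉ F, ∃ f ∈ F, ∃ g ∈ F, f < g ∧
        blockValue b (mask ((insert j ((F.erase f).erase g)).image r)) = 0 := by
  have h1 := List.all_eq_true.1 t.frameTable_frame _ (List.mem_range.2 (mask_lt F))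
  rw [bitCount_mask, hF] at h1
  obtain ⟨⟨b, c⟩, he, hn⟩ := List.any_eq_true.1 h1
  have h2 := List.all_eq_true.1 t.frameTable_symmetry _ he
  simp only [symmetryCheck, Bool.and_eq_true] at h2
  obtain ⟨⟨h3, h4⟩, h5⟩ := h2
  obtain ⟨r, hr⟩ := exists_isCode h3
  refine ⟨b, c, r, shape_of_mem_frameTable he, hr, fun T hT => ?_, h5, fun i hi => ?_,
    fun j hj => ?_⟩
  · rw [hr.mask_image]
    exact Nat.eq_of_beq_eq_true (List.all_eq_true.1 h4 _ (mem_quadMasks hT))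
  · have h6 := List.all_eq_true.1 hn _ (mem_labels i)
    rw [if_pos (bit_mask_of_mem hi)] at h6
    have : mask (F.erase i) + 2 ^ (i : ℕ) = mask F := Finset.sum_erase_add _ _ hi
    rw [hr.mask_image, show mask (F.erase i) = mask F - 2 ^ (i : ℕ) by omega]
    exact Nat.eq_of_beq_eq_true h6
  · have h6 := List.all_eq_true.1 hn _ (mem_labels j)
    rw [if_neg (by rw [bit_mask_of_notMem hj]; norm_num)] at h6
    obtain ⟨f, hf, h7⟩ := List.any_eq_true.1 h6
    rw [Bool.and_eq_true] at h7
    obtain ⟨g, hg, h8⟩ := List.any_eq_true.1 h7.2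
    simp only [Bool.and_eq_true, Nat.beq_eq] at h8
    obtain ⟨⟨h9, h10⟩, h11⟩ := h8
    have lift : ∀ {f}, f ∈ labels → bit (mask F) f = 1 → ∃ f' ∈ F, (f' : ℕ) = f := by
      intro f hf h
      have hf8 : f < 8 := by
        simp only [labels, List.mem_cons, List.not_mem_nil, or_false] at hf
        omega
      refine ⟨⟨f, hf8⟩, ?_, rfl⟩
      by_contra hcon
      exact absurd ((bit_mask_of_notMem hcon).symm.trans h) (by norm_num)
    obtain ⟨f, hf', rfl⟩ := lift hf (Nat.eq_of_beq_eq_true h7.1)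
    obtain ⟨g, hg', rfl⟩ := lift hg h10
    have hfg : f < g := by simpa [Nat.blt] using h9
    refine ⟨f, hf', g, hg', hfg, ?_⟩
    have e1 : mask (F.erase f) + 2 ^ (f : ℕ) = mask F := Finset.sum_erase_add _ _ hf'
    have e2 : mask ((F.erase f).erase g) + 2 ^ (g : ℕ) = mask (F.erase f) :=
      Finset.sum_erase_add _ _ (Finset.mem_erase.2 ⟨hfg.ne', hg'⟩)
    have e3 : mask (insert j ((F.erase f).erase g)) = 2 ^ (j : ℕ) + mask ((F.erase f).erase g) :=
      Finset.sum_insert fun h => hj (Finset.mem_of_mem_erase (Finset.mem_of_mem_erase h))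
    rw [hr.mask_image, e3, show 2 ^ (j : ℕ) + mask ((F.erase f).erase g) =
      mask F - 2 ^ (f : ℕ) - 2 ^ (g : ℕ) + 2 ^ (j : ℕ) by omega]
    exact h11

end CheckConsequences

/-! ### Valuation data and twisted cubic index in terms of regular lifts and shapes. -/

section ShapeOfOctad
variable {L : Type*} [Field L] {ν : AddValuation L (WithTop ℚ)}

lemma plucker_orderEmb (x : Fin 8 → Fin 4 → L) (S : Quadruple) :
    plucker x (S.1.orderEmbOfFin S.2 0) (S.1.orderEmbOfFin S.2 1) (S.1.orderEmbOfFin S.2 2)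
      (S.1.orderEmbOfFin S.2 3) = minor x (S.1.orderEmbOfFin S.2) := by
  rw [plucker_eq_minor]
  congr 1
  ext a
  fin_cases a <;> rfl

/-- A finite valuation means a nonzero minor, so finite valuation data already contain general
position. -/
lemma nu_plucker_iff {x : Fin 8 → Fin 4 → L} {v : Quadruple → ℚ} :
    (∀ S : Quadruple, ν (plucker x (S.1.orderEmbOfFin S.2 0) (S.1.orderEmbOfFin S.2 1)
      (S.1.orderEmbOfFin S.2 2) (S.1.orderEmbOfFin S.2 3)) = (v S : WithTop ℚ)) ↔
    GeneralPosition x ∧ ∀ S : Quadruple, minorNu ν x S.1 = v S := by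
  have e : ∀ S : Quadruple, minorNu ν x S.1 = nu ν (minor x (S.1.orderEmbOfFin S.2)) :=
    fun S => dif_pos S.2
  simp only [plucker_orderEmb, nu_eq_iff, e]
  refine ⟨fun h => ⟨fun f hf h0 => ?_, fun S => (h S).2⟩, fun h S =>
    ⟨h.1 _ (S.1.orderEmbOfFin S.2).injective, h.2 S⟩⟩
  have hc : (Finset.univ.image f).card = 4 := by
    rw [Finset.card_image_of_injective _ hf]; rfl
  refine pow_ne_zero 2 (h ⟨_, hc⟩).1 ?_
  rw [minor_sq_congr x (Finset.orderEmbOfFin _ hc).injective hf, h0, zero_pow two_ne_zero]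
  simp

lemma sum_quad (π : Equiv.Perm (Fin 8)) {i j k l : Fin 8} (h : [i, j, k, l].Nodup)
    (f : Fin 8 → ℚ) : ∑ a ∈ {π i, π j, π k, π l}, f a = f (π i) + f (π j) + f (π k) + f (π l) := by
  have h1 : ({π i, π j, π k, π l} : Finset (Fin 8)) = ([i, j, k, l].map π).toFinset := by simp
  rw [h1, List.sum_toFinset f (h.map π.injective)]
  simp [add_assoc]

/-- The common contribution of a rescaling of the points to the monomials of the conic condition. -/
def monomialShift (d : ℚ) (h : Fin 8 → ℚ) (π : Equiv.Perm (Fin 8)) : ℚ :=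
  4 * d + 4 * h (π 0) + 2 * (h (π 1) + h (π 2) + h (π 3) + h (π 4) + h (π 5) + h (π 6))

lemma quad_card (π : Equiv.Perm (Fin 8)) {i j k l : Fin 8} (h : [i, j, k, l].Nodup) :
    ({π i, π j, π k, π l} : Finset (Fin 8)).card = 4 := by
  have h1 : ({π i, π j, π k, π l} : Finset (Fin 8)) = ([i, j, k, l].map π).toFinset := by simp
  rw [h1, List.toFinset_card_of_nodup (h.map π.injective)]
  rfl

/-- Both monomials contain every label equally often, so a rescaling of the points shifts them by
the same amount. -/
lemma monomialSum_shift {f g : Finset (Fin 8) → ℚ} {d r : ℚ} {h : Fin 8 → ℚ}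
    (hfg : ∀ S, S.card = 4 → f S = r * g S + d + ∑ i ∈ S, h i) (π : Equiv.Perm (Fin 8)) :
    monomialSum₁ f π = r * monomialSum₁ g π + monomialShift d h π ∧
      monomialSum₂ f π = r * monomialSum₂ g π + monomialShift d h π := by
  have e : ∀ i j k l : Fin 8, [i, j, k, l].Nodup → f {π i, π j, π k, π l} =
      r * g {π i, π j, π k, π l} + d + (h (π i) + h (π j) + h (π k) + h (π l)) :=
    fun i j k l hn => by rw [hfg _ (quad_card π hn), sum_quad π hn]
  unfold monomialSum₁ monomialSum₂ monomialShift
  rw [e 0 1 2 3 (by decide), e 0 1 4 5 (by decide), e 0 2 4 6 (by decide), e 0 3 5 6 (by decide),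
    e 0 1 2 4 (by decide), e 0 1 3 5 (by decide), e 0 2 3 6 (by decide), e 0 4 5 6 (by decide)]
  constructor <;> ring

lemma GeneralPosition.nu_cubicMonomial {x : Fin 8 → Fin 4 → L} (hx : GeneralPosition x)
    (π : Equiv.Perm (Fin 8)) : ν (cubicMonomial₁ x π) = ((monomialSum₁ (minorNu ν x) π : ℚ) : WithTop ℚ) ∧
      ν (cubicMonomial₂ x π) = ((monomialSum₂ (minorNu ν x) π : ℚ) : WithTop ℚ) := by
  have e : ∀ i j k l : Fin 8, Function.Injective ![i, j, k, l] →
      ν (plucker x (π i) (π j) (π k) (π l)) =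
        (minorNu ν x {π i, π j, π k, π l} : WithTop ℚ) := fun i j k l h => by
    have hi : Function.Injective ![π i, π j, π k, π l] := by
      have := π.injective.comp h
      convert this using 1
      ext a
      fin_cases a <;> rfl
    rw [minorNu_plucker x hi, coe_nu]
    rw [plucker_eq_minor]
    exact hx _ hi
  unfold cubicMonomial₁ cubicMonomial₂ monomialSum₁ monomialSum₂
  simp only [ν.map_mul]
  rw [e 0 1 2 3 (by decide), e 0 1 4 5 (by decide), e 0 2 4 6 (by decide), e 0 3 5 6 (by decide),
    e 0 1 2 4 (by decide), e 0 1 3 5 (by decide), e 0 2 3 6 (by decide), e 0 4 5 6 (by decide)]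
  exact ⟨rfl, rfl⟩

/-- The twisted cubic index is computed by any regular lift. -/
lemma IsRegular.isTwistedCubicIndex_iff {x : Fin 8 → Fin 4 → L} (hx : IsRegular x)
    {c : Fin 8 → L} (hc : ∀ i, c i ≠ 0) {t : ℚ} :
    IsTwistedCubicIndex ν (fun i => c i • x i) t ↔
      (∀ π, t + min (monomialSum₁ (minorNu ν x) π) (monomialSum₂ (minorNu ν x) π) ≤ cubicNu ν x) ∧
      ∃ π, t + min (monomialSum₁ (minorNu ν x) π) (monomialSum₂ (minorNu ν x) π) = cubicNu ν x := by
  have hg : GeneralPosition fun i => c i • x i := by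
    simpa using hx.general.smul_mulVec (M := 1) (by simp) hc
  have hm := monomialSum_shift (f := minorNu ν fun i => c i • x i) (g := minorNu ν x) (r := 1)
    (d := 0) (h := fun i => nu ν (c i)) fun S hS => by
      have := minorNu_smul_mulVec (ν := ν) hx.general (M := 1) (by simp) hc hS
      simp only [Matrix.one_mulVec, Matrix.det_one, nu_one] at this
      rw [this, one_mul]
  have hf : ∀ π, ν (cubicMonomial₁ (fun i => c i • x i) π - cubicMonomial₂ (fun i => c i • x i) π) =
      ((cubicNu ν x + monomialShift 0 (fun i => nu ν (c i)) π : ℚ) : WithTop ℚ) := fun π => by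
    have h1 := cubicForm_smul_mulVec 1 c x π
    simp only [Matrix.one_mulVec, Matrix.det_one] at h1
    have h2 := cubicFactor_ne_zero one_ne_zero hc π
    rw [show cubicMonomial₁ (fun i => c i • x i) π - cubicMonomial₂ (fun i => c i • x i) π =
      cubicForm (fun i => c i • x i) π from rfl, h1, coe_nu (mul_ne_zero h2 (hx.cubic π)),
      nu_mul h2 (hx.cubic π), hx.nu_cubicForm, nu_cubicFactor one_ne_zero hc, nu_one,
      monomialShift, add_comm]
  have key : ∀ π, (t : WithTop ℚ) + min (ν (cubicMonomial₁ (fun i => c i • x i) π))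
      (ν (cubicMonomial₂ (fun i => c i • x i) π)) =
      ((t + min (monomialSum₁ (minorNu ν x) π) (monomialSum₂ (minorNu ν x) π) +
        monomialShift 0 (fun i => nu ν (c i)) π : ℚ) : WithTop ℚ) := fun π => by
    rw [(hg.nu_cubicMonomial π).1, (hg.nu_cubicMonomial π).2, (hm π).1, (hm π).2, one_mul, one_mul,
      ← WithTop.coe_min, ← WithTop.coe_add, min_add_add_right, add_assoc]
  -- The same shift occurs for the binomial and for its monomials, and cancels.
  unfold IsTwistedCubicIndex
  simp only [key, hf, WithTop.coe_le_coe, WithTop.coe_inj, add_le_add_iff_right, add_left_inj]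

/-- The valuations of a regular octad are those of a single block of shape `t`, relabelled by `σ`
and scaled by `m`. -/
def HasShape (ν : AddValuation L (WithTop ℚ)) (x : Fin 8 → Fin 4 → L) (m : ℚ) (t : Shape)
    (σ : Equiv.Perm (Fin 8)) : Prop :=
  ∃ c : ℚ, (∀ S, S.card = 4 → minorNu ν x S = m / 2 * t.weight (mask (S.image σ.symm)) + c) ∧
    cubicNu ν x = m / 2 * t.cubicWeight + 4 * c

lemma HasShape.comp {x : Fin 8 → Fin 4 → L} {m : ℚ} {t : Shape} {σ : Equiv.Perm (Fin 8)}
    (h : HasShape ν x m t σ) (hx : IsRegular x) (ρ : Equiv.Perm (Fin 8)) :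
    HasShape ν (x ∘ ρ.symm) m t (ρ * σ) := by
  obtain ⟨c, h1, h2⟩ := h
  refine ⟨c, fun S hS => ?_, ?_⟩
  · rw [minorNu_comp x ρ.symm hS, h1 _ (by
      rw [Finset.card_image_of_injective _ ρ.symm.injective, hS]), Finset.image_image]
    rfl
  · rw [hx.cubicNu_comp, h2]

lemma HasShape.mulVec {x : Fin 8 → Fin 4 → L} {m : ℚ} {t : Shape} {σ : Equiv.Perm (Fin 8)}
    (h : HasShape ν x m t σ) (hx : IsRegular x) {M : Matrix (Fin 4) (Fin 4) L} (hM : M.det ≠ 0) :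
    HasShape ν (fun i => M.mulVec (x i)) m t σ := by
  obtain ⟨c, h1, h2⟩ := h
  refine ⟨c + nu ν M.det, fun S hS => ?_, ?_⟩
  · rw [hx.minorNu_mulVec hM hS, h1 S hS, add_assoc]
  · rw [hx.cubicNu_mulVec hM, h2]; ring

/-- The weights of a shape have the twisted cubic index of the shape. -/
lemma Shape.cubic_bound (t : Shape) {m c k : ℚ} (hm : 0 < m) {w : Finset (Fin 8) → ℚ}
    {σ : Equiv.Perm (Fin 8)}
    (hw : ∀ S, S.card = 4 → w S = m / 2 * t.weight (mask (S.image σ.symm)) + c) :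
    ((∀ π, m * t.cubicIndex + min (monomialSum₁ w π) (monomialSum₂ w π) ≤ k) ∧
      ∃ π, m * t.cubicIndex + min (monomialSum₁ w π) (monomialSum₂ w π) = k) ↔
    k = m / 2 * t.cubicWeight + 4 * c := by
  have hsum : ∀ π, m * t.cubicIndex + min (monomialSum₁ w π) (monomialSum₂ w π) =
      m / 2 * ((2 * t.cubicIndex + min (monomialSum₁ (fun S => t.weight (mask S)) (σ⁻¹ * π))
        (monomialSum₂ (fun S => t.weight (mask S)) (σ⁻¹ * π)) : ℕ) : ℚ) + 4 * c := fun π => by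
    have h1 := monomialSum_shift (f := w) (g := fun S => (t.weight (mask (S.image σ.symm)) : ℚ)) (d := c)
      (r := m / 2) (h := fun _ => 0) (fun S hS => by rw [hw S hS]; simp) π
    have e : ∀ i j k l : Fin 8, ({π i, π j, π k, π l} : Finset (Fin 8)).image σ.symm =
        {(σ⁻¹ * π) i, (σ⁻¹ * π) j, (σ⁻¹ * π) k, (σ⁻¹ * π) l} := fun i j k l => by
      simp only [Finset.image_insert, Finset.image_singleton]; rfl
    have h2 : monomialSum₁ (fun S => (t.weight (mask (S.image σ.symm)) : ℚ)) π =
        (monomialSum₁ (fun S => t.weight (mask S)) (σ⁻¹ * π) : ℕ) := by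
      simp only [monomialSum₁, e]; push_cast; rfl
    have h3 : monomialSum₂ (fun S => (t.weight (mask (S.image σ.symm)) : ℚ)) π =
        (monomialSum₂ (fun S => t.weight (mask S)) (σ⁻¹ * π) : ℕ) := by
      simp only [monomialSum₂, e]; push_cast; rfl
    have h4 : monomialShift c (fun _ => 0) π = 4 * c := by unfold monomialShift; ring
    rw [h1.1, h1.2, h2, h3, h4, min_add_add_right, ← mul_min_of_nonneg _ _ (by positivity)]
    push_cast
    ring
  have hm2 : 0 < m / 2 := by positivity
  have hb : ∀ π, m * t.cubicIndex + min (monomialSum₁ w π) (monomialSum₂ w π) ≤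
      m / 2 * t.cubicWeight + 4 * c := fun π => by
    rw [hsum]
    have := t.monomial_bound (σ⁻¹ * π)
    have := (Nat.cast_le (α := ℚ)).2 this
    nlinarith
  have ha : ∃ π, m * t.cubicIndex + min (monomialSum₁ w π) (monomialSum₂ w π) =
      m / 2 * t.cubicWeight + 4 * c := by
    obtain ⟨π, hπ⟩ := t.exists_monomial_eq
    refine ⟨σ * π, ?_⟩
    rw [hsum, inv_mul_cancel_left, hπ]
  -- A bound that holds everywhere and is attained somewhere is unique, and `m / 2 * t.cubicWeight +
  -- 4 * c` is such a bound.
  constructor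
  · rintro ⟨h1, π, h2⟩
    obtain ⟨π', h3⟩ := ha
    exact le_antisymm (h2 ▸ hb π) (h3 ▸ h1 π')
  · rintro rfl
    exact ⟨hb, ha⟩

end ShapeOfOctad

/-! ### From blocks to shapes, through Cremona transformations, and back to blocks. -/

section NormalForm
variable {L : Type*} [Field L] {ν : AddValuation L (WithTop ℚ)}

/-- A rescaling that does not affect self-dual weights is constant. -/
lemma offset_const {δ : Fin 8 → ℚ}
    (h : ∀ S : Finset (Fin 8), S.card = 4 → ∑ i ∈ S, δ i = ∑ i ∈ Sᶜ, δ i) (i j : Fin 8) :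
    δ i = δ j := by
  by_cases hij : i = j
  · rw [hij]
  obtain ⟨S, hS, hi, hj⟩ : ∃ S : Finset (Fin 8), S.card = 4 ∧ i ∈ S ∧ j ∉ S := by
    clear h
    revert i j
    decide +kernel
  have hc := swapLabel_card hS hi hj
  have h1 := Finset.sum_add_sum_compl S δ
  have h2 := Finset.sum_add_sum_compl (swapLabel S i j) δ
  have h3 := h S hS
  have h4 := h _ hc
  have h5 : ∑ l ∈ swapLabel S i j, δ l = δ j + ∑ l ∈ S.erase i, δ l :=
    Finset.sum_insert fun h => hj (Finset.mem_of_mem_erase h)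
  have h6 : ∑ l ∈ S.erase i, δ l + δ i = ∑ l ∈ S, δ l := Finset.sum_erase_add _ _ hi
  linarith

lemma Block.valData_apply (B : Block) (S : Quadruple) {T : Quadruple}
    (h : T.1 = S.1.image B.labelling.symm) : B.valData.1 S = B.type.valData.1 T := by
  have : T = ⟨S.1.map B.labelling.symm.toEmbedding, by rw [Finset.card_map]; exact S.2⟩ :=
    Subtype.ext (h.trans (Finset.map_eq_image B.labelling.symm.toEmbedding S.1).symm)
  rw [this]; rfl

lemma sum_image_symm (σ : Equiv.Perm (Fin 8)) (S : Finset (Fin 8)) (g : Fin 8 → ℚ) :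
    ∑ i ∈ S.image σ.symm, g i = ∑ i ∈ S, g (σ.symm i) :=
  Finset.sum_image fun _ _ _ _ h => σ.symm.injective h

lemma card_image_perm (σ : Equiv.Perm (Fin 8)) (S : Finset (Fin 8)) :
    (S.image σ).card = S.card := Finset.card_image_of_injective _ σ.injective

lemma minorNu_smul_of_general {x : Fin 8 → Fin 4 → L} (hx : GeneralPosition x) {c : Fin 8 → L}
    (hc : ∀ i, c i ≠ 0) {S : Finset (Fin 8)} (hS : S.card = 4) :
    minorNu ν (fun i => c i • x i) S = minorNu ν x S + ∑ i ∈ S, nu ν (c i) := by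
  have := minorNu_smul_mulVec (ν := ν) hx (M := 1) (by simp) hc hS
  simpa only [Matrix.one_mulVec, Matrix.det_one, nu_one, add_zero] using this

/-- An octad with the valuation data of a block has the corresponding shape. -/
lemma HasValuationData.exists_hasShape [IsAlgClosed L] {O : Octad L} (hO : IsCayleyOctad O) {m : ℚ}
    (hm : 0 < m) {B : Block} (h : HasValuationData ν O (m • B.valData)) :
    ∃ x, IsLift x O ∧ IsRegular x ∧ IsNetBase x ∧ HasShape ν x m B.type.shape B.labelling := by
  obtain ⟨x, hx, -, hv, ht⟩ := h
  obtain ⟨hg, hw⟩ := nu_plucker_iff.1 hv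
  obtain ⟨π, hπ⟩ := ht.2
  -- A vanishing binomial would have infinite valuation, against the finiteness of the twisted cubic
  -- index.
  have hc : cubicForm x π ≠ 0 := by
    intro h0
    rw [show cubicMonomial₁ x π - cubicMonomial₂ x π = cubicForm x π from rfl, h0, ν.map_zero,
      (hg.nu_cubicMonomial π).1, (hg.nu_cubicMonomial π).2, ← WithTop.coe_min, ← WithTop.coe_add]
      at hπ
    exact WithTop.coe_ne_top hπ
  obtain ⟨c, hc0, hr⟩ := hO.exists_isRegular hx hg hc
  have hl := hx.smul hc0
  refine ⟨_, hl, hr, ((isCayleyOctad_iff hl).1 hO).2, ?_⟩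
  obtain ⟨g, hgo⟩ := B.type.exists_offset
  set δ : Fin 8 → ℚ := fun i => m / 8 * g (B.labelling.symm i) + nu ν (c i) with hδ
  have hw' : ∀ S : Finset (Fin 8), S.card = 4 → minorNu ν (fun i => c i • x i) S =
      m / 2 * B.type.shape.weight (mask (S.image B.labelling.symm)) + ∑ i ∈ S, δ i := by
    intro S hS
    have hS' : (S.image B.labelling.symm).card = 4 := by rw [card_image_perm, hS]
    have h1 := hw ⟨S, hS⟩
    have h2 := hgo ⟨_, hS'⟩
    have h3 : (m • B.valData).1 ⟨S, hS⟩ = m * B.type.valData.1 ⟨_, hS'⟩ := by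
      rw [← B.valData_apply ⟨S, hS⟩ rfl]; rfl
    rw [sum_image_symm] at h2
    rw [minorNu_smul_of_general hg hc0 hS, h1, h3, hδ, Finset.sum_add_distrib, ← Finset.mul_sum]
    linear_combination m / 8 * h2
  -- The minors of the self-dual lift and the weights are both symmetric under complementation,
  -- hence so is the rescaling between them, which must be constant.
  have hconst := offset_const fun S hS => by
    have h1 := hw' S hS
    have hS' : Sᶜ.card = 4 := by rw [Finset.card_compl, hS]; rfl
    have h2 := hw' Sᶜ hS'
    rw [image_compl, B.type.shape.weight_mask_compl (by rw [card_image_perm, hS]),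
      hr.selfDual.minorNu_compl hS] at h2
    linarith
  have hw'' : ∀ S : Finset (Fin 8), S.card = 4 → minorNu ν (fun i => c i • x i) S =
      m / 2 * B.type.shape.weight (mask (S.image B.labelling.symm)) + 4 * δ 0 := by
    intro S hS
    rw [hw' S hS, Finset.sum_congr rfl fun i _ => hconst i 0, Finset.sum_const, hS, nsmul_eq_mul]
    norm_num
  refine ⟨4 * δ 0, hw'', ?_⟩
  -- The valuation of the conic condition is not determined by the minors; the prescribed twisted
  -- cubic index supplies it.
  refine (B.type.shape.cubic_bound hm hw'').1 ?_
  have hxc : x = fun i => (c i)⁻¹ • (c i • x i) := by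
    funext i
    rw [smul_smul, inv_mul_cancel₀ (hc0 i), one_smul]
  rw [hxc, hr.isTwistedCubicIndex_iff fun i => inv_ne_zero (hc0 i)] at ht
  have htv : (m • B.valData).2 = m * B.type.shape.cubicIndex := by
    rw [← B.type.valData_snd]; rfl
  rwa [htv] at ht

/-! ### Cremona transformations -/

lemma CremonaEquations.smul {w w' : Finset (Fin 8) → ℚ} {k k' : ℚ}
    (h : CremonaEquations w k w' k') (r : ℚ) :
    CremonaEquations (fun T => r * w T) (r * k) (fun T => r * w' T) (r * k') := by
  refine ⟨fun a j => ?_, fun a b i j hab hij => ?_, ?_⟩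
  · have := h.one a j
    simp only [← Finset.mul_sum]
    linear_combination r * this
  · have := h.two a b i j hab hij
    simp only [← Finset.mul_sum]
    linear_combination r * this
  · have := h.cubic
    simp only [← Finset.mul_sum]
    linear_combination r * this

/-- The Cremona equations determine the weights of the image up to a shift. -/
lemma CremonaEquations.unique {w w₁ w₂ : Finset (Fin 8) → ℚ} {k k₁ k₂ : ℚ}
    (h₁ : CremonaEquations w k w₁ k₁) (h₂ : CremonaEquations w k w₂ k₂)
    (hw₁ : ∀ T, T.card = 4 → w₁ Tᶜ = w₁ T) (hw₂ : ∀ T, T.card = 4 → w₂ Tᶜ = w₂ T) :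
    ∃ c, (∀ T, T.card = 4 → w₁ T = w₂ T + c) ∧ k₁ = k₂ + 4 * c := by
  have h1 : ∀ a j, w₁ (exch a j) = w₂ (exch a j) + (w₁ frameSet - w₂ frameSet) := fun a j => by
    linarith [h₁.one a j, h₂.one a j]
  refine ⟨w₁ frameSet - w₂ frameSet, fun T hT => ?_, by linarith [h₁.cubic, h₂.cubic]⟩
  have hF : frameSet.card = 4 := by decide
  rcases quadruple_cases T hT with rfl | rfl | ⟨a, j, rfl | rfl⟩ | ⟨a, b, i, j, hab, hij, rfl⟩
  · ring
  · rw [hw₁ _ hF, hw₂ _ hF]; ring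
  · exact h1 a j
  · rw [hw₁ _ (exch_card a j), hw₂ _ (exch_card a j), h1]
  · linarith [h₁.two a b i j hab hij, h₂.two a b i j hab hij]

/-- The shape of a Cremona image. -/
lemma CremonaRel.exists_hasShape [IsAlgClosed L] {S : Finset (Fin 8)} (hS : S.card = 4)
    {O O' : Octad L} (h : CremonaRel S O O') {x : Fin 8 → Fin 4 → L} (hx : IsLift x O)
    (hr : IsRegular x) (hn : IsNetBase x) {m : ℚ} {t : Shape} {σ : Equiv.Perm (Fin 8)}
    (hs : HasShape ν x m t σ) :
    ∃ (z : Fin 8 → Fin 4 → L) (t' : Shape) (c : ℕ) (r : Equiv.Perm (Fin 8)), IsLift z O' ∧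
      IsRegular z ∧ IsNetBase z ∧ HasShape ν z m t' (σ * r⁻¹) ∧
      t'.blockClass = t.blockClass ∧ IsCode c r ∧
      (samePicture (t.picture.map fun l => l.map fun n =>
        permMask c (transvectMask (mask (S.image σ.symm)) n)) t'.picture = true ∨
      samePicture (t.picture.map fun l => l.map fun n =>
        permMask c (transvectMask (mask (S.image σ.symm)ᶜ) n)) t'.picture = true) := by
  obtain ⟨π, z, hπ, hz, hzr, hzn, heq⟩ := h.exists_isRegular ν hx hr hn
  obtain ⟨t', c, r, hcl, hrc, hC, hpic⟩ := t.exists_cremona (S := S.image σ.symm)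
    (by rw [card_image_perm, hS])
  refine ⟨z, t', c, r, hz, hzr, hzn, ?_, hcl, hrc, hpic⟩
  obtain ⟨d, hw, hk⟩ := hs
  have hπ' : frameSet.image (σ.symm * π : Equiv.Perm (Fin 8)) = S.image σ.symm := by
    rw [← hπ, Finset.image_image]; rfl
  have himg : ∀ T : Finset (Fin 8), T.image (σ.symm * π : Equiv.Perm (Fin 8)) =
      (T.image π).image σ.symm := fun T => by rw [Finset.image_image]; rfl
  -- The table and the octad solve the same linear system, so the actual image has the tabulated
  -- weights up to a constant.
  have e1 := (hC.equations hπ').smul (m / 2)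
  have e2 : CremonaEquations (fun T => minorNu ν x (T.image π)) (cubicNu ν x)
      (fun T => m / 2 * (t'.weight (mask (((T.image π).image σ.symm).image r)) : ℚ))
      (m / 2 * t'.cubicWeight) := by
    refine e1.shift (c := d) (c' := 0) (fun T hT => ?_) hk (fun T hT => ?_) (by ring)
    · rw [hw _ (by rw [card_image_perm, hT]), himg]
    · rw [himg, add_zero]
  obtain ⟨c', h1, h2⟩ := heq.unique e2 (fun T hT => by
      rw [image_compl, hzr.selfDual.minorNu_compl (by rw [card_image_perm, hT])]) fun T hT => by
      rw [image_compl, image_compl, image_compl, t'.weight_mask_compl]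
      simp only [card_image_perm, hT]
  refine ⟨c', fun T hT => ?_, h2⟩
  have := h1 (T.image π.symm) (by rw [card_image_perm, hT])
  have e : (T.image π.symm).image π = T := by
    rw [Finset.image_image, Equiv.self_comp_symm, Finset.image_id]
  rw [e] at this
  rw [this, Finset.image_image]
  rfl

/-! ### Normalised octads -/

/-- Divide by a coordinate of minimal valuation. -/
lemma exists_primitive (ν : AddValuation L (WithTop ℚ)) {v : Fin 4 → L} (hv : v ≠ 0) :
    ∃ u : L, u ≠ 0 ∧ (∀ a, 0 ≤ ν (u * v a)) ∧ ∃ a, ν (u * v a) = 0 := by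
  obtain ⟨a, -, ha⟩ := Finset.exists_min_image Finset.univ (fun a => ν (v a)) Finset.univ_nonempty
  have h0 : v a ≠ 0 := by
    intro h
    refine hv (funext fun b => ν.top_iff.1 (top_le_iff.1 ?_))
    have := ha b (Finset.mem_univ b)
    rwa [h, ν.map_zero] at this
  have h1 : ν ((v a)⁻¹ * v a) = 0 := by rw [inv_mul_cancel₀ h0, ν.map_one]
  refine ⟨(v a)⁻¹, inv_ne_zero h0, fun b => ?_, a, h1⟩
  rw [← h1, ν.map_mul, ν.map_mul]
  gcongr
  exact ha b (Finset.mem_univ b)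

lemma minor_integral {x : Fin 8 → Fin 4 → L} (hx : ∀ i a, 0 ≤ ν (x i a)) (f : Fin 4 → Fin 8) :
    0 ≤ ν (minor x f) := by
  rw [minor, Matrix.det_apply']
  refine ν.map_le_sum fun p _ => ?_
  rw [ν.map_mul]
  have h1 : 0 ≤ ν ((Equiv.Perm.sign p : ℤ) : L) := by
    rcases Int.units_eq_one_or (Equiv.Perm.sign p) with h | h <;> simp [h]
  have h2 : 0 ≤ ν (∏ i, Matrix.of (fun a => x (f a)) (p i) i) := by
    rw [Fin.prod_univ_four]
    simp only [ν.map_mul]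
    have := fun i => hx (f (p i)) i
    exact add_nonneg (add_nonneg (add_nonneg (this 0) (this 1)) (this 2)) (this 3)
  exact add_nonneg h1 h2

lemma minorNu_nonneg {x : Fin 8 → Fin 4 → L} (hg : GeneralPosition x)
    (hx : ∀ i a, 0 ≤ ν (x i a)) {S : Finset (Fin 8)} (hS : S.card = 4) : 0 ≤ minorNu ν x S := by
  obtain ⟨f, hf, rfl⟩ := exists_image_eq hS
  rw [minorNu_image x hf]
  have := minor_integral hx f
  rw [coe_nu (hg f hf)] at this
  exact_mod_cast this

/-- The labels of the standard projective frame. -/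
def fullFrame : Finset (Fin 8) := {0, 1, 2, 3, 4}

/-- A normalised octad has a lift with a standard frame and primitive coordinates. -/
lemma IsNormalised.exists_lift (ν : AddValuation L (WithTop ℚ)) {O : Octad L} (h : IsNormalised O) :
    ∃ (π : Equiv.Perm (Fin 8)) (y : Fin 8 → Fin 4 → L), IsLift y O ∧
      (∀ i, (∀ a, 0 ≤ ν (y i a)) ∧ ∃ a, ν (y i a) = 0) ∧
      StandardFrame (y ∘ π) ∧ ∀ a, y (π 4) a = 1 := by
  obtain ⟨s, x, hx, hs, h4⟩ := h
  have hp : ∀ i, ∃ u : L, u ≠ 0 ∧ ((∀ a, 0 ≤ ν (u * x i a)) ∧ ∃ a, ν (u * x i a) = 0) ∧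
      (i ∈ Set.range s → u = 1) := by
    intro i
    by_cases hi : i ∈ Set.range s
    · refine ⟨1, one_ne_zero, ?_, fun _ => rfl⟩
      simp only [one_mul]
      obtain ⟨k, rfl⟩ := hi
      induction k using Fin.lastCases with
      | last => rw [h4]; exact ⟨fun a => by simp, 0, ν.map_one⟩
      | cast k =>
        rw [hs]
        refine ⟨fun a => ?_, k, by simp⟩
        by_cases hak : a = k
        · subst hak; simp
        · simp [hak]
    · obtain ⟨u, h1, h2⟩ := exists_primitive ν (hx.ne_zero i)
      exact ⟨u, h1, h2, fun h => absurd h hi⟩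
  choose u hu hup hus using hp
  obtain ⟨π, hπ⟩ := exists_perm_apply_eq (Fin.castLEEmb (by norm_num : 5 ≤ 8)) s
  have hy : ∀ k : Fin 5, u (π (Fin.castLE (by norm_num) k)) •
      x (π (Fin.castLE (by norm_num) k)) = x (s k) := fun k => by
    have : π (Fin.castLE (by norm_num) k) = s k := hπ k
    rw [this, hus _ ⟨k, rfl⟩, one_smul]
  refine ⟨π, _, hx.smul hu, hup, standardFrame_iff.2 fun a => ?_, fun a => ?_⟩
  · exact (hy a.castSucc).trans (hs a)
  · exact congrFun ((hy (Fin.last 4)).trans h4) a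

/-- A normalised octad with the shape of a block has the valuation data of one of the blocks of this
shape. -/
lemma HasShape.exists_hasValuationData {O : Octad L} {z : Fin 8 → Fin 4 → L} (hz : IsLift z O)
    (hr : IsRegular z) (hO : IsNormalised O) {m : ℚ} (hm : 0 < m) {t : Shape}
    {σ : Equiv.Perm (Fin 8)} (h : HasShape ν z m t σ) :
    ∃ (b : BlockType) (c : ℕ) (r : Equiv.Perm (Fin 8)), b.shape = t ∧ IsCode c r ∧
      samePicture (t.picture.map fun l => l.map (permMask c)) t.picture = true ∧
      HasValuationData ν O (m • (Block.mk b (σ * r⁻¹)).valData) := by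
  obtain ⟨π, y, hy, hprim, hf, h4⟩ := hO.exists_lift ν
  obtain ⟨d, hd, hdy⟩ := hz.exists_smul hy
  obtain rfl : y = fun i => d i • z i := funext hdy
  have hg : GeneralPosition fun i => d i • z i := by
    simpa using hr.general.smul_mulVec (M := 1) (by simp) hd
  set F : Finset (Fin 8) := fullFrame.image π with hF
  obtain ⟨b, c, r, rfl, hrc, hW, hpic, hz1, hz2⟩ := t.exists_frame (F := F.image σ.symm) (by
    rw [card_image_perm, hF, card_image_perm]; rfl)
  refine ⟨b, c, r, rfl, hrc, hpic, ?_⟩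
  obtain ⟨e, hw, hk⟩ := h
  obtain ⟨g, hgo⟩ := b.exists_offset
  let V : Finset (Fin 8) → ℚ := fun S => (blockValue b (mask ((S.image σ.symm).image r)) : ℚ)
  -- `γ` is the discrepancy in scale between the primitive lift and the block. The rest of the proof
  -- shows that it vanishes.
  set γ : Fin 8 → ℚ := fun i => nu ν (d i) + e / 4 - m / 8 * g (r (σ.symm i)) with hγ
  have hV : ∀ S : Finset (Fin 8), S.card = 4 →
      minorNu ν (fun i => d i • z i) S = m * V S + ∑ i ∈ S, γ i := by
    intro S hS
    have h1 := hgo ⟨(S.image σ.symm).image r, by rw [card_image_perm, card_image_perm, hS]⟩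
    have h2 : ∑ i ∈ (S.image σ.symm).image r, g i = ∑ i ∈ S, g (r (σ.symm i)) := by
      rw [Finset.sum_image fun _ _ _ _ h => r.injective h, sum_image_symm]
    have h3 : ∑ i ∈ S, γ i = ∑ i ∈ S, nu ν (d i) + e - m / 8 * ∑ i ∈ S, g (r (σ.symm i)) := by
      rw [hγ, Finset.sum_sub_distrib, Finset.sum_add_distrib, Finset.sum_const, hS, Finset.mul_sum,
        nsmul_eq_mul]
      push_cast
      ring
    rw [b.valData_fst, hW _ (by rw [card_image_perm, hS]), h2] at h1
    rw [minorNu_smul_of_general hr.general hd hS, hw S hS, h3]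
    linear_combination -(m / 8) * h1
  have hV1 : ∀ i ∈ F, V (F.erase i) = 0 := fun i hi => by
    have := hz1 (σ.symm i) (Finset.mem_image_of_mem _ hi)
    rw [← Finset.image_erase σ.symm.injective] at this
    exact (congrArg Nat.cast this).trans Nat.cast_zero
  have hV2 : ∀ j ∉ F, ∃ f ∈ F, ∃ f' ∈ F, f ≠ f' ∧ V (insert j ((F.erase f).erase f')) = 0 := by
    intro j hj
    obtain ⟨f, hf, f', hf', hff, h0⟩ := hz2 (σ.symm j) (fun h => by
      obtain ⟨i, hi, hij⟩ := Finset.mem_image.1 h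
      exact hj (σ.symm.injective hij ▸ hi))
    obtain ⟨f, hfF, rfl⟩ := Finset.mem_image.1 hf
    obtain ⟨f', hfF', rfl⟩ := Finset.mem_image.1 hf'
    refine ⟨f, hfF, f', hfF', fun h => hff.ne (by rw [h]), ?_⟩
    rw [← Finset.image_erase σ.symm.injective, ← Finset.image_erase σ.symm.injective,
      ← Finset.image_insert] at h0
    exact (congrArg Nat.cast h0).trans Nat.cast_zero
  have hcardF : F.card = 5 := by rw [hF, card_image_perm]; rfl
  have hexch : ∀ a j, minorNu ν (fun i => d i • z i) ((exch a j).image π) =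
      nu ν ((d (π (Fin.natAdd 4 j)) • z (π (Fin.natAdd 4 j))) a) := fun a j => by
    rw [← minorNu_comp _ π (exch_card a j), ← hf.nu_coord]
    rfl
  -- All minors of the standard projective frame are `±1`.
  have hfr : ∀ i ∈ F, minorNu ν (fun i => d i • z i) (F.erase i) = 0 := by
    intro i hi
    obtain ⟨k, hk, rfl⟩ := Finset.mem_image.1 hi
    rw [hF, ← Finset.image_erase π.injective]
    obtain rfl | ⟨a, rfl⟩ : k = 4 ∨ ∃ a : Fin 4, k = Fin.castAdd 4 a := by
      clear hi
      revert k; decide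
    · rw [show fullFrame.erase 4 = frameSet by decide, ← minorNu_comp _ π (by decide)]
      exact hf.minorNu_frameSet
    · rw [show fullFrame.erase (Fin.castAdd 4 a) = exch a 0 by clear hi hk; revert a; decide,
        hexch]
      exact (congrArg (nu ν) (h4 a)).trans nu_one
  have hγF : ∀ i ∈ F, γ i = 0 := by
    -- The sum of `γ` over any four of the five labels vanishes, so every value equals the total;
    -- the total is then five times itself.
    have h1 : ∀ i ∈ F, γ i = ∑ l ∈ F, γ l := fun i hi => by
      have h2 := hV _ (by rw [Finset.card_erase_of_mem hi, hcardF] : (F.erase i).card = 4)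
      rw [hfr i hi, hV1 i hi] at h2
      have h3 : ∑ l ∈ F.erase i, γ l + γ i = _ := Finset.sum_erase_add _ _ hi
      linarith
    have h2 : ∑ l ∈ F, γ l = 5 * ∑ l ∈ F, γ l := by
      conv_lhs => rw [Finset.sum_congr rfl h1, Finset.sum_const, hcardF, nsmul_eq_mul]
      norm_num
    exact fun i hi => (h1 i hi).trans (by linarith)
  have hγ0 : ∀ i, γ i = 0 := by
    intro j
    by_cases hj : j ∈ F
    · exact hγF j hj
    have hsum : ∀ T ⊆ F, ∑ i ∈ insert j T, γ i = γ j := fun T hT => by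
      rw [Finset.sum_insert fun h => hj (hT h), Finset.sum_eq_zero fun i hi => hγF i (hT hi),
        add_zero]
    -- At a quadruple where the block vanishes, `γ j` is the valuation of an integral minor.
    have hge : 0 ≤ γ j := by
      obtain ⟨f, hf, f', hf', hne, h0⟩ := hV2 j hj
      have hcard : (insert j ((F.erase f).erase f')).card = 4 := by
        rw [Finset.card_insert_of_notMem fun h =>
          hj (Finset.mem_of_mem_erase (Finset.mem_of_mem_erase h)),
          Finset.card_erase_of_mem (Finset.mem_erase.2 ⟨hne.symm, hf'⟩),
          Finset.card_erase_of_mem hf, hcardF]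
      have h1 := hV _ hcard
      rw [h0, mul_zero, zero_add,
        hsum _ ((Finset.erase_subset _ _).trans (Finset.erase_subset _ _))] at h1
      rw [← h1]
      exact minorNu_nonneg hg (fun i => (hprim i).1) hcard
    -- A coordinate of valuation 0 is a minor that equals a nonnegative block value plus `γ j`.
    have hle : γ j ≤ 0 := by
      obtain ⟨a, ha⟩ := (hprim j).2
      obtain ⟨k, rfl⟩ := π.surjective j
      obtain ⟨k, rfl⟩ : ∃ l : Fin 4, k = Fin.natAdd 4 l := by
        have : k ∉ fullFrame := fun h => hj (Finset.mem_image_of_mem π h)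
        clear hsum hge ha hj
        revert k; decide
      have h1 := hV ((exch a k).image π) (by rw [card_image_perm, exch_card])
      have h2 : (exch a k).image π = insert (π (Fin.natAdd 4 k))
          ((frameSet.erase (Fin.castAdd 4 a)).image π) := Finset.image_insert _ _ _
      have h3 : (frameSet.erase (Fin.castAdd 4 a)).image π ⊆ F :=
        Finset.image_subset_image ((Finset.erase_subset _ _).trans (by decide))
      have h4 : nu ν ((d (π (Fin.natAdd 4 k)) • z (π (Fin.natAdd 4 k))) a) = 0 :=
        (nu_eq_iff.1 (ha.trans WithTop.coe_zero.symm)).2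
      rw [hexch, h4, h2, hsum _ h3] at h1
      have h5 : 0 ≤ m * V (insert (π (Fin.natAdd 4 k))
          ((frameSet.erase (Fin.castAdd 4 a)).image π)) := mul_nonneg hm.le (Nat.cast_nonneg _)
      linarith
    exact le_antisymm hle hge
  refine ⟨_, hy, hprim, nu_plucker_iff.2 ⟨hg, fun S => ?_⟩, ?_⟩
  · rw [hV S.1 S.2, Finset.sum_eq_zero fun i _ => hγ0 i, add_zero]
    have h1 := (Block.mk b (σ * r⁻¹)).valData_apply S
      (T := ⟨(S.1.image σ.symm).image r, by rw [card_image_perm, card_image_perm, S.2]⟩)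
      (Finset.image_image (s := S.1) (f := σ.symm) (g := r))
    rw [b.valData_fst] at h1
    rw [show (m • (Block.mk b (σ * r⁻¹)).valData).1 S = m * (Block.mk b (σ * r⁻¹)).valData.1 S
      from rfl, h1]
  · rw [hr.isTwistedCubicIndex_iff hd, show (m • (Block.mk b (σ * r⁻¹)).valData).2 =
      m * b.valData.2 from rfl, b.valData_snd]
    exact (b.shape.cubic_bound hm hw).2 hk

end NormalForm

/-! ### The space `E3`, its action maps and the pictures, computed with masks. -/

section E3Classes

lemma exists_cls (x : E3) : ∃ (T : Finset (Fin 8)) (h : Even T.card), x = cls T h := by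
  obtain ⟨⟨f, hf⟩, rfl⟩ := Submodule.Quotient.mk_surjective _ x
  have hT : f = fun i => if i ∈ Finset.univ.filter (fun i => f i = 1) then 1 else 0 := by
    funext i
    have : ∀ a : ZMod 2, a = if a = 1 then 1 else 0 := by decide
    simpa using this (f i)
  refine ⟨Finset.univ.filter (fun i => f i = 1), ?_, ?_⟩
  · rw [mem_evenSubsets] at hf
    rw [hT, Finset.sum_boole, Finset.filter_univ_mem] at hf
    exact (ZMod.natCast_eq_zero_iff_even).1 hf
  · unfold cls
    congr 1
    exact Subtype.ext hT

lemma cls_congr {T T' : Finset (Fin 8)} (h : T = T') (hT : Even T.card) :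
    cls T hT = cls T' (h ▸ hT) := by subst h; rfl

lemma even_symmDiff {S T : Finset (Fin 8)} (hS : Even S.card) (hT : Even T.card) :
    Even (symmDiff S T).card := by
  have h1 : (symmDiff S T).card + 2 * (S ∩ T).card = S.card + T.card := by
    have h2 : (symmDiff S T).card = (S \ T).card + (T \ S).card := by
      rw [symmDiff_def]
      exact Finset.card_union_of_disjoint (by
        rw [Finset.disjoint_left]
        intro a ha hb
        exact (Finset.mem_sdiff.1 ha).2 (Finset.mem_sdiff.1 hb).1)
    have h3 := Finset.card_sdiff_add_card_inter S T
    have h4 := Finset.card_sdiff_add_card_inter T S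
    rw [Finset.inter_comm T S] at h4
    omega
  have h2 : Even (S.card + T.card) := hS.add hT
  rw [← h1] at h2
  exact (Nat.even_add.1 h2).2 (even_two_mul _)

lemma cls_add {S T : Finset (Fin 8)} (hS : Even S.card) (hT : Even T.card) :
    cls S hS + cls T hT = cls (symmDiff S T) (even_symmDiff hS hT) := by
  unfold cls
  rw [← Submodule.Quotient.mk_add]
  congr 1
  ext i
  by_cases h1 : i ∈ S <;> by_cases h2 : i ∈ T <;> simp [h1, h2, Finset.mem_symmDiff]
  exact CharTwo.add_self_eq_zero _

lemma cls_empty (h : Even (∅ : Finset (Fin 8)).card) : cls ∅ h = 0 := by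
  unfold cls
  rw [Submodule.Quotient.mk_eq_zero]
  convert Submodule.zero_mem _ using 1
  ext i
  simp

lemma even_compl {T : Finset (Fin 8)} (hT : Even T.card) : Even Tᶜ.card := by
  have := Finset.card_add_card_compl T
  rw [Fintype.card_fin] at this
  have h8 : Even (T.card + Tᶜ.card) := by rw [this]; decide
  exact (Nat.even_add.1 h8).1 hT

lemma cls_compl {T : Finset (Fin 8)} (hT : Even T.card) : cls Tᶜ (even_compl hT) = cls T hT := by
  unfold cls
  rw [Submodule.Quotient.eq, Submodule.mem_span_singleton]
  refine ⟨1, ?_⟩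
  ext i
  by_cases h1 : i ∈ T <;> simp [h1, fullSet]

lemma even_image (r : Equiv.Perm (Fin 8)) {T : Finset (Fin 8)} (hT : Even T.card) :
    Even (T.image r).card := by rwa [card_image_perm]

lemma permE3_cls (r : Equiv.Perm (Fin 8)) {T : Finset (Fin 8)} (hT : Even T.card) :
    permE3 r (cls T hT) = cls (T.image r) (even_image r hT) := by
  unfold permE3 cls
  rw [Submodule.mapQ_apply]
  congr 1
  ext i
  have : r.symm i ∈ T ↔ i ∈ T.image r := by
    obtain ⟨j, rfl⟩ := r.surjective i
    simp
  simp only [LinearMap.coe_restrict_apply, LinearMap.funLeft_apply, this]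

lemma pairing_cls {S T : Finset (Fin 8)} (hS : Even S.card) (hT : Even T.card) :
    pairing (cls S hS) (cls T hT) = ((S ∩ T).card : ZMod 2) := by
  have : pairing (cls S hS) (cls T hT) =
      ∑ i, (if i ∈ S then (1 : ZMod 2) else 0) * (if i ∈ T then 1 else 0) := rfl
  rw [this]
  simp only [mul_ite, mul_one, mul_zero, Finset.sum_ite_mem, Finset.univ_inter]
  rw [Finset.sum_const, nsmul_one, Finset.inter_comm]

lemma transvection_cls {S T : Finset (Fin 8)} (hS : Even S.card) (hT : Even T.card) :
    transvection (cls S hS) (cls T hT) = cls T hT + ((T ∩ S).card : ZMod 2) • cls S hS := by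
  rw [← pairing_cls hT hS]; rfl

/-- The class of the set with a given mask. -/
def clsMask (n : ℕ) : E3 :=
  if h : Even (Finset.univ.filter fun i : Fin 8 => n.testBit i).card then cls _ h else 0

lemma clsMask_mask {T : Finset (Fin 8)} (hT : Even T.card) : clsMask (mask T) = cls T hT := by
  have h : (Finset.univ.filter fun i : Fin 8 => (mask T).testBit i) = T := by
    ext i
    simp [testBit_mask]
  unfold clsMask
  rw [dif_pos (by rwa [h])]
  exact cls_congr h _

/-- The mask of an even set. -/
def IsEvenMask (n : ℕ) : Prop := ∃ T : Finset (Fin 8), Even T.card ∧ mask T = n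

lemma isEvenMask_iff {n : ℕ} : IsEvenMask n ↔ n < 256 ∧ bitCount n % 2 = 0 := by
  constructor
  · rintro ⟨T, hT, rfl⟩
    exact ⟨mask_lt T, by rw [bitCount_mask]; exact Nat.even_iff.1 hT⟩
  · rintro ⟨h1, h2⟩
    obtain ⟨T, rfl⟩ := mask_surjective h1
    rw [bitCount_mask] at h2
    exact ⟨T, Nat.even_iff.2 h2, rfl⟩

lemma clsMask_zero : clsMask 0 = 0 := by
  rw [show 0 = mask ∅ from rfl, clsMask_mask (T := ∅) (by simp)]
  exact cls_empty _

lemma clsMask_xor {m n : ℕ} (hm : IsEvenMask m) (hn : IsEvenMask n) :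
    clsMask (m ^^^ n) = clsMask m + clsMask n := by
  obtain ⟨S, hS, rfl⟩ := hm
  obtain ⟨T, hT, rfl⟩ := hn
  rw [← mask_symmDiff, clsMask_mask (even_symmDiff hS hT), clsMask_mask hS, clsMask_mask hT,
    cls_add]

lemma IsEvenMask.xor {m n : ℕ} (hm : IsEvenMask m) (hn : IsEvenMask n) : IsEvenMask (m ^^^ n) := by
  obtain ⟨S, hS, rfl⟩ := hm
  obtain ⟨T, hT, rfl⟩ := hn
  exact ⟨_, even_symmDiff hS hT, mask_symmDiff S T⟩

lemma permE3_clsMask {c : ℕ} {r : Equiv.Perm (Fin 8)} (hr : IsCode c r) {n : ℕ}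
    (hn : IsEvenMask n) : permE3 r (clsMask n) = clsMask (permMask c n) := by
  obtain ⟨T, hT, rfl⟩ := hn
  rw [clsMask_mask hT, permE3_cls, ← hr.mask_image, clsMask_mask]

lemma transvectMask_mask (S T : Finset (Fin 8)) : transvectMask (mask S) (mask T) =
    if (T ∩ S).card % 2 = 1 then mask (symmDiff T S) else mask T := by
  rw [transvectMask, meet_mask, mask_symmDiff]

lemma IsEvenMask.transvect {n : ℕ} (hn : IsEvenMask n) {S : Finset (Fin 8)} (hS : Even S.card) :
    IsEvenMask (transvectMask (mask S) n) := by
  unfold transvectMask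
  split_ifs
  · exact hn.xor ⟨S, hS, rfl⟩
  · exact hn

lemma transvection_clsMask {S : Finset (Fin 8)} (hS : Even S.card) {n : ℕ} (hn : IsEvenMask n) :
    transvection (cls S hS) (clsMask n) = clsMask (transvectMask (mask S) n) := by
  obtain ⟨T, hT, rfl⟩ := hn
  rw [clsMask_mask hT, transvection_cls, transvectMask_mask]
  split_ifs with h
  · rw [clsMask_mask (even_symmDiff hT hS), ← cls_add hT hS,
      ZMod.natCast_eq_one_iff_odd.2 (Nat.odd_iff.2 h), one_smul]
  · rw [clsMask_mask hT, ZMod.natCast_eq_zero_iff_even.2 (Nat.even_iff.2 (by omega)), zero_smul,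
      add_zero]

lemma sameClass.clsMask_eq {m n : ℕ} (h : sameClass m n = true) (hm : IsEvenMask m) :
    clsMask m = clsMask n := by
  rw [sameClass, Bool.or_eq_true, Nat.beq_eq, Nat.beq_eq] at h
  rcases h with rfl | h
  · rfl
  · obtain ⟨T, hT, rfl⟩ := hm
    have : n = mask Tᶜ := by rw [mask_compl]; omega
    rw [this, clsMask_mask hT, clsMask_mask (even_compl hT), cls_compl]

/-! ### Pictures -/

/-- The subset of `E₃` described by a list of masks. -/
def setOfMasks (l : List ℕ) : Set E3 := {x | ∃ n ∈ l, x = clsMask n}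

/-- The set of subsets of `E₃` described by a list of lists of masks. -/
def pictureOfMasks (P : List (List ℕ)) : Set (Set E3) := {X | ∃ l ∈ P, X = setOfMasks l}

/-- The action of a map on sets of subsets. -/
def mapPicture (f : E3 → E3) (P : Set (Set E3)) : Set (Set E3) := (fun X => f '' X) '' P

lemma mapPicture_comp (f g : E3 → E3) (P : Set (Set E3)) :
    mapPicture f (mapPicture g P) = mapPicture (f ∘ g) P := by
  unfold mapPicture
  rw [Set.image_image]
  simp only [Set.image_image]
  rfl

/-- It suffices that `h` computes `f` on the listed masks; elsewhere no relation is needed. -/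
lemma mapPicture_masks {f : E3 → E3} {h : ℕ → ℕ} {P : List (List ℕ)}
    (hf : ∀ l ∈ P, ∀ n ∈ l, f (clsMask n) = clsMask (h n)) :
    mapPicture f (pictureOfMasks P) = pictureOfMasks (P.map fun l => l.map h) := by
  have key : ∀ l ∈ P, f '' setOfMasks l = setOfMasks (l.map h) := by
    intro l hl
    ext x
    constructor
    · rintro ⟨_, ⟨n, hn, rfl⟩, rfl⟩
      exact ⟨h n, List.mem_map_of_mem hn, hf l hl n hn⟩
    · rintro ⟨_, hn, rfl⟩
      obtain ⟨n, hn', rfl⟩ := List.mem_map.1 hn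
      exact ⟨_, ⟨n, hn', rfl⟩, hf l hl n hn'⟩
  ext X
  constructor
  · rintro ⟨_, ⟨l, hl, rfl⟩, rfl⟩
    exact ⟨_, List.mem_map_of_mem hl, key l hl⟩
  · rintro ⟨_, hl, rfl⟩
    obtain ⟨l, hl', rfl⟩ := List.mem_map.1 hl
    exact ⟨_, ⟨l, hl', rfl⟩, key l hl'⟩

lemma sameSet.setOfMasks_eq {l l' : List ℕ} (h : sameSet l l' = true)
    (hl : ∀ n ∈ l, IsEvenMask n) : setOfMasks l = setOfMasks l' := by
  rw [sameSet, Bool.and_eq_true, List.all_eq_true, List.all_eq_true] at h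
  ext x
  constructor
  · rintro ⟨m, hm, rfl⟩
    obtain ⟨n, hn, hmn⟩ := List.any_eq_true.1 (h.1 m hm)
    exact ⟨n, hn, sameClass.clsMask_eq hmn (hl m hm)⟩
  · rintro ⟨n, hn, rfl⟩
    obtain ⟨m, hm, hmn⟩ := List.any_eq_true.1 (h.2 n hn)
    exact ⟨m, hm, (sameClass.clsMask_eq hmn (hl m hm)).symm⟩

lemma samePicture.pictureOfMasks_eq {P P' : List (List ℕ)} (h : samePicture P P' = true)
    (hP : ∀ l ∈ P, ∀ n ∈ l, IsEvenMask n) : pictureOfMasks P = pictureOfMasks P' := by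
  rw [samePicture, Bool.and_eq_true, List.all_eq_true, List.all_eq_true] at h
  ext X
  constructor
  · rintro ⟨l, hl, rfl⟩
    obtain ⟨l', hl', hll⟩ := List.any_eq_true.1 (h.1 l hl)
    exact ⟨l', hl', sameSet.setOfMasks_eq hll (hP l hl)⟩
  · rintro ⟨l', hl', rfl⟩
    obtain ⟨l, hl, hll⟩ := List.any_eq_true.1 (h.2 l' hl')
    exact ⟨l, hl, (sameSet.setOfMasks_eq hll (hP l hl)).symm⟩

lemma Shape.isEvenMask_of_mem_picture {t : Shape} : ∀ l ∈ t.picture, ∀ n ∈ l, IsEvenMask n := by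
  intro l hl n hn
  have := List.all_eq_true.1 (List.all_eq_true.1 t.picture_even l hl) n hn
  rw [Bool.and_eq_true, Nat.beq_eq] at this
  exact isEvenMask_iff.2 ⟨by simpa [Nat.blt] using this.1, this.2⟩

lemma IsCode.isEvenMask {c : ℕ} {r : Equiv.Perm (Fin 8)} (hr : IsCode c r) {n : ℕ}
    (hn : IsEvenMask n) : IsEvenMask (permMask c n) := by
  obtain ⟨T, hT, rfl⟩ := hn
  exact ⟨T.image r, even_image r hT, hr.mask_image T⟩

/-- A relabelling that preserves the picture of a shape according to the mask check. -/
lemma Shape.mapPicture_of_samePicture {t : Shape} {c : ℕ} {r : Equiv.Perm (Fin 8)}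
    (hr : IsCode c r) (h : samePicture (t.picture.map fun l => l.map (permMask c)) t.picture = true) :
    mapPicture (permE3 r) (pictureOfMasks t.picture) = pictureOfMasks t.picture := by
  have he := t.isEvenMask_of_mem_picture
  rw [mapPicture_masks fun l hl n hn => permE3_clsMask hr (he l hl n hn)]
  refine samePicture.pictureOfMasks_eq h fun l hl n hn => ?_
  obtain ⟨l, hl', rfl⟩ := List.mem_map.1 hl
  obtain ⟨n, hn', rfl⟩ := List.mem_map.1 hn
  exact hr.isEvenMask (he l hl' n hn')

lemma Shape.mapPicture_transvection {t t' : Shape} {c : ℕ} {r : Equiv.Perm (Fin 8)}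
    (hr : IsCode c r) {S : Finset (Fin 8)} (hS : Even S.card)
    (h : samePicture (t.picture.map fun l => l.map fun n => permMask c (transvectMask (mask S) n))
      t'.picture = true) :
    mapPicture (permE3 r ∘ transvection (cls S hS)) (pictureOfMasks t.picture) =
      pictureOfMasks t'.picture := by
  have he := t.isEvenMask_of_mem_picture
  rw [mapPicture_masks (h := fun n => permMask c (transvectMask (mask S) n)) fun l hl n hn => by
    rw [Function.comp_apply, transvection_clsMask hS (he l hl n hn),
      permE3_clsMask hr ((he l hl n hn).transvect hS)]]
  refine samePicture.pictureOfMasks_eq h fun l hl n hn => ?_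
  obtain ⟨l, hl', rfl⟩ := List.mem_map.1 hl
  obtain ⟨n, hn', rfl⟩ := List.mem_map.1 hn
  exact hr.isEvenMask ((he l hl' n hn').transvect hS)

/-! ### The pictures of the blocks -/

lemma spanOf_eq {T₁ T₂ T₃ : Finset (Fin 8)} (h₁ : Even T₁.card) (h₂ : Even T₂.card)
    (h₃ : Even T₃.card) : BlockType.spanOf T₁ T₂ T₃ h₁ h₂ h₃ =
      setOfMasks (Shape.spanList (mask T₁) (mask T₂) (mask T₃)) := by
  have e₁ : IsEvenMask (mask T₁) := ⟨_, h₁, rfl⟩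
  have e₂ : IsEvenMask (mask T₂) := ⟨_, h₂, rfl⟩
  have e₃ : IsEvenMask (mask T₃) := ⟨_, h₃, rfl⟩
  ext x
  rw [BlockType.spanOf, SetLike.mem_coe, Submodule.mem_span_triple]
  simp only [setOfMasks, Shape.spanList, Set.mem_ofPred_eq, List.mem_cons, List.not_mem_nil,
    or_false, exists_eq_or_imp, exists_eq_left, clsMask_zero, clsMask_xor e₁ e₂, clsMask_xor e₁ e₃,
    clsMask_xor e₂ e₃, clsMask_xor (e₁.xor e₂) e₃, clsMask_mask h₁, clsMask_mask h₂,
    clsMask_mask h₃]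
  have h01 : ∀ a : ZMod 2, a = 0 ∨ a = 1 := by decide
  constructor
  · rintro ⟨a, b, c, rfl⟩
    rcases h01 a with rfl | rfl <;> rcases h01 b with rfl | rfl <;> rcases h01 c with rfl | rfl <;>
      simp
  · rintro (rfl | rfl | rfl | rfl | rfl | rfl | rfl | rfl)
    · exact ⟨0, 0, 0, by simp⟩
    · exact ⟨1, 0, 0, by simp⟩
    · exact ⟨0, 1, 0, by simp⟩
    · exact ⟨1, 1, 0, by simp⟩
    · exact ⟨0, 0, 1, by simp⟩
    · exact ⟨1, 0, 1, by simp⟩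
    · exact ⟨0, 1, 1, by simp⟩
    · exact ⟨1, 1, 1, by simp⟩

lemma tcuSubset_eq : BlockType.tcuSubset =
    setOfMasks ((List.range 256).filter fun n => n == 0 || bitCount n == 2) := by
  ext x
  simp only [BlockType.tcuSubset, setOfMasks, Set.mem_ofPred_eq, List.mem_filter, List.mem_range,
    Bool.or_eq_true, beq_iff_eq]
  constructor
  · rintro (rfl | ⟨T, hT, h2, rfl⟩)
    · exact ⟨0, ⟨by norm_num, Or.inl rfl⟩, clsMask_zero.symm⟩
    · exact ⟨mask T, ⟨mask_lt T, Or.inr ((bitCount_mask T).trans h2)⟩, (clsMask_mask hT).symm⟩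
  · rintro ⟨n, ⟨hn, rfl | h2⟩, rfl⟩
    · exact Or.inl clsMask_zero
    · obtain ⟨T, rfl⟩ := mask_surjective hn
      rw [bitCount_mask] at h2
      have hT : Even T.card := by rw [h2]; decide
      exact Or.inr ⟨T, hT, h2, clsMask_mask hT⟩

lemma lineSubset_eq : BlockType.lineSubset = setOfMasks ((List.range 256).filter fun n =>
    n == 0 || meet n 15 == meet n 240 + 2 || meet n 240 == meet n 15 + 2) := by
  have m1 : ∀ T, meet (mask T) 15 = (T ∩ {0, 1, 2, 3}).card := fun T => by
    rw [← meet_mask, show mask {0, 1, 2, 3} = 15 by decide +kernel]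
  have m2 : ∀ T, meet (mask T) 240 = (T ∩ {4, 5, 6, 7}).card := fun T => by
    rw [← meet_mask, show mask {4, 5, 6, 7} = 240 by decide +kernel]
  have hu : ∀ T : Finset (Fin 8), T ∩ {0, 1, 2, 3} ∪ T ∩ {4, 5, 6, 7} = T := fun T => by
    rw [← Finset.inter_union_distrib_left, show ({0, 1, 2, 3} ∪ {4, 5, 6, 7} : Finset (Fin 8)) =
      Finset.univ by decide, Finset.inter_univ]
  have hd : Disjoint ({0, 1, 2, 3} : Finset (Fin 8)) {4, 5, 6, 7} := by decide
  ext x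
  simp only [BlockType.lineSubset, setOfMasks, Set.mem_ofPred_eq, List.mem_filter, List.mem_range,
    Bool.or_eq_true, beq_iff_eq, or_assoc]
  constructor
  · rintro (rfl | ⟨S, T, h, hS, hT, hST, rfl⟩)
    · exact ⟨0, ⟨by norm_num, Or.inl rfl⟩, clsMask_zero.symm⟩
    · refine ⟨mask (S ∪ T), ⟨mask_lt _, Or.inr ?_⟩, (clsMask_mask h).symm⟩
      have h1 : (S ∪ T) ∩ {0, 1, 2, 3} = S := by
        rw [Finset.union_inter_distrib_right, Finset.inter_eq_left.2 hS,
          Finset.disjoint_iff_inter_eq_empty.1 (hd.symm.mono_left hT), Finset.union_empty]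
      have h2 : (S ∪ T) ∩ {4, 5, 6, 7} = T := by
        rw [Finset.union_inter_distrib_right, Finset.inter_eq_left.2 hT,
          Finset.disjoint_iff_inter_eq_empty.1 (hd.mono_left hS), Finset.empty_union]
      rw [m1, m2, h1, h2]
      exact hST
  · rintro ⟨n, ⟨hn, rfl | h⟩, rfl⟩
    · exact Or.inl clsMask_zero
    · obtain ⟨U, rfl⟩ := mask_surjective hn
      rw [m1, m2] at h
      have hc : U.card = (U ∩ {0, 1, 2, 3}).card + (U ∩ {4, 5, 6, 7}).card := by
        rw [← Finset.card_union_of_disjoint (hd.mono Finset.inter_subset_right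
          Finset.inter_subset_right), hu]
      have hU : Even U.card := by
        rw [Nat.even_iff]; omega
      refine Or.inr ⟨_, _, by rwa [hu], Finset.inter_subset_right, Finset.inter_subset_right, h, ?_⟩
      rw [clsMask_mask hU]
      exact cls_congr (hu U).symm _

lemma BlockType.picture_eq (b : BlockType) : b.picture = pictureOfMasks b.shape.picture := by
  have h1 : ∀ l, ({setOfMasks l} : Set (Set E3)) = pictureOfMasks [l] := fun l => by
    ext X; simp [pictureOfMasks]
  have h2 : ∀ l l', ({setOfMasks l, setOfMasks l'} : Set (Set E3)) = pictureOfMasks [l, l'] :=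
    fun l l' => by ext X; simp [pictureOfMasks]
  cases b <;> simp only [BlockType.picture, spanOf_eq, tcuSubset_eq, lineSubset_eq] <;>
    first | exact h2 _ _ | exact h1 _

lemma Block.picture_eq (B : Block) :
    B.picture = mapPicture (permE3 B.labelling) (pictureOfMasks B.type.shape.picture) := by
  rw [← B.type.picture_eq]; rfl

end E3Classes

/-! ### Decomposition of symplectic maps into a relabelling and at most one transvection. -/

section Symplectic

lemma cls_eq_cls_iff {S T : Finset (Fin 8)} (hS : Even S.card) (hT : Even T.card) :
    cls S hS = cls T hT ↔ S = T ∨ S = Tᶜ := by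
  constructor
  · intro h
    unfold cls at h
    rw [Submodule.Quotient.eq, Submodule.mem_span_singleton] at h
    obtain ⟨a, ha⟩ := h
    have h1 : ∀ i, a = (if i ∈ S then 1 else 0) - if i ∈ T then 1 else 0 := fun i => by
      have := congrFun (congrArg Subtype.val ha) i
      simpa [fullSet] using this
    have h01 : a = 0 ∨ a = 1 := by
      clear * -; revert a; decide
    rcases h01 with rfl | rfl
    · left
      ext i
      have := h1 i
      by_cases h2 : i ∈ S <;> by_cases h3 : i ∈ T <;> simp [h2, h3] at this ⊢
    · right
      ext i
      have := h1 i
      by_cases h2 : i ∈ S <;> by_cases h3 : i ∈ T <;> simp [h2, h3] at this ⊢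
  · rintro (rfl | rfl)
    · rfl
    · exact cls_compl hT

lemma pairing_comm (x y : E3) : pairing x y = pairing y x := by
  obtain ⟨S, hS, rfl⟩ := exists_cls x
  obtain ⟨T, hT, rfl⟩ := exists_cls y
  rw [pairing_cls, pairing_cls, Finset.inter_comm]

lemma pairing_self (x : E3) : pairing x x = 0 := by
  obtain ⟨S, hS, rfl⟩ := exists_cls x
  rw [pairing_cls, Finset.inter_self]
  exact ZMod.natCast_eq_zero_iff_even.2 hS

lemma even_pair {i j : Fin 8} (h : i ≠ j) : Even ({i, j} : Finset (Fin 8)).card := by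
  rw [Finset.card_pair h]; decide

/-- Pairing with the class of `{i, j}` detects whether exactly one of the two labels lies in the
set. A set orthogonal to all pairs is empty or full. -/
lemma eq_zero_of_pairing_eq_zero {u : E3} (h : ∀ x, pairing x u = 0) : u = 0 := by
  obtain ⟨T, hT, rfl⟩ := exists_cls u
  have h1 : ∀ i j, i ∈ T → j ∈ T := fun i j hi => by
    by_contra hj
    have hij : i ≠ j := fun e => hj (e ▸ hi)
    have := h (cls {i, j} (even_pair hij))
    rw [pairing_cls, Finset.insert_inter_of_mem hi, Finset.singleton_inter_of_notMem hj] at this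
    simp at this
  rcases T.eq_empty_or_nonempty with rfl | ⟨i, hi⟩
  · exact cls_empty _
  · have : T = (∅ : Finset (Fin 8))ᶜ := by
      ext j
      simpa using h1 i j hi
    exact ((cls_eq_cls_iff hT (by simp)).2 (Or.inr this)).trans (cls_empty (by simp))

/-- Additive maps to `𝔽₂` are linear, and a nondegenerate pairing identifies the space with its dual
by comparison of dimensions. -/
lemma exists_pairing_eq (f : E3 →+ ZMod 2) : ∃ u, ∀ x, f x = pairing x u := by
  have : FiniteDimensional (ZMod 2) E3 := inferInstance
  have hinj : Function.Injective pairing.flip := by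
    rw [← LinearMap.ker_eq_bot, LinearMap.ker_eq_bot']
    intro u hu
    exact eq_zero_of_pairing_eq_zero fun x => LinearMap.congr_fun hu x
  have hsurj := (LinearMap.injective_iff_surjective_of_finrank_eq_finrank
    (Subspace.dual_finrank_eq (K := ZMod 2) (V := E3)).symm).1 hinj
  obtain ⟨u, hu⟩ := hsurj (f.toZModLinearMap 2)
  exact ⟨u, fun x => (LinearMap.congr_fun hu x).symm⟩

/-- The quadratic form `|T| / 2 mod 2` on `E₃`. -/
def quadForm (x : E3) : ZMod 2 := ((exists_cls x).choose.card / 2 : ℕ)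

/-- The chosen representative is the set or its complement, and `4 - |T| / 2` has the parity of `|T|
/ 2`. -/
lemma quadForm_cls {T : Finset (Fin 8)} (hT : Even T.card) :
    quadForm (cls T hT) = (T.card / 2 : ℕ) := by
  obtain ⟨h1, h2⟩ := (exists_cls (cls T hT)).choose_spec
  unfold quadForm
  generalize (exists_cls (cls T hT)).choose = S at *
  rcases (cls_eq_cls_iff hT h1).1 h2 with rfl | rfl
  · rfl
  · rw [Finset.card_compl, Fintype.card_fin, ZMod.natCast_eq_natCast_iff']
    have := S.card_le_univ
    rw [Fintype.card_fin] at this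
    obtain ⟨k, hk⟩ := h1
    omega

/-- Half the cardinality of a symmetric difference is the sum of the halves minus the cardinality of
the intersection; modulo 2 the sign is irrelevant. -/
lemma quadForm_add (x y : E3) : quadForm (x + y) = quadForm x + quadForm y + pairing x y := by
  obtain ⟨S, hS, rfl⟩ := exists_cls x
  obtain ⟨T, hT, rfl⟩ := exists_cls y
  rw [cls_add, quadForm_cls, quadForm_cls, quadForm_cls, pairing_cls]
  have h2 : (symmDiff S T).card = (S \ T).card + (T \ S).card := by
    rw [symmDiff_def]
    exact Finset.card_union_of_disjoint disjoint_sdiff_sdiff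
  have h3 := Finset.card_sdiff_add_card_inter S T
  have h4 := Finset.card_sdiff_add_card_inter T S
  rw [Finset.inter_comm T S] at h4
  have h5 : ((symmDiff S T).card / 2 + 2 * (S ∩ T).card : ℕ) =
      S.card / 2 + T.card / 2 + (S ∩ T).card := by
    obtain ⟨k, hk⟩ := hS
    obtain ⟨l, hl⟩ := hT
    omega
  have h6 := congrArg (Nat.cast (R := ZMod 2)) h5
  push_cast at h6
  rw [show (2 : ZMod 2) = 0 from rfl, zero_mul, add_zero] at h6
  exact_mod_cast h6

lemma quadForm_eq_one {x : E3} (h : quadForm x = 1) :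
    ∃ (T : Finset (Fin 8)) (hT : Even T.card), T.card = 2 ∧ x = cls T hT := by
  obtain ⟨T, hT, rfl⟩ := exists_cls x
  rw [quadForm_cls, ZMod.natCast_eq_one_iff_odd, Nat.odd_iff] at h
  have := T.card_le_univ
  rw [Fintype.card_fin] at this
  obtain ⟨k, hk⟩ := hT
  have h26 : T.card = 2 ∨ T.card = 6 := by omega
  rcases h26 with h2 | h6
  · exact ⟨T, _, h2, rfl⟩
  · exact ⟨Tᶜ, even_compl ⟨k, hk⟩, by rw [Finset.card_compl, h6]; rfl, (cls_compl _).symm⟩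

lemma quadForm_eq_zero {x : E3} (h : quadForm x = 0) :
    x = 0 ∨ ∃ (T : Finset (Fin 8)) (hT : T.card = 4), x = cls T (hT ▸ by decide) := by
  obtain ⟨T, hT, rfl⟩ := exists_cls x
  rw [quadForm_cls, ZMod.natCast_eq_zero_iff_even, Nat.even_iff] at h
  have := T.card_le_univ
  rw [Fintype.card_fin] at this
  obtain ⟨k, hk⟩ := hT
  have h048 : T.card = 0 ∨ T.card = 4 ∨ T.card = 8 := by omega
  rcases h048 with h | h | h
  · rw [Finset.card_eq_zero] at h
    subst h
    exact Or.inl (cls_empty _)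
  · exact Or.inr ⟨T, h, rfl⟩
  · left
    have h1 : T = (∅ : Finset (Fin 8))ᶜ := by
      rw [Finset.compl_empty]
      exact Finset.eq_univ_of_card T h
    exact ((cls_eq_cls_iff _ (by simp)).2 (Or.inr h1)).trans (cls_empty (by simp))

lemma quadForm_zero : quadForm 0 = 0 := by
  have := quadForm_add 0 0
  simpa using this

/-- The quadratic form takes the value `0` more often than the value `1`. -/
lemma not_injective_of_quadForm {f : E3 → E3} (hf : Function.Injective f)
    (h : ∀ x, quadForm x = 0 → quadForm (f x) = 1) : False := by
  classical
  -- Requiring label 0 selects one quadruple from each complementary pair. The resulting 35 classes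
  -- with value 0 would embed into the 28 classes of pairs.
  let Z : Finset (Finset (Fin 8)) := (Finset.powersetCard 4 Finset.univ).filter (0 ∈ ·)
  let P : Finset (Finset (Fin 8)) := Finset.powersetCard 2 Finset.univ
  have hZ4 : ∀ T : Z, T.1.card = 4 := fun T =>
    (Finset.mem_powersetCard.1 (Finset.mem_filter.1 T.2).1).2
  have hZe : ∀ T : Z, Even T.1.card := fun T => by rw [hZ4]; decide
  have h1 : ∀ T : Z, ∃ U : P, ∃ hU : Even U.1.card, f (cls T.1 (hZe T)) = cls U.1 hU := fun T => by
    have : quadForm (cls T.1 (hZe T)) = 0 := by rw [quadForm_cls, hZ4]; rfl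
    obtain ⟨U, hU, h2, h3⟩ := quadForm_eq_one (h _ this)
    exact ⟨⟨U, Finset.mem_powersetCard.2 ⟨Finset.subset_univ _, h2⟩⟩, hU, h3⟩
  choose g hg hfg using h1
  have hginj : Function.Injective g := fun T T' e => by
    have h2 : f (cls T.1 (hZe T)) = f (cls T'.1 (hZe T')) := by
      rw [hfg, hfg]
      exact cls_congr (by rw [e]) _
    rcases (cls_eq_cls_iff _ _).1 (hf h2) with h3 | h3
    · exact Subtype.ext h3
    · have h4 := (Finset.mem_filter.1 T.2).2
      rw [h3, Finset.mem_compl] at h4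
      exact absurd (Finset.mem_filter.1 T'.2).2 h4
  have h5 := Fintype.card_le_of_injective g hginj
  rw [Fintype.card_coe, Fintype.card_coe] at h5
  have h6 : Z.card = 35 := by decide +kernel
  have h7 : P.card = 28 := by decide +kernel
  omega

lemma transvection_apply (u x : E3) : transvection u x = x + pairing x u • u := rfl

lemma transvection_transvection (u x : E3) : transvection u (transvection u x) = x := by
  simp only [transvection_apply, map_add, map_smul, pairing_self, zero_smul, add_zero]
  rw [add_assoc, ZModModule.add_self, add_zero]

lemma pairing_transvection (u x y : E3) :
    pairing (transvection u x) (transvection u y) = pairing x y := by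
  simp only [transvection_apply, map_add, map_smul, LinearMap.add_apply, LinearMap.smul_apply,
    pairing_self, mul_zero, add_zero, smul_eq_mul]
  rw [pairing_comm u y]
  linear_combination CharTwo.add_self_eq_zero (pairing x u * pairing y u)

lemma quadForm_transvection {u : E3} (hu : quadForm u = 0) (x : E3) :
    quadForm (transvection u x) = quadForm x + pairing x u := by
  rw [transvection_apply, quadForm_add, map_smul, smul_eq_mul]
  have h01 : ∀ a : ZMod 2, a = 0 ∨ a = 1 := by decide
  rcases h01 (pairing x u) with h | h
  · rw [h, zero_smul, quadForm_zero]; ring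
  · rw [h, one_smul, hu]; ring

/-- A symplectic map preserves the quadratic form, up to a translation. -/
lemma IsSymplectic.exists_quadForm_eq {τ : E3 ≃ₗ[ZMod 2] E3} (hτ : IsSymplectic τ) :
    ∃ u, quadForm u = 0 ∧ ∀ x, quadForm x = quadForm (τ x) + pairing (τ x) u := by
  -- Two quadratic forms with the same polar form differ by an additive map, here represented by
  -- pairing with `u`.
  let f : E3 →+ ZMod 2 := AddMonoidHom.mk' (fun x => quadForm (τ.symm x) + quadForm x) (by
    intro x y
    have h := hτ (τ.symm x) (τ.symm y)
    rw [τ.apply_symm_apply, τ.apply_symm_apply] at h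
    rw [map_add, quadForm_add, quadForm_add, h]
    linear_combination CharTwo.add_self_eq_zero (pairing (τ.symm x) (τ.symm y)))
  obtain ⟨u, hu⟩ := exists_pairing_eq f
  have h1 : ∀ x, quadForm x = quadForm (τ x) + pairing (τ x) u := fun x => by
    have h2 : quadForm (τ.symm (τ x)) + quadForm (τ x) = pairing (τ x) u := hu (τ x)
    rw [τ.symm_apply_apply] at h2
    linear_combination h2 - CharTwo.add_self_eq_zero (quadForm (τ x))
  refine ⟨u, ?_, h1⟩
  have h01 : ∀ a : ZMod 2, a = 0 ∨ a = 1 := by decide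
  refine (h01 _).resolve_right fun hu1 => ?_
  -- If the form took the value 1 at `u`, this injection would add 1 to the form and send all zeros
  -- to nonzeros.
  refine not_injective_of_quadForm (f := fun x => τ.symm (x + u))
    (fun x y h => add_right_cancel (τ.symm.injective h)) fun x hx => ?_
  rw [h1, τ.apply_symm_apply, quadForm_add, hx, hu1, map_add, LinearMap.add_apply, pairing_self]
  linear_combination CharTwo.add_self_eq_zero (pairing x u)

/-- Seven pairs that meet pairwise in one label have a common label. -/
lemma exists_forall_mem_of_card_inter {T : Fin 7 → Finset (Fin 8)} (h2 : ∀ i, (T i).card = 2)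
    (h : ∀ i j, i ≠ j → (T i ∩ T j).card = 1) : ∃ c, ∀ i, c ∈ T i := by
  have hne : ∀ i j, i ≠ j → ∃ a, a ∈ T i ∧ a ∈ T j := fun i j hij => by
    obtain ⟨a, ha⟩ := Finset.card_eq_one.1 (h i j hij)
    exact ⟨a, Finset.mem_inter.1 (ha ▸ Finset.mem_singleton_self a)⟩
  have huniq : ∀ i j, i ≠ j → ∀ a b, a ∈ T i → a ∈ T j → b ∈ T i → b ∈ T j → a = b :=
    fun i j hij a b h1 h2 h3 h4 => Finset.card_le_one.1 (h i j hij).le a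
      (Finset.mem_inter.2 ⟨h1, h2⟩) b (Finset.mem_inter.2 ⟨h3, h4⟩)
  have htwo : ∀ i a b c, a ∈ T i → b ∈ T i → c ∈ T i → a ≠ b → c = a ∨ c = b :=
    fun i a b c ha hb hc hab => by
      have : T i = {a, b} := (Finset.eq_of_subset_of_card_le
        (Finset.insert_subset ha (Finset.singleton_subset_iff.2 hb))
        (by rw [h2, Finset.card_pair hab])).symm
      simpa [this] using hc
  obtain ⟨c, hc0, hc1⟩ := hne 0 1 (by decide)
  refine ⟨c, fun j => ?_⟩
  by_contra hj
  have hj0 : j ≠ 0 := fun e => hj (e ▸ hc0)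
  have hj1 : j ≠ 1 := fun e => hj (e ▸ hc1)
  obtain ⟨a, ha0, haj⟩ := hne 0 j hj0.symm
  obtain ⟨b, hb1, hbj⟩ := hne 1 j hj1.symm
  have hac : a ≠ c := fun e => hj (e ▸ haj)
  have hbc : b ≠ c := fun e => hj (e ▸ hbj)
  have hab : a ≠ b := fun e => hac (huniq 0 1 (by decide) a c ha0 (e ▸ hb1) hc0 hc1)
  -- Without a common label, `T 0`, `T 1` and `T j` are the sides of a triangle. No fourth pair
  -- meets each side in exactly one label.
  obtain ⟨k, hk0, hk1, hkj⟩ : ∃ k : Fin 7, k ≠ 0 ∧ k ≠ 1 ∧ k ≠ j := by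
    clear * -; revert j; decide
  by_cases hck : c ∈ T k
  · obtain ⟨d, hdk, hdj⟩ := hne k j hkj
    rcases htwo j a b d haj hbj hdj hab with rfl | rfl
    · exact hac (huniq 0 k hk0.symm _ _ ha0 hdk hc0 hck)
    · exact hbc (huniq 1 k hk1.symm _ _ hb1 hdk hc1 hck)
  · obtain ⟨a', ha0', hak⟩ := hne 0 k hk0.symm
    obtain ⟨b', hb1', hbk⟩ := hne 1 k hk1.symm
    rcases htwo 0 a c a' ha0 hc0 ha0' hac with rfl | rfl
    · rcases htwo 1 b c b' hb1 hc1 hb1' hbc with rfl | rfl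
      · exact hab (huniq j k hkj.symm _ _ haj hak hbj hbk)
      · exact hck hbk
    · exact hck hak

lemma mk_eq_sum_cls (x : evenSubsets) : (Submodule.Quotient.mk x : E3) =
    ∑ i : Fin 7, x.1 i.succ • cls {0, i.succ} (even_pair (Fin.succ_ne_zero i).symm) := by
  unfold cls
  rw [← Submodule.mkQ_apply]
  simp only [← Submodule.mkQ_apply, ← map_smul]
  rw [← map_sum]
  congr 1
  ext j
  rw [AddSubmonoidClass.coe_finsetSum, Finset.sum_apply]
  simp only [SetLike.val_smul, Pi.smul_apply, smul_eq_mul]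
  refine Fin.cases ?_ (fun j => ?_) j
  · have h := (mem_evenSubsets x.1).1 x.2
    rw [Fin.sum_univ_succ] at h
    simp only [Finset.mem_insert, true_or, if_true, mul_one]
    linear_combination h - CharTwo.add_self_eq_zero (∑ i : Fin 7, x.1 i.succ)
  · simp [Fin.succ_ne_zero]

/-- The classes of the seven pairs through label 0 span the space, by evenness. -/
lemma linearMap_ext {f g : E3 →ₗ[ZMod 2] E3}
    (h : ∀ i : Fin 7, f (cls {0, i.succ} (even_pair (Fin.succ_ne_zero i).symm)) =
      g (cls {0, i.succ} (even_pair (Fin.succ_ne_zero i).symm))) : f = g := by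
  ext1
  ext x
  simp only [LinearMap.comp_apply, Submodule.mkQ_apply, mk_eq_sum_cls, map_sum, map_smul, h]

/-- A linear map that preserves the pairing and the quadratic form is a relabelling. -/
lemma exists_eq_permE3 {f : E3 →ₗ[ZMod 2] E3} (hp : ∀ x y, pairing (f x) (f y) = pairing x y)
    (hq : ∀ x, quadForm (f x) = quadForm x) : ∃ ρ, f = permE3 ρ := by
  have h1 : ∀ i : Fin 7, ∃ (T : Finset (Fin 8)) (hT : Even T.card), T.card = 2 ∧
      f (cls {0, i.succ} (even_pair (Fin.succ_ne_zero i).symm)) = cls T hT := fun i =>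
    quadForm_eq_one (by
      rw [hq, quadForm_cls, Finset.card_pair (Fin.succ_ne_zero i).symm]; rfl)
  choose T hT h2 hfT using h1
  have h3 : ∀ i j, i ≠ j → (T i ∩ T j).card = 1 := fun i j hij => by
    have h4 := hp (cls {0, i.succ} (even_pair (Fin.succ_ne_zero i).symm))
      (cls {0, j.succ} (even_pair (Fin.succ_ne_zero j).symm))
    have h5 : ({0, i.succ} ∩ {0, j.succ} : Finset (Fin 8)) = {0} := by
      ext a
      simp only [Finset.mem_inter, Finset.mem_insert, Finset.mem_singleton]
      constructor
      · rintro ⟨h | rfl, h' | h'⟩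
        · exact h
        · exact h
        · exact h'
        · exact absurd (Fin.succ_injective _ h') hij
      · rintro rfl
        simp
    rw [hfT, hfT, pairing_cls, pairing_cls, h5, Finset.card_singleton, Nat.cast_one,
      ZMod.natCast_eq_one_iff_odd, Nat.odd_iff] at h4
    have h6 := Finset.card_le_card (Finset.inter_subset_left (s₁ := T i) (s₂ := T j))
    rw [h2] at h6
    omega
  -- The seven pairs through label 0 are sent to seven pairs through a common label `c`. Then `c` is
  -- the image of 0, and the other ends are the images of the remaining labels.
  obtain ⟨c, hc⟩ := exists_forall_mem_of_card_inter h2 h3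
  have h4 : ∀ i, ∃ v, v ≠ c ∧ T i = {c, v} := fun i => by
    obtain ⟨a, b, hab, h⟩ := Finset.card_eq_two.1 (h2 i)
    have h5 := hc i
    rw [h, Finset.mem_insert, Finset.mem_singleton] at h5
    rcases h5 with rfl | rfl
    · exact ⟨b, hab.symm, h⟩
    · exact ⟨a, hab, by rw [h, Finset.pair_comm]⟩
  choose v hvc hv using h4
  have hinj : Function.Injective (Fin.cons c v : Fin 8 → Fin 8) := by
    rw [Fin.cons_injective_iff]
    refine ⟨by rintro ⟨i, hi⟩; exact hvc i hi, fun i j hij => ?_⟩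
    by_contra hne
    have h6 := h3 i j hne
    rw [hv i, hv j, hij, Finset.inter_self, Finset.card_pair (hvc j).symm] at h6
    omega
  refine ⟨Equiv.ofBijective _ (Finite.injective_iff_bijective.1 hinj), linearMap_ext fun i => ?_⟩
  rw [hfT, permE3_cls]
  refine cls_congr ?_ _
  rw [hv, Finset.image_insert, Finset.image_singleton]
  rfl

/-- Every symplectic map is a relabelling, possibly followed by one transvection. -/
lemma IsSymplectic.exists_decomposition {τ : E3 ≃ₗ[ZMod 2] E3} (hτ : IsSymplectic τ) :
    ∃ ρ : Equiv.Perm (Fin 8), τ.toLinearMap = permE3 ρ ∨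
      ∃ (S : Finset (Fin 8)) (hS : S.card = 4),
        τ.toLinearMap = transvection (cls S (hS ▸ by decide)) ∘ₗ permE3 ρ := by
  obtain ⟨u, hu, h⟩ := hτ.exists_quadForm_eq
  -- The transvection in `u` compensates the change of the quadratic form under `τ`. It is an
  -- involution, so it can be moved to the other side.
  obtain ⟨ρ, hρ⟩ := exists_eq_permE3 (f := transvection u ∘ₗ τ.toLinearMap)
    (fun x y => by
      rw [LinearMap.comp_apply, LinearMap.comp_apply, pairing_transvection]
      exact hτ x y)
    (fun x => by
      rw [LinearMap.comp_apply, quadForm_transvection hu]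
      exact (h x).symm)
  have h1 : τ.toLinearMap = transvection u ∘ₗ permE3 ρ := by
    rw [← hρ]
    refine LinearMap.ext fun x => ?_
    exact (transvection_transvection u _).symm
  refine ⟨ρ, ?_⟩
  rcases quadForm_eq_zero hu with rfl | ⟨S, hS, rfl⟩
  · left
    rw [h1]
    refine LinearMap.ext fun x => ?_
    rw [LinearMap.comp_apply, transvection_apply, smul_zero, add_zero]
  · exact Or.inr ⟨S, hS, h1⟩

end Symplectic

/-! ### Compatibility of blocks and pictures with relabellings and Cremona transformations. -/

section Action

lemma permE3_mul (σ ρ : Equiv.Perm (Fin 8)) : permE3 (σ * ρ) = permE3 σ ∘ₗ permE3 ρ := by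
  refine LinearMap.ext fun x => ?_
  obtain ⟨T, hT, rfl⟩ := exists_cls x
  rw [LinearMap.comp_apply, permE3_cls, permE3_cls, permE3_cls]
  exact cls_congr (by rw [Finset.image_image]; rfl) _

lemma permE3_one : permE3 1 = LinearMap.id := by
  refine LinearMap.ext fun x => ?_
  obtain ⟨T, hT, rfl⟩ := exists_cls x
  rw [permE3_cls]
  exact cls_congr (by simp) _

lemma permE3_inv_comp (r : Equiv.Perm (Fin 8)) : permE3 r⁻¹ ∘ permE3 r = id := by
  rw [← LinearMap.coe_comp, ← permE3_mul, inv_mul_cancel, permE3_one]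
  rfl

/-- Conjugating a transvection by an isometry gives the transvection in the transported vector. The
tables speak of the standard labelling, so the quadruple must be carried there by `σ`. -/
lemma transvection_permE3 {S : Finset (Fin 8)} (hS : Even S.card) (σ : Equiv.Perm (Fin 8)) :
    transvection (cls S hS) ∘ permE3 σ =
      permE3 σ ∘ transvection (cls (S.image σ.symm) (even_image σ.symm hS)) := by
  funext x
  obtain ⟨T, hT, rfl⟩ := exists_cls x
  have h1 : S = (S.image σ.symm).image σ := by
    rw [Finset.image_image, Equiv.self_comp_symm, Finset.image_id]
  have h2 : (T.image σ ∩ S).card = (T ∩ S.image σ.symm).card := by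
    conv_lhs => rw [h1]
    rw [← Finset.image_inter _ _ σ.injective, card_image_perm]
  simp only [Function.comp_apply]
  rw [permE3_cls, transvection_cls, transvection_cls, map_add, map_smul, permE3_cls, permE3_cls, h2]
  congr 2
  exact cls_congr h1 _

variable {L : Type*} [Field L] {ν : AddValuation L (WithTop ℚ)}

/-- The auxiliary relabelling `r` preserves the picture of the shape, so `σ * r⁻¹` and `σ` give the
same picture. -/
lemma HasShape.exists_block {z : Fin 8 → Fin 4 → L} {O : Octad L} (hz : IsLift z O)
    (hr : IsRegular z) (hO : IsNormalised O) {m : ℚ} (hm : 0 < m) {t : Shape}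
    {σ : Equiv.Perm (Fin 8)} (h : HasShape ν z m t σ) :
    ∃ B : Block, B.blockClass = t.blockClass ∧ HasValuationData ν O (m • B.valData) ∧
      B.picture = mapPicture (permE3 σ) (pictureOfMasks t.picture) := by
  obtain ⟨b, c, r, rfl, hc, hs, hv⟩ := h.exists_hasValuationData hz hr hO hm
  refine ⟨⟨b, σ * r⁻¹⟩, b.shape_blockClass.symm, hv, ?_⟩
  have h1 := Shape.mapPicture_of_samePicture hc hs
  rw [Block.picture_eq]
  conv_lhs => rw [← h1]
  rw [mapPicture_comp, permE3_mul, LinearMap.coe_comp, Function.comp_assoc, permE3_inv_comp,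
    Function.comp_id]

lemma exists_block_of_pglEquiv [IsAlgClosed L] {O O' : Octad L} {x : Fin 8 → Fin 4 → L}
    (hx : IsLift x O) (hr : IsRegular x) (hn : IsNetBase x) {m : ℚ} (hm : 0 < m) {t : Shape}
    {σ : Equiv.Perm (Fin 8)} (h : HasShape ν x m t σ) (hO : PGLEquiv O O')
    (hO' : IsNormalised O') : IsCayleyOctad O' ∧
      ∃ B : Block, B.blockClass = t.blockClass ∧ HasValuationData ν O' (m • B.valData) ∧
        B.picture = mapPicture (permE3 σ) (pictureOfMasks t.picture) := by
  obtain ⟨M, hM, hz⟩ := hO.exists_lift hx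
  exact ⟨(hr.mulVec hM).isCayleyOctad (hn.mulVec hM) hz,
    (h.mulVec hr hM).exists_block hz (hr.mulVec hM) hO' hm⟩

/-- The relabelling `r` of the table enters the picture, and `r⁻¹` enters the labelling of the
image; they cancel and leave the transvection. -/
lemma exists_block_of_cremonaRel [IsAlgClosed L] {O O' : Octad L} {x : Fin 8 → Fin 4 → L}
    (hx : IsLift x O) (hr : IsRegular x) (hn : IsNetBase x) {m : ℚ} (hm : 0 < m) {t : Shape}
    {σ : Equiv.Perm (Fin 8)} (h : HasShape ν x m t σ) {S : Finset (Fin 8)} (hS : S.card = 4)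
    (hO : CremonaRel S O O') (hO' : IsNormalised O') : IsCayleyOctad O' ∧
      ∃ B : Block, B.blockClass = t.blockClass ∧ HasValuationData ν O' (m • B.valData) ∧
        B.picture = mapPicture (transvection (cls S (hS ▸ by decide)) ∘ permE3 σ)
          (pictureOfMasks t.picture) := by
  obtain ⟨z, t', c, r, hz, hzr, hzn, hzs, hcl, hrc, hpic⟩ := hO.exists_hasShape hS hx hr hn h
  obtain ⟨B, h1, h2, h3⟩ := hzs.exists_block hz hzr hO' hm
  refine ⟨hzr.isCayleyOctad hzn hz, B, h1.trans hcl, h2, ?_⟩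
  have hSe : Even S.card := hS ▸ by decide
  have hSi := even_image σ.symm hSe
  have key : pictureOfMasks t'.picture = mapPicture (permE3 r ∘
      transvection (cls (S.image σ.symm) hSi)) (pictureOfMasks t.picture) := by
    rcases hpic with hp | hp
    · exact (Shape.mapPicture_transvection hrc hSi hp).symm
    · rw [← cls_compl hSi]
      exact (Shape.mapPicture_transvection hrc (even_compl hSi) hp).symm
  rw [h3, key, mapPicture_comp, transvection_permE3, permE3_mul, LinearMap.coe_comp,
    Function.comp_assoc, ← Function.comp_assoc (permE3 r⁻¹), permE3_inv_comp, Function.id_comp]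

end Action

end CayleyOctad

end

/-! ### Assembly of the theorem. -/

theorem mainTheorem3 {K : Type*} [Field K] [ValuativeRel K] [TopologicalSpace K]
    [IsNonarchimedeanLocalField K] (hK : (2 : K) ≠ 0)
    {L : Type*} [Field L] [Algebra K L] [IsAlgClosure K L]
    (ν : AddValuation L (WithTop ℚ)) (hν : CayleyOctad.IsNormalisedExtension K ν)
    (O : CayleyOctad.Octad L) (hO : CayleyOctad.IsCayleyOctad O)
    (m : ℚ) (hm : 0 < m) (B : CayleyOctad.Block)
    (hB : CayleyOctad.HasValuationData ν O (m • B.valData))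
    (τ : CayleyOctad.E3 ≃ₗ[ZMod 2] CayleyOctad.E3) (hτ : CayleyOctad.IsSymplectic τ) :
    (∃ O' : CayleyOctad.Octad L, CayleyOctad.SpImage τ O O' ∧ CayleyOctad.IsNormalised O') ∧
    ∀ O' : CayleyOctad.Octad L, CayleyOctad.SpImage τ O O' → CayleyOctad.IsNormalised O' →
      CayleyOctad.IsCayleyOctad O' ∧
      ∃ B' : CayleyOctad.Block, B'.blockClass = B.blockClass ∧
        CayleyOctad.HasValuationData ν O' (m • B'.valData) ∧
        B'.picture = (fun X => τ '' X) '' B.picture := by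
  have : IsAlgClosed L := IsAlgClosure.isAlgClosed K
  obtain ⟨x, hx, hr, hn, hs⟩ := hB.exists_hasShape hO hm
  have hrρ := fun ρ : Equiv.Perm (Fin 8) => hr.comp ρ.symm
  refine ⟨?_, ?_⟩
  · obtain ⟨ρ, h | ⟨S, hS, h⟩⟩ := hτ.exists_decomposition
    · obtain ⟨O', h1, h2⟩ := (hrρ ρ).general.exists_pglEquiv_normalised (hx.comp ρ)
      exact ⟨O', ⟨ρ, Or.inl ⟨h, h1⟩⟩, h2⟩
    · obtain ⟨O', h1, h2⟩ := (hrρ ρ).general.exists_cremonaRel_normalised (hx.comp ρ) hS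
      exact ⟨O', ⟨ρ, Or.inr ⟨S, hS, h, h1⟩⟩, h2⟩
  · rintro O' ⟨ρ, ⟨h, h1⟩ | ⟨S, hS, h, h1⟩⟩ hO'
    · obtain ⟨h2, B', h3, h4, h5⟩ := CayleyOctad.exists_block_of_pglEquiv (hx.comp ρ) (hrρ ρ)
        (hn.comp ρ.symm) hm (hs.comp hr ρ) h1 hO'
      refine ⟨h2, B', h3.trans B.type.shape_blockClass, h4, ?_⟩
      have h6 : ⇑τ = CayleyOctad.permE3 ρ := congrArg DFunLike.coe h
      change _ = CayleyOctad.mapPicture τ B.picture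
      rw [h5, B.picture_eq, CayleyOctad.mapPicture_comp, h6, CayleyOctad.permE3_mul,
        LinearMap.coe_comp]
    · obtain ⟨h2, B', h3, h4, h5⟩ := CayleyOctad.exists_block_of_cremonaRel (hx.comp ρ) (hrρ ρ)
        (hn.comp ρ.symm) hm (hs.comp hr ρ) hS h1 hO'
      refine ⟨h2, B', h3.trans B.type.shape_blockClass, h4, ?_⟩
      have h6 : ⇑τ = CayleyOctad.transvection _ ∘ CayleyOctad.permE3 ρ :=
        congrArg DFunLike.coe h
      change _ = CayleyOctad.mapPicture τ B.picture
      rw [h5, B.picture_eq, CayleyOctad.mapPicture_comp, h6, CayleyOctad.permE3_mul,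
        LinearMap.coe_comp, Function.comp_assoc]
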